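/- Let $R\subset\mathfrak a^*$ be a (crystallographic, possibly non-reduced) root system in the dual of a Euclidean space $\mathfrak a$, with Weyl group $W$, weight lattice $P=\{\lambda : \lambda(\alpha^\vee)\in\mathbb Z\ \forall\alpha\in R\}$, coroot lattice $Q^\vee\subset\mathfrak a$, simple roots $\Pi$, positive roots $R^+$, and simple reflections $S$. Let $k=(k_\alpha)_{\alpha\in R}$ be $W$-invariant with $k_\alpha\ge 0$. On the group algebra $\mathbb C[P]$ (with $W$ acting by $we^\lambda=e^{w\lambda}$), viewed as the Laurent polynomials on the compact torus $T=i\mathfrak a/2\pi iQ^\vee$ with Haar measure $dt$, put $$(\phi,\psi)_k=\int_T\overline{\phi(t)}\,\psi(t)\prod_{\alpha\in R}\bigl|e^{\alpha/2}(t)-e^{-\alpha/2}(t)\bigr|^{k_\alpha}dt .$$ For $\lambda\in P$ let $\lambda_+$ be the dominant weight in $W\lambda$ and $\overline v(\lambda)\in W$ the shortest element with $\overline v(\lambda)\lambda_+=\lambda$. Write $\lambda\preceq\mu$ if $\mu-\lambda\in\sum_{\alpha\in\Pi}\mathbb Z_{\ge0}\alpha$, and $\lambda\le\mu$ if $\lambda_+\preceq\mu_+$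 and, in case $\lambda_+=\mu_+$, $\overline v(\lambda)\le_W\overline v(\mu)$ in the Bruhat order; $\mu<\lambda$ means $\mu\le\lambda$ and $\mu\ne\lambda$. For $I\subset S$ let $W_I=\langle I\rangle$, let $R_I^+\subset R^+$ be the positive roots of the parabolic subsystem belonging to $W_I$, $P_I^+=\{\lambda\in P : \lambda(\alpha^\vee)\ge0\ \forall\alpha\in R_I^+\}$, $P^+=P_S^+$, and $m_I(\lambda)=\sum_{\mu\in W_I\lambda}e^\mu$. For $\lambda\in P_I^+$ the Jacobi polynomial $p_I(\lambda,k)\in\mathbb C[P]^{W_I}$ is defined by $p_I(\lambda,k)=m_I(\lambda)+\sum_{\mu\in P_I^+,\,\mu<\lambda}c_{\lambda,\mu}m_I(\mu)$ and $(p_I(\lambda,k),m_I(\mu))_k=0$ for all $\mu\in P_I^+$ with $\mu<\lambda$. For $\lambda\in P$ the non-symmetric Heckman–Opdam polynomial $E(\lambda,k)$ is defined by $E(\lambda,k)=e^\lambda+\sum_{\mu<\lambda}c_{\lambda,\mu}e^\mu$ and $(E(\lambda,k),e^\mu)_k=0$ for all $\mu<\lambda$. For $\lambda\in P^+$ the $W$-invariant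 polynomial $P(\lambda,k)$ is defined by $P(\lambda,k)=m_S(\lambda)+\sum_{\mu\in P^+,\,\mu\preceq\lambda,\,\mu\neq\lambda}c_{\lambda,\mu}m_S(\mu)$ and $(P(\lambda,k),m_S(\mu))_k=0$ for all $\mu\in P^+$ with $\mu\preceq\lambda$, $\mu\ne\lambda$. Proposition. These conditions determine $E(\lambda,k)$, $P(\lambda,k)$ and $p_I(\lambda,k)$ uniquely, and such polynomials exist. For all $I\subset S$ and $\lambda\in P_I^+$, $$p_I(\lambda,k)=\sum_{w\in (W_I)^\lambda}wE(\lambda,k),$$ where $(W_I)^\lambda$ is the set of $w\in W_I$ of minimal length in their coset $wW_{I,\lambda}$, with $W_{I,\lambda}$ the stabilizer of $\lambda$ in $W_I$. Moreover $P_\emptyset^+=P$ and $p_\emptyset(\lambda,k)=E(\lambda,k)$ for all $\lambda\in P$, and $p_S(\lambda,k)=P(\lambda,k)$ for all $\lambda\in P^+$. -/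

import Mathlib

open MeasureTheory

noncomputable section

namespace HeckmanOpdam

section Lattices

variable {ι M N : Type*} [AddCommGroup M] [Module ℝ M] [AddCommGroup N] [Module ℝ N]

/-- A set of simple roots of a (possibly non-reduced) root system: the simple roots are linearly
independent and every root is a combination of simple roots with non-negative integral
coefficients, or the negative of such a combination. -/
structure SimpleRoots (P : RootPairing ι ℝ M N) where
  support : Set ι
  linearIndepOn_root : LinearIndepOn ℝ P.root support
  root_mem_or_neg_mem (i : ι) : P.root i ∈ AddSubmonoid.closure (P.root '' support) ∨
    -P.root i ∈ AddSubmonoid.closure (P.root '' support)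

/-- The coroot lattice `Q^∨`. -/
def corootLattice (P : RootPairing ι ℝ M N) : AddSubgroup N :=
  AddSubgroup.closure (Set.range P.coroot)

/-- The weight lattice: all `x` such that `⟨x, α^∨⟩` is an integer for all roots `α`. -/
def weightLattice (P : RootPairing ι ℝ M N) : AddSubgroup M where
  carrier := {x | ∀ i, ∃ n : ℤ, P.toLinearMap x (P.coroot i) = n}
  zero_mem' i := ⟨0, by simp⟩
  add_mem' {x y} hx hy i := by
    obtain ⟨m, hm⟩ := hx i
    obtain ⟨n, hn⟩ := hy i
    exact ⟨m + n, by simp [hm, hn]⟩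
  neg_mem' {x} hx i := by
    obtain ⟨m, hm⟩ := hx i
    exact ⟨-m, by simp [hm]⟩

/-- A root, as an element of the weight lattice. -/
def rootWeight (P : RootPairing ι ℝ M N) [P.IsCrystallographic] (i : ι) : weightLattice P :=
  ⟨P.root i, fun j => by
    obtain ⟨n, hn⟩ := P.exists_value (S := ℤ) i j
    exact ⟨n, by simpa using hn.symm⟩⟩

/-- The Weyl group preserves the weight lattice. -/
theorem smul_mem_weightLattice (P : RootPairing ι ℝ M N) (w : P.weylGroup) {x : M}
    (hx : x ∈ weightLattice P) : w • x ∈ weightLattice P := by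
  obtain ⟨g, hg⟩ := w
  change g • x ∈ weightLattice P
  induction hg using RootPairing.weylGroup.induction generalizing x with
  | mem j =>
    intro i
    obtain ⟨n, hn⟩ := hx (P.reflectionPerm j i)
    refine ⟨n, ?_⟩
    rw [RootPairing.Equiv.reflection_smul]
    exact (P.coroot'_reflection x).trans hn
  | one => simpa using hx
  | mul g₁ g₂ _ _ h₁ h₂ => rw [mul_smul]; exact h₁ (h₂ hx)

instance (P : RootPairing ι ℝ M N) : DistribMulAction P.weylGroup (weightLattice P) where
  smul w x := ⟨w • (x : M), smul_mem_weightLattice P w x.2⟩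
  one_smul x := Subtype.ext (one_smul P.weylGroup (x : M))
  mul_smul v w x := Subtype.ext (mul_smul v w (x : M))
  smul_zero w := Subtype.ext (smul_zero (A := M) w)
  smul_add w x y := Subtype.ext (smul_add w (x : M) (y : M))

/-- The Weyl group of a finite root system is finite, so that all sums below are finite. -/
theorem finite_weylGroup (P : RootPairing ι ℝ M N) [Finite ι] [P.IsRootSystem] :
    Finite P.weylGroup := by
  refine Finite.of_injective (fun w : P.weylGroup => P.weylGroupToPerm w) ?_
  intro v w h
  refine Subtype.ext (RootPairing.Equiv.weightHom_injective P ?_)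
  ext x
  have key : ∀ x ∈ Submodule.span ℝ (Set.range P.root), (v • x : M) = w • x := by
    intro x hx
    induction hx using Submodule.span_induction with
    | mem x hx =>
      obtain ⟨i, rfl⟩ := hx
      rw [P.weylGroup_apply_root, P.weylGroup_apply_root]
      exact congrArg (fun e : Equiv.Perm ι => P.root (e i)) h
    | zero => simp
    | add x y _ _ hx hy => rw [smul_add, smul_add, hx, hy]
    | smul a x _ hx =>
      have e : ∀ u : P.weylGroup, u • (a • x) = a • (u • x) := fun u =>
        smul_comm (u : P.Aut) a x
      rw [e, e, hx]
  exact key x (by rw [RootPairing.IsRootSystem.span_root_eq_top]; trivial)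

end Lattices

section Combinatorics

variable {ι M N : Type*} [AddCommGroup M] [Module ℝ M] [AddCommGroup N] [Module ℝ N]
variable {P : RootPairing ι ℝ M N} (b : SimpleRoots P)

/-- The positive roots `R⁺`. -/
def SimpleRoots.IsPos (i : ι) : Prop :=
  P.root i ∈ AddSubmonoid.closure (P.root '' b.support)

/-- The cone `Q⁺` of non-negative integral combinations of simple roots. -/
def SimpleRoots.rootCone : AddSubmonoid M := AddSubmonoid.closure (P.root '' b.support)

/-- The parabolic subgroup `W_I` generated by the reflections in the roots in `I`. -/
def parabolic (P : RootPairing ι ℝ M N) (I : Set ι) : Subgroup P.weylGroup :=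
  Subgroup.closure (RootPairing.weylGroup.ofIdx P '' I)

/-- The positive roots `R_I⁺` of the parabolic subsystem generated by the simple roots in `I`. -/
def SimpleRoots.posRoots (I : Set ι) : Set ι :=
  {i | P.root i ∈ Submodule.span ℝ (P.root '' I) ∧ b.IsPos i}

/-- The set `P_I⁺` of weights that are dominant for `R_I⁺`. -/
def SimpleRoots.relDominant (I : Set ι) : Set (weightLattice P) :=
  {x | ∀ i ∈ b.posRoots I, 0 ≤ P.toLinearMap (x : M) (P.coroot i)}

/-- The set `P⁺` of dominant weights. -/
def SimpleRoots.dominant : Set (weightLattice P) :=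
  {x | ∀ i, b.IsPos i → 0 ≤ P.toLinearMap (x : M) (P.coroot i)}

/-- The length of an element of the Weyl group with respect to the simple reflections. -/
def SimpleRoots.length (w : P.weylGroup) : ℕ :=
  sInf {n | ∃ l : List ι, (∀ i ∈ l, i ∈ b.support) ∧ l.length = n ∧
    (l.map (RootPairing.weylGroup.ofIdx P)).prod = w}

/-- The Bruhat order on the Weyl group. -/
def SimpleRoots.bruhatLE : P.weylGroup → P.weylGroup → Prop :=
  Relation.ReflTransGen fun u w =>
    (∃ i, w = RootPairing.weylGroup.ofIdx P i * u) ∧ b.length u < b.length w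

/-- Every Weyl group orbit of weights contains a dominant weight. -/
theorem SimpleRoots.exists_dominant [Finite ι] [P.IsRootSystem] (x : weightLattice P) :
    ∃ y ∈ MulAction.orbit P.weylGroup x, y ∈ b.dominant := by
  have := finite_weylGroup P
  obtain ⟨f, hf⟩ : ∃ f : M →ₗ[ℝ] ℝ, ∀ i ∈ b.support, f (P.root i) = 1 := by
    have h := b.linearIndepOn_root.linearIndependent
    obtain ⟨f, hf⟩ := ((Module.Basis.span h).constr ℝ (fun _ => (1 : ℝ))).exists_extend
    refine ⟨f, fun i hi => ?_⟩
    have h1 := LinearMap.congr_fun hf (Module.Basis.span h ⟨i, hi⟩)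
    rw [Module.Basis.constr_basis] at h1
    simpa [Module.Basis.span_apply] using h1
  have hpos : ∀ z ∈ AddSubmonoid.closure (P.root '' b.support), z = 0 ∨ 0 < f z := by
    intro z hz
    induction hz using AddSubmonoid.closure_induction with
    | mem z hz =>
      obtain ⟨i, hi, rfl⟩ := hz
      exact Or.inr (by rw [hf i hi]; exact one_pos)
    | zero => exact Or.inl rfl
    | add y z _ _ hy hz =>
      rcases hy with rfl | hy
      · simpa using hz
      · rcases hz with rfl | hz
        · exact Or.inr (by simpa using hy)
        · exact Or.inr (by rw [map_add]; exact add_pos hy hz)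
  obtain ⟨w, hw⟩ := Finite.exists_max fun w : P.weylGroup => f ((w • x : weightLattice P) : M)
  refine ⟨w • x, ⟨w, rfl⟩, fun i hi => ?_⟩
  by_contra hneg
  rw [not_le] at hneg
  have h1 := hw (RootPairing.weylGroup.ofIdx P i * w)
  have h2 : ((RootPairing.weylGroup.ofIdx P i * w) • x : weightLattice P) =
      P.reflection i ((w • x : weightLattice P) : M) := by
    rw [mul_smul]; rfl
  have h3 : 0 < f (P.root i) := (hpos _ hi).resolve_left (P.ne_zero i)
  rw [h2, P.reflection_apply, map_sub, map_smul, smul_eq_mul] at h1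
  have h4 : P.toLinearMap ((w • x : weightLattice P) : M) (P.coroot i) * f (P.root i) < 0 :=
    mul_neg_of_neg_of_pos hneg h3
  have h5 : P.coroot' i ((w • x : weightLattice P) : M) =
    P.toLinearMap ((w • x : weightLattice P) : M) (P.coroot i) := rfl
  rw [h5] at h1
  linarith

/-- The dominant weight `x₊` in the Weyl group orbit of `x`. -/
def SimpleRoots.domRep [Finite ι] [P.IsRootSystem] (x : weightLattice P) : weightLattice P :=
  (b.exists_dominant x).choose

theorem SimpleRoots.domRep_spec [Finite ι] [P.IsRootSystem] (x : weightLattice P) :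
    b.domRep x ∈ MulAction.orbit P.weylGroup x ∧ b.domRep x ∈ b.dominant :=
  (b.exists_dominant x).choose_spec

theorem SimpleRoots.exists_shortest [Finite ι] [P.IsRootSystem] (x : weightLattice P) :
    ∃ w : P.weylGroup, w • b.domRep x = x ∧
      ∀ u : P.weylGroup, u • b.domRep x = x → b.length w ≤ b.length u := by
  obtain ⟨w, hw⟩ := (b.domRep_spec x).1
  have hne : {u : P.weylGroup | u • b.domRep x = x}.Nonempty :=
    ⟨w⁻¹, by rw [Set.mem_ofPred_eq, ← hw]; exact inv_smul_smul w x⟩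
  exact ⟨Function.argminOn b.length _ hne, Function.argminOn_mem b.length _ hne,
    fun u hu => Function.argminOn_le b.length {u : P.weylGroup | u • b.domRep x = x} hu⟩

/-- The shortest element `v̄(x)` of the Weyl group that sends `x₊` to `x`. -/
def SimpleRoots.vbar [Finite ι] [P.IsRootSystem] (x : weightLattice P) : P.weylGroup :=
  (b.exists_shortest x).choose

theorem SimpleRoots.vbar_spec [Finite ι] [P.IsRootSystem] (x : weightLattice P) :
    b.vbar x • b.domRep x = x ∧
      ∀ u : P.weylGroup, u • b.domRep x = x → b.length (b.vbar x) ≤ b.length u :=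
  (b.exists_shortest x).choose_spec

/-- The dominance order: `x ⪯ y` if and only if `y - x ∈ Q⁺`. -/
def SimpleRoots.domLE (x y : weightLattice P) : Prop := ((y - x : weightLattice P) : M) ∈ b.rootCone

/-- Heckman's partial order on the weight lattice. -/
def SimpleRoots.weightLE [Finite ι] [P.IsRootSystem] (x y : weightLattice P) : Prop :=
  b.domLE (b.domRep x) (b.domRep y) ∧
    (b.domRep x = b.domRep y → b.bruhatLE (b.vbar x) (b.vbar y))

/-- The set `(W_I)^x` of those elements of `W_I` that have minimal length in their coset with
respect to the stabilizer of `x` in `W_I`. -/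
def SimpleRoots.minCosetReps (I : Set ι) (x : weightLattice P) : Set P.weylGroup :=
  {w | w ∈ parabolic P I ∧ ∀ u ∈ parabolic P I, u • x = x → b.length w ≤ b.length (w * u)}

end Combinatorics

section LaurentPolynomials

variable {ι M N : Type*} [AddCommGroup M] [Module ℝ M] [AddCommGroup N] [Module ℝ N]

/-- The group algebra `ℂ[P]` of the weight lattice. -/
abbrev Laurent (P : RootPairing ι ℝ M N) : Type _ := AddMonoidAlgebra ℂ (weightLattice P)

/-- The basis element `e^x` of the group algebra. -/
def expW {P : RootPairing ι ℝ M N} (x : weightLattice P) : Laurent P := AddMonoidAlgebra.single x 1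

/-- The action of the Weyl group on the group algebra, `w e^x = e^{w x}`. -/
def act {P : RootPairing ι ℝ M N} (w : P.weylGroup) (p : Laurent P) : Laurent P :=
  AddMonoidAlgebra.mapDomain (fun x => w • x) p

/-- The sum of `e^y` over the orbit of `x` under a subgroup of the Weyl group. -/
def orbitSum {P : RootPairing ι ℝ M N} (H : Subgroup P.weylGroup) (x : weightLattice P) :
    Laurent P :=
  ∑ᶠ y ∈ MulAction.orbit H x, expW y

end LaurentPolynomials

section Torus

variable {ι M N : Type*} [AddCommGroup M] [Module ℝ M] [NormedAddCommGroup N] [NormedSpace ℝ N]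

/-- The compact torus `T`, realised as the quotient of the ambient space of the coroots by the
coroot lattice. The class of `h` corresponds to the point `exp(2πi h)`. -/
def Torus (P : RootPairing ι ℝ M N) : Type _ := N ⧸ corootLattice P

instance (P : RootPairing ι ℝ M N) : AddCommGroup (Torus P) :=
  inferInstanceAs (AddCommGroup (N ⧸ corootLattice P))

instance (P : RootPairing ι ℝ M N) : TopologicalSpace (Torus P) :=
  inferInstanceAs (TopologicalSpace (N ⧸ corootLattice P))

instance (P : RootPairing ι ℝ M N) : IsTopologicalAddGroup (Torus P) :=
  inferInstanceAs (IsTopologicalAddGroup (N ⧸ corootLattice P))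

instance (P : RootPairing ι ℝ M N) : MeasurableSpace (Torus P) := borel _

instance (P : RootPairing ι ℝ M N) : BorelSpace (Torus P) := ⟨rfl⟩

/-- A weight takes integral values on the coroot lattice. -/
theorem corootLattice_le_comap (P : RootPairing ι ℝ M N) (x : weightLattice P) :
    corootLattice P ≤ (AddSubgroup.zmultiples (1 : ℝ)).comap
      (P.toLinearMap (x : M)).toAddMonoidHom := by
  rw [corootLattice, AddSubgroup.closure_le]
  rintro _ ⟨i, rfl⟩
  obtain ⟨n, hn⟩ := x.2 i
  exact ⟨n, by simpa using hn.symm⟩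

/-- The homomorphism from the torus to `ℝ/ℤ` that is induced by a weight. -/
def weightHom (P : RootPairing ι ℝ M N) (x : weightLattice P) : Torus P →+ AddCircle (1 : ℝ) :=
  QuotientAddGroup.map (corootLattice P) (AddSubgroup.zmultiples (1 : ℝ))
    (P.toLinearMap (x : M)).toAddMonoidHom (corootLattice_le_comap P x)

/-- The value of the character `e^x` at a point of the torus: `e^{2πi⟨x, h⟩}` at the class
of `h`. -/
def character (P : RootPairing ι ℝ M N) (x : weightLattice P) (t : Torus P) : ℂ :=
  (AddCircle.toCircle (weightHom P x t) : ℂ)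

theorem character_mk (P : RootPairing ι ℝ M N) (x : weightLattice P) (h : N) :
    character P x (QuotientAddGroup.mk h : N ⧸ corootLattice P) =
      Complex.exp (2 * Real.pi * Complex.I * (P.toLinearMap (x : M) h : ℝ)) := by
  change ((AddCircle.toCircle ((P.toLinearMap (x : M) h : ℝ) : AddCircle (1 : ℝ)) : Circle) : ℂ) = _
  rw [AddCircle.toCircle_apply_mk, Circle.coe_exp]
  congr 1
  push_cast
  ring

/-- The value of a Laurent polynomial at a point of the torus. -/
def evalTorus (P : RootPairing ι ℝ M N) (p : Laurent P) (t : Torus P) : ℂ :=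
  p.coeff.sum fun x c => c * character P x t

/-- The weight function `δ_k`, the product over all roots `α` of `|e^{α/2} - e^{-α/2}|^{k_α}`.
Note that `|e^{α/2} - e^{-α/2}| = |1 - e^α|` on the compact torus. -/
def delta (P : RootPairing ι ℝ M N) [Fintype ι] [P.IsCrystallographic] (k : ι → ℝ) (t : Torus P) :
    ℝ :=
  ∏ i, ‖1 - character P (rootWeight P i) t‖ ^ (k i)

/-- The Hermitian inner product `(p, q)_k`, with respect to a Haar measure on the torus. -/
def innerK (P : RootPairing ι ℝ M N) [Fintype ι] [P.IsCrystallographic] (k : ι → ℝ)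
    (vol : Measure (Torus P)) (p q : Laurent P) : ℂ :=
  ∫ t, (starRingEnd ℂ) (evalTorus P p t) * evalTorus P q t * (delta P k t : ℂ) ∂vol

variable {P : RootPairing ι ℝ M N} [Fintype ι] [P.IsRootSystem] [P.IsCrystallographic]
variable (b : SimpleRoots P) (k : ι → ℝ) (vol : Measure (Torus P))

/-- The non-symmetric Heckman-Opdam polynomial `E(x, k)`. -/
structure IsNonsymmetric (x : weightLattice P) (E : Laurent P) : Prop where
  triangular : E - expW x ∈
    Submodule.span ℂ (expW '' {y : weightLattice P | b.weightLE y x ∧ y ≠ x})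
  orthogonal : ∀ y : weightLattice P, b.weightLE y x → y ≠ x → innerK P k vol E (expW y) = 0

/-- The `W`-invariant Heckman-Opdam polynomial (Jacobi polynomial) `P(x, k)`, for a dominant
weight `x`. -/
structure IsSymmetric (x : weightLattice P) (p : Laurent P) : Prop where
  triangular : p - orbitSum ⊤ x ∈
    Submodule.span ℂ (orbitSum ⊤ '' {y : weightLattice P | y ∈ b.dominant ∧ b.domLE y x ∧ y ≠ x})
  orthogonal : ∀ y ∈ b.dominant, b.domLE y x → y ≠ x → innerK P k vol p (orbitSum ⊤ y) = 0

/-- The `W_I`-invariant Jacobi polynomial `p_I(x, k)`, for a weight `x ∈ P_I⁺`. -/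
structure IsJacobi (I : Set ι) (x : weightLattice P) (p : Laurent P) : Prop where
  invariant : ∀ w ∈ parabolic P I, act w p = p
  triangular : p - orbitSum (parabolic P I) x ∈
    Submodule.span ℂ (orbitSum (parabolic P I) ''
      {y : weightLattice P | y ∈ b.relDominant I ∧ b.weightLE y x ∧ y ≠ x})
  orthogonal : ∀ y ∈ b.relDominant I, b.weightLE y x → y ≠ x →
    innerK P k vol p (orbitSum (parabolic P I) y) = 0

end Torus

end HeckmanOpdam

end

set_option linter.unusedSectionVars false

/-! For `k ≥ 0` the form `(·,·)_k` is positive definite on `ℂ[P]`, because `∏ (1 - e^α)` is a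
nonzero element of a domain, and only finitely many weights lie below a given one. Each of the three
families therefore consists of a leading term minus its orthogonal projection onto the span of
finitely many lower terms (`existsUnique_projection`). This settles existence and uniqueness, and
reduces the main identity to showing that `∑ w E(x)` meets the conditions that define `p_I(x)`
(`IsNonsymmetric.isJacobi_sum`).

By uniqueness `E(x)` is fixed by the stabilizer of `x` in `W_I`, so up to a nonzero factor the sum
over minimal representatives is the sum over all of `W_I`. Triangularity holds since every
`W_I`-orbit has a smallest element, which is dominant for `R_I⁺`. Orthogonality reduces, by
invariance of the form, to `E(x) ⟂ m_I(y)` for `y < x` in `P_I⁺`. The definition of `E(x)` does not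
give this directly: when `y` lies in `W x`, the translates `w y` with `w ∈ W_I` need not lie below
`x`.

The missing orthogonality comes from the Cherednik operators `∂_ξ + ∑_{α > 0} k_α α(ξ) (1 -
e^{-α})⁻¹ (1 - s_α)`. They are triangular for the order, and symmetric for the form
(`innerK_cherednik`, an integration by parts on the torus). So every `E(x)` is a joint eigenfunction
(`IsNonsymmetric.cherednik_eq`), and distinct weights of one Weyl orbit have distinct real spectra
(`spectralVector_injOn_orbit`). Thus `E(x) ⟂ E(z)` for all `z ≠ x` in `W x`, comparable or not, and
a triangular induction gives `E(x) ⟂ e^z` unless `z ≥ x` (`IsNonsymmetric.inner_expW_eq_zero`).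
Finally, if `x ≤ w y` in one Weyl orbit with `w ∈ W_I` and `x ∈ P_I⁺`, the lifting property of the
Bruhat order gives `x ≤ y` (`SimpleRoots.orbitLE.parabolic_smul`), which contradicts `y < x`.

In the extreme cases, `W_∅` is trivial, and on dominant weights the order `≤` coincides with `⪯`. -/

noncomputable section

namespace HeckmanOpdam

/-! ### Reflections, positive roots and parabolic subsystems -/

section RootCombinatorics

variable {ι M N : Type*} [AddCommGroup M] [Module ℝ M] [AddCommGroup N] [Module ℝ N]
variable {P : RootPairing ι ℝ M N}

/-- The reflection in a root, as an element of the Weyl group. -/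
abbrev refl (P : RootPairing ι ℝ M N) (i : ι) : P.weylGroup := RootPairing.weylGroup.ofIdx P i

/-- The pairing of a vector with a coroot. -/
abbrev pr (P : RootPairing ι ℝ M N) (x : M) (i : ι) : ℝ := P.toLinearMap x (P.coroot i)

theorem root_smul (w : P.weylGroup) (i : ι) : P.root (w • i) = w • P.root i :=
  (P.weylGroup_apply_root w i).symm

theorem refl_smul (i : ι) (x : M) : refl P i • x = x - pr P x i • P.root i :=
  P.reflection_apply i x

theorem refl_smul_idx (i j : ι) : refl P i • j = P.reflectionPerm i j := by
  apply P.root.injective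
  rw [root_smul, P.root_reflectionPerm]; rfl

theorem weylGroup_ext {v w : P.weylGroup} (h : ∀ x : M, v • x = w • x) : v = w :=
  Subtype.ext (RootPairing.Equiv.weightHom_injective P (LinearEquiv.ext h))

@[simp] theorem refl_mul_self (i : ι) : refl P i * refl P i = 1 :=
  weylGroup_ext fun x => by
    rw [mul_smul, one_smul]
    exact P.reflection_same i x

@[simp] theorem refl_inv (i : ι) : (refl P i)⁻¹ = refl P i :=
  inv_eq_of_mul_eq_one_left (refl_mul_self i)

@[simp] theorem refl_mul_cancel_left (i : ι) (w : P.weylGroup) : refl P i * (refl P i * w) = w := by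
  rw [← mul_assoc, refl_mul_self, one_mul]

@[simp] theorem refl_mul_cancel_right (i : ι) (w : P.weylGroup) : w * refl P i * refl P i = w := by
  rw [mul_assoc, refl_mul_self, mul_one]

@[simp] theorem refl_smul_smul {X : Type*} [MulAction P.weylGroup X] (i : ι) (x : X) :
    refl P i • refl P i • x = x := by
  rw [← mul_smul, refl_mul_self, one_smul]

theorem weyl_smul_smul (w : P.weylGroup) (c : ℝ) (x : M) : w • (c • x) = c • (w • x) :=
  smul_comm (w : P.Aut) c x

theorem pr_smul_smul (w : P.weylGroup) (x : M) (i : ι) : pr P (w • x) (w • i) = pr P x i := by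
  obtain ⟨g, hg⟩ := w
  change pr P (g • x) (g • i) = _
  induction hg using RootPairing.weylGroup.induction generalizing x i with
  | mem j =>
    have h1 : RootPairing.Equiv.reflection P j • i = P.reflectionPerm j i := refl_smul_idx j i
    rw [RootPairing.Equiv.reflection_smul, h1]
    have := P.coroot'_reflection (i := j) (j := P.reflectionPerm j i) x
    rw [P.reflectionPerm_self] at this
    exact this
  | one => simp
  | mul g₁ g₂ _ _ h₁ h₂ => rw [mul_smul, mul_smul, h₁, h₂]

theorem pr_smul (w : P.weylGroup) (x : M) (i : ι) : pr P (w • x) i = pr P x (w⁻¹ • i) := by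
  rw [← pr_smul_smul w x, smul_inv_smul]

theorem refl_conj (w : P.weylGroup) (i : ι) : refl P (w • i) = w * refl P i * w⁻¹ :=
  weylGroup_ext fun x => by
    rw [refl_smul, mul_smul, mul_smul, refl_smul, smul_sub, smul_inv_smul, root_smul,
      weyl_smul_smul, pr_smul, inv_inv]

/-- Throughout, `refl P i • i` serves as the index of the root `-α`, where `α` has index `i`. -/
theorem refl_smul_self_idx_root (i : ι) : P.root (refl P i • i) = -P.root i := by
  rw [refl_smul_idx, P.root_reflectionPerm, P.reflection_apply_self]

theorem pr_neg_idx (x : M) (i : ι) : pr P x (refl P i • i) = -pr P x i := by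
  have h := pr_smul (refl P i) x i
  rw [refl_inv] at h
  rw [← h, refl_smul]
  simp only [pr, map_sub, map_smul, LinearMap.sub_apply, LinearMap.smul_apply, smul_eq_mul,
    P.root_coroot_two]
  ring

theorem refl_neg_idx (i : ι) : refl P (refl P i • i) = refl P i := by
  rw [refl_conj]; simp

theorem smul_neg_idx (w : P.weylGroup) (i : ι) :
    w • (refl P i • i) = refl P (w • i) • (w • i) := by
  rw [refl_conj, ← mul_smul, ← mul_smul]
  simp

/-- Coroots scale inversely to roots. In a non-reduced system this is the substitute for the
equality of proportional positive roots. -/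
theorem refl_eq_of_root_eq_smul [Finite ι] [P.IsRootSystem] {i j : ι} {c : ℝ}
    (h : P.root i = c • P.root j) : refl P i = refl P j := by
  have : IsAddTorsionFree N := .of_isTorsionFree ℝ N
  have hc := P.smul_coroot_eq_of_root_eq_smul j i c h
  refine weylGroup_ext fun x => ?_
  rw [refl_smul, refl_smul, h, smul_smul]
  congr 2
  simp only [pr]
  rw [← hc, map_smul, smul_eq_mul, mul_comm]

/-- A linear functional that vanishes on the simple roots in `I` and is one on the others. -/
theorem SimpleRoots.exists_functional (b : SimpleRoots P) (I : Set ι) :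
    ∃ f : M →ₗ[ℝ] ℝ, ∀ i ∈ b.support, (i ∈ I → f (P.root i) = 0) ∧ (i ∉ I → f (P.root i) = 1) := by
  classical
  have h := b.linearIndepOn_root.linearIndependent
  obtain ⟨f, hf⟩ := ((Module.Basis.span h).constr ℝ
    (fun i => if (i : ι) ∈ I then (0 : ℝ) else 1)).exists_extend
  have key : ∀ i ∈ b.support, f (P.root i) = if i ∈ I then (0 : ℝ) else 1 := fun i hi => by
    have h1 := LinearMap.congr_fun hf (Module.Basis.span h ⟨i, hi⟩)
    rw [Module.Basis.constr_basis] at h1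
    simpa [Module.Basis.span_apply] using h1
  exact ⟨f, fun i hi => ⟨fun h => by rw [key i hi, if_pos h], fun h => by rw [key i hi, if_neg h]⟩⟩

/-- The functional `f` is non-negative on the cone of positive combinations and vanishes exactly on
the face generated by `I`. -/
theorem SimpleRoots.rootCone_face (b : SimpleRoots P) {I : Set ι} {f : M →ₗ[ℝ] ℝ}
    (hf : ∀ i ∈ b.support, (i ∈ I → f (P.root i) = 0) ∧ (i ∉ I → f (P.root i) = 1))
    {z : M} (hz : z ∈ b.rootCone) :
    0 ≤ f z ∧ (f z = 0 → z ∈ AddSubmonoid.closure (P.root '' I)) := by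
  rw [SimpleRoots.rootCone] at hz
  induction hz using AddSubmonoid.closure_induction with
  | mem z hz =>
    obtain ⟨i, hi, rfl⟩ := hz
    by_cases h : i ∈ I
    · exact ⟨((hf i hi).1 h).ge, fun _ => AddSubmonoid.subset_closure ⟨i, h, rfl⟩⟩
    · rw [(hf i hi).2 h]
      exact ⟨zero_le_one, fun h => absurd h one_ne_zero⟩
  | zero => exact ⟨by simp, fun _ => zero_mem _⟩
  | add y z _ _ hy hz =>
    rw [map_add]
    refine ⟨add_nonneg hy.1 hz.1, fun h => add_mem (hy.2 ?_) (hz.2 ?_)⟩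
    · linarith [hy.1, hz.1]
    · linarith [hy.1, hz.1]

/-- The height: the linear functional that is one on all simple roots. -/
def SimpleRoots.height (b : SimpleRoots P) : M →ₗ[ℝ] ℝ := (b.exists_functional ∅).choose

theorem SimpleRoots.height_root (b : SimpleRoots P) {i : ι} (hi : i ∈ b.support) :
    b.height (P.root i) = 1 :=
  ((b.exists_functional ∅).choose_spec i hi).2 (by simp)

theorem SimpleRoots.height_nonneg (b : SimpleRoots P) {z : M} (hz : z ∈ b.rootCone) :
    0 ≤ b.height z := (b.rootCone_face (b.exists_functional ∅).choose_spec hz).1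

theorem SimpleRoots.eq_zero_of_height (b : SimpleRoots P) {z : M} (hz : z ∈ b.rootCone)
    (h : b.height z = 0) : z = 0 := by
  simpa using (b.rootCone_face (b.exists_functional ∅).choose_spec hz).2 h

theorem SimpleRoots.IsPos.height_pos {b : SimpleRoots P} {i : ι} (hi : b.IsPos i) :
    0 < b.height (P.root i) :=
  (b.height_nonneg hi).lt_of_ne' fun h => P.ne_zero i (b.eq_zero_of_height hi h)

theorem SimpleRoots.isPos_of_mem (b : SimpleRoots P) {i : ι} (hi : i ∈ b.support) : b.IsPos i :=
  AddSubmonoid.subset_closure ⟨i, hi, rfl⟩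

theorem SimpleRoots.isPos_neg_iff (b : SimpleRoots P) {i : ι} :
    b.IsPos (refl P i • i) ↔ ¬ b.IsPos i := by
  constructor
  · intro h h'
    have := h.height_pos
    rw [refl_smul_self_idx_root, map_neg] at this
    linarith [h'.height_pos]
  · intro h
    rw [SimpleRoots.IsPos, refl_smul_self_idx_root]
    exact (b.root_mem_or_neg_mem i).resolve_left h

theorem SimpleRoots.not_isPos_neg_iff (b : SimpleRoots P) {i : ι} :
    ¬ b.IsPos (refl P i • i) ↔ b.IsPos i := by
  rw [b.isPos_neg_iff, not_not]

theorem closure_root_le_span (I : Set ι) {z : M} (hz : z ∈ AddSubmonoid.closure (P.root '' I)) :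
    z ∈ Submodule.span ℝ (P.root '' I) :=
  Submodule.closure_subset_span hz

theorem SimpleRoots.mem_closure_of_mem_span (b : SimpleRoots P) {I : Set ι} (hI : I ⊆ b.support)
    {z : M} (hz : z ∈ b.rootCone) (hz' : z ∈ Submodule.span ℝ (P.root '' I)) :
    z ∈ AddSubmonoid.closure (P.root '' I) := by
  obtain ⟨f, hf⟩ := b.exists_functional I
  refine (b.rootCone_face hf hz).2 ?_
  have : Submodule.span ℝ (P.root '' I) ≤ LinearMap.ker f := by
    rw [Submodule.span_le]
    rintro _ ⟨i, hi, rfl⟩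
    exact (hf i (hI hi)).1 hi
  exact this hz'

/-- A simple reflection permutes the positive roots that are not proportional to the simple
root. -/
theorem SimpleRoots.exists_eq_smul (b : SimpleRoots P) {i j : ι} (hj : j ∈ b.support)
    (hi : b.IsPos i) (hij : ¬ b.IsPos (refl P j • i)) : ∃ c : ℝ, P.root i = c • P.root j := by
  obtain ⟨f, hf⟩ := b.exists_functional {j}
  have h0 := b.rootCone_face hf hi
  have h1 := (b.rootCone_face hf (b.isPos_neg_iff.2 hij)).1
  have hfj : f (P.root j) = 0 := (hf j hj).1 rfl
  -- As `f` kills the simple root `j`, it takes the same value on `α` and `s_j α`. With both `α` and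
  -- `-s_j α` positive this value is zero, which puts `α` on the ray of the simple root.
  rw [refl_smul_self_idx_root, root_smul, refl_smul, map_neg, map_sub, map_smul, hfj] at h1
  have h2 := h0.2 (le_antisymm (by simpa using h1) h0.1)
  have h3 := closure_root_le_span _ h2
  rw [Set.image_singleton, Submodule.mem_span_singleton] at h3
  obtain ⟨c, hc⟩ := h3
  exact ⟨c, hc.symm⟩

theorem SimpleRoots.refl_eq (b : SimpleRoots P) [Finite ι] [P.IsRootSystem] {i j : ι}
    (hj : j ∈ b.support) (hi : b.IsPos i) (hij : ¬ b.IsPos (refl P j • i)) :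
    refl P i = refl P j := by
  obtain ⟨c, hc⟩ := b.exists_eq_smul hj hi hij
  exact refl_eq_of_root_eq_smul hc

theorem SimpleRoots.mem_posRoots_support (b : SimpleRoots P) {i : ι} :
    i ∈ b.posRoots b.support ↔ b.IsPos i :=
  ⟨fun h => h.2, fun h => ⟨closure_root_le_span _ h, h⟩⟩

theorem SimpleRoots.mem_posRoots_of_mem (b : SimpleRoots P) {I : Set ι} (hI : I ⊆ b.support)
    {j : ι} (hj : j ∈ I) : j ∈ b.posRoots I :=
  ⟨Submodule.subset_span ⟨j, hj, rfl⟩, b.isPos_of_mem (hI hj)⟩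

theorem smul_mem_span_of_mem_parabolic {I : Set ι} {w : P.weylGroup} (hw : w ∈ parabolic P I)
    {x : M} (hx : x ∈ Submodule.span ℝ (P.root '' I)) :
    w • x ∈ Submodule.span ℝ (P.root '' I) := by
  rw [parabolic] at hw
  induction hw using Subgroup.closure_induction'' generalizing x with
  | one => simpa using hx
  | mem w hw =>
    obtain ⟨i, hi, rfl⟩ := hw
    rw [refl_smul]
    exact sub_mem hx (Submodule.smul_mem _ _ (Submodule.subset_span ⟨i, hi, rfl⟩))
  | inv_mem w hw =>
    obtain ⟨i, hi, rfl⟩ := hw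
    rw [refl_inv, refl_smul]
    exact sub_mem hx (Submodule.smul_mem _ _ (Submodule.subset_span ⟨i, hi, rfl⟩))
  | mul v w _ _ hv hw => rw [mul_smul]; exact hv (hw hx)

theorem refl_mem_parabolic {I : Set ι} {j : ι} (hj : j ∈ I) : refl P j ∈ parabolic P I :=
  Subgroup.subset_closure ⟨j, hj, rfl⟩

variable [Finite ι]

/-- Induction over the positive roots of a parabolic subsystem. -/
theorem SimpleRoots.posRoots_induction (b : SimpleRoots P) [P.IsCrystallographic]
    {I : Set ι} (hI : I ⊆ b.support) {Q : ι → Prop}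
    (h1 : ∀ i ∈ b.posRoots I, ∀ j ∈ I, ∀ c : ℝ, 0 < c → P.root i = c • P.root j → Q i)
    (h2 : ∀ i ∈ b.posRoots I, ∀ j ∈ I, 0 < pr P (P.root j) i → refl P j • i ∈ b.posRoots I →
      Q (refl P j • i) → Q i) {i : ι} (hi : i ∈ b.posRoots I) : Q i := by
  have hwf : WellFounded fun i j : ι => b.height (P.root i) < b.height (P.root j) := by
    have : IsTrans ι fun i j : ι => b.height (P.root i) < b.height (P.root j) :=
      ⟨fun _ _ _ => lt_trans⟩
    have : Std.Irrefl fun i j : ι => b.height (P.root i) < b.height (P.root j) :=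
      ⟨fun _ => lt_irrefl _⟩
    exact Finite.wellFounded_of_trans_of_irrefl _
  induction i using hwf.induction with
  | _ i ih =>
  obtain ⟨j, hj, hji⟩ : ∃ j ∈ I, 0 < pr P (P.root j) i := by
    -- Otherwise `α`, a non-negative combination of the simple roots in `I`, would pair
    -- non-positively with its own coroot; but that pairing is `2`.
    by_contra! hneg
    have : ∀ z ∈ AddSubmonoid.closure (P.root '' I), pr P z i ≤ 0 := by
      intro z hz
      induction hz using AddSubmonoid.closure_induction with
      | mem z hz => obtain ⟨j, hj, rfl⟩ := hz; exact hneg j hj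
      | zero => simp [pr]
      | add y z _ _ hy hz =>
        simp only [pr, map_add, LinearMap.add_apply] at *
        linarith
    have h := this _ (b.mem_closure_of_mem_span hI hi.2 hi.1)
    rw [pr, P.root_coroot_two] at h
    linarith
  have hij : 0 < pr P (P.root i) j := by
    have := (P.zero_lt_pairingIn_iff' ℝ (i := j) (j := i)).1
      (by have := P.algebraMap_pairingIn ℝ j i; simp only [Algebra.algebraMap_self,
            RingHom.id_apply] at this; rw [this]; exact hji)
    have h' := P.algebraMap_pairingIn ℝ i j
    simp only [Algebra.algebraMap_self, RingHom.id_apply] at h'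
    rw [h'] at this; exact this
  by_cases hp : b.IsPos (refl P j • i)
  · have hm : refl P j • i ∈ b.posRoots I :=
      ⟨by rw [root_smul]; exact smul_mem_span_of_mem_parabolic (refl_mem_parabolic hj) hi.1, hp⟩
    -- The reflection `s_j` lowers the height of `α` by `⟨α, α_j^∨⟩ > 0`.
    refine h2 i hi j hj hji hm (ih _ ?_ hm)
    rw [root_smul, refl_smul, map_sub, map_smul, b.height_root (hI hj), smul_eq_mul, mul_one]
    linarith
  · obtain ⟨c, hc⟩ := b.exists_eq_smul (hI hj) hi.2 hp
    refine h1 i hi j hj c ?_ hc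
    have := hi.2.height_pos
    rw [hc, map_smul, b.height_root (hI hj)] at this
    simpa using this

theorem SimpleRoots.refl_mem_parabolic_of_mem_posRoots (b : SimpleRoots P) [P.IsRootSystem] [P.IsCrystallographic]
    {I : Set ι} (hI : I ⊆ b.support) {i : ι} (hi : i ∈ b.posRoots I) :
    refl P i ∈ parabolic P I := by
  refine b.posRoots_induction hI (Q := fun i => refl P i ∈ parabolic P I) ?_ ?_ hi
  · intro i hi j hj c hc h
    rw [refl_eq_of_root_eq_smul h]
    exact refl_mem_parabolic hj
  · intro i hi j hj _ _ h
    have := mul_mem (mul_mem (refl_mem_parabolic hj) h) (refl_mem_parabolic hj)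
    rw [refl_conj] at this
    simpa [mul_assoc] using this

/-- The Weyl group is generated by the simple reflections. -/
theorem SimpleRoots.parabolic_support (b : SimpleRoots P) [P.IsRootSystem] [P.IsCrystallographic] :
    parabolic P b.support = ⊤ := by
  have key : ∀ i, refl P i ∈ parabolic P b.support := fun i => by
    by_cases hi : b.IsPos i
    · exact b.refl_mem_parabolic_of_mem_posRoots subset_rfl (b.mem_posRoots_support.2 hi)
    · rw [← refl_neg_idx]
      exact b.refl_mem_parabolic_of_mem_posRoots subset_rfl
        (b.mem_posRoots_support.2 (b.isPos_neg_iff.2 hi))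
  rw [eq_top_iff]
  rintro ⟨g, hg⟩ -
  induction hg using RootPairing.weylGroup.induction with
  | mem i => exact key i
  | one => exact one_mem _
  | mul x y hx hy h1 h2 => exact mul_mem h1 h2

/-- Vectors whose pairings with the simple coroots in `I` are non-negative are dominant
for `R_I⁺`. -/
theorem SimpleRoots.pr_nonneg_of_simple (b : SimpleRoots P) [P.IsCrystallographic] {I : Set ι}
    (hI : I ⊆ b.support) {x : M} (hx : ∀ j ∈ I, 0 ≤ pr P x j) {i : ι} (hi : i ∈ b.posRoots I) :
    0 ≤ pr P x i := by
  have : IsAddTorsionFree N := .of_isTorsionFree ℝ N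
  refine b.posRoots_induction hI (Q := fun i => 0 ≤ pr P x i) ?_ ?_ hi
  · intro i hi j hj c hc h
    have h' := P.smul_coroot_eq_of_root_eq_smul j i c h
    have h3 := hx j hj
    simp only [pr] at *
    rw [← h', map_smul, smul_eq_mul] at h3
    exact nonneg_of_mul_nonneg_right h3 hc
  -- Here `⟨x, α^∨⟩ = ⟨x, (s_j α)^∨⟩ + ⟨x, α_j^∨⟩ ⟨α_j, α^∨⟩`, and every term on the right is
  -- non-negative.
  · intro i hi j hj hp _ h
    have h' := pr_smul (refl P j) x i
    rw [refl_inv] at h'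
    rw [← h', refl_smul] at h
    simp only [pr, map_sub, map_smul, LinearMap.sub_apply, LinearMap.smul_apply,
      smul_eq_mul] at *
    nlinarith [hx j hj, mul_nonneg (hx j hj) hp.le]

end RootCombinatorics

/-! ### Length, exchange and minimal coset representatives -/

section Length

variable {ι M N : Type*} [AddCommGroup M] [Module ℝ M] [AddCommGroup N] [Module ℝ N]
variable {P : RootPairing ι ℝ M N}

theorem mem_parabolic_iff_exists_word {I : Set ι} {w : P.weylGroup} :
    w ∈ parabolic P I ↔ ∃ l : List ι, (∀ i ∈ l, i ∈ I) ∧ (l.map (refl P)).prod = w := by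
  constructor
  · intro hw
    rw [parabolic] at hw
    induction hw using Subgroup.closure_induction with
    | one => exact ⟨[], by simp, by simp⟩
    | mem w hw =>
      obtain ⟨i, hi, rfl⟩ := hw
      exact ⟨[i], by simpa using hi, by simp⟩
    | inv w _ h =>
      obtain ⟨l, hl, rfl⟩ := h
      refine ⟨l.reverse, by simpa using hl, ?_⟩
      rw [List.prod_inv_reverse, List.map_reverse, List.map_map]
      congr 2
      exact List.map_congr_left fun i _ => (refl_inv i).symm
    | mul v w _ _ hv hw =>
      obtain ⟨l, hl, rfl⟩ := hv
      obtain ⟨l', hl', rfl⟩ := hw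
      refine ⟨l ++ l', fun i hi => ?_, by simp⟩
      rcases List.mem_append.1 hi with h | h
      · exact hl i h
      · exact hl' i h
  · rintro ⟨l, hl, rfl⟩
    refine list_prod_mem fun w hw => ?_
    obtain ⟨i, hi, rfl⟩ := List.mem_map.1 hw
    exact refl_mem_parabolic (hl i hi)

variable (b : SimpleRoots P)

theorem SimpleRoots.length_le {l : List ι} (hl : ∀ i ∈ l, i ∈ b.support) :
    b.length (l.map (refl P)).prod ≤ l.length :=
  Nat.sInf_le ⟨l, hl, rfl, rfl⟩

variable [Finite ι] [P.IsRootSystem] [P.IsCrystallographic]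

/-- Since the simple reflections generate `W`, the infimum that defines the length is over a
nonempty set, so it is attained and is not the default value `0`. -/
theorem SimpleRoots.exists_reduced_word (w : P.weylGroup) :
    ∃ l : List ι, (∀ i ∈ l, i ∈ b.support) ∧ l.length = b.length w ∧
      (l.map (refl P)).prod = w := by
  have hw : w ∈ parabolic P b.support := by rw [b.parabolic_support]; trivial
  obtain ⟨l, hl, h⟩ := mem_parabolic_iff_exists_word.1 hw
  exact Nat.sInf_mem (s := {n | ∃ l : List ι, (∀ i ∈ l, i ∈ b.support) ∧ l.length = n ∧
    (l.map (RootPairing.weylGroup.ofIdx P)).prod = w}) ⟨_, l, hl, rfl, h⟩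

/-- The strong exchange property. -/
theorem SimpleRoots.exchange (l : List ι) (hl : ∀ i ∈ l, i ∈ b.support) (i : ι) (hi : b.IsPos i)
    (h : ¬ b.IsPos ((l.map (refl P)).prod⁻¹ • i)) :
    ∃ l' : List ι, l'.length + 1 = l.length ∧ (∀ j ∈ l', j ∈ l) ∧
      (l'.map (refl P)).prod = refl P i * (l.map (refl P)).prod := by
  induction l generalizing i with
  | nil => exact absurd hi (by simpa using h)
  | cons j l ih =>
    have hj := hl j (by simp)
    rw [List.map_cons, List.prod_cons, mul_inv_rev, refl_inv, mul_smul] at h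
    -- If `s_j α` is still positive, a letter is deleted further on in the word. If not, `α` is
    -- proportional to the simple root `j`, so `s_α = s_j` and the first letter is the one to
    -- delete.
    by_cases hp : b.IsPos (refl P j • i)
    · obtain ⟨l', h1, h2, h3⟩ := ih (fun i hi => hl i (by simp [hi])) _ hp h
      refine ⟨j :: l', by simpa using h1, ?_, ?_⟩
      · intro a ha
        rcases List.mem_cons.1 ha with rfl | ha
        · simp
        · exact List.mem_cons_of_mem _ (h2 a ha)
      · rw [List.map_cons, List.prod_cons, h3, refl_conj, List.map_cons, List.prod_cons, refl_inv]
        simp only [mul_assoc, refl_mul_cancel_left]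
    · refine ⟨l, by simp, fun a ha => List.mem_cons_of_mem _ ha, ?_⟩
      rw [b.refl_eq hj hi hp, List.map_cons, List.prod_cons, refl_mul_cancel_left]

theorem SimpleRoots.length_refl_mul_lt {w : P.weylGroup} {i : ι} (hi : b.IsPos i)
    (h : ¬ b.IsPos (w⁻¹ • i)) : b.length (refl P i * w) < b.length w := by
  obtain ⟨l, hl, h1, rfl⟩ := b.exists_reduced_word w
  obtain ⟨l', h2, h3, h4⟩ := b.exchange l hl i hi h
  rw [← h4, ← h1, ← h2, Nat.lt_succ_iff]
  exact b.length_le fun j hj => hl j (h3 j hj)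

theorem SimpleRoots.length_lt_refl_mul {w : P.weylGroup} {i : ι} (hi : b.IsPos i)
    (h : b.IsPos (w⁻¹ • i)) : b.length w < b.length (refl P i * w) := by
  have := b.length_refl_mul_lt (w := refl P i * w) hi (by
    rw [mul_inv_rev, refl_inv, mul_smul, smul_neg_idx, b.not_isPos_neg_iff]; exact h)
  rwa [refl_mul_cancel_left] at this

/-- The left-handed version applies to the positive root `-w α`, because `w s_α = s_{wα} w`. -/
theorem SimpleRoots.length_mul_refl_lt {w : P.weylGroup} {i : ι} (hi : b.IsPos i)
    (h : ¬ b.IsPos (w • i)) : b.length (w * refl P i) < b.length w := by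
  have h2 := b.length_refl_mul_lt (w := w) (b.isPos_neg_iff.2 h) (by
    rw [← smul_neg_idx, inv_smul_smul, b.not_isPos_neg_iff]; exact hi)
  rwa [refl_neg_idx, refl_conj, inv_mul_cancel_right] at h2

theorem SimpleRoots.exists_descent {I : Set ι} (hI : I ⊆ b.support) {w : P.weylGroup}
    (hw : w ∈ parabolic P I) (h1 : w ≠ 1) : ∃ j ∈ I, ¬ b.IsPos (w⁻¹ • j) := by
  obtain ⟨l₀, hl₀⟩ := mem_parabolic_iff_exists_word.1 hw
  -- The word is taken shortest among words with letters in `I`, so no comparison with the length in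
  -- all of `W` is needed. Were its first letter not a descent, exchange would give a shorter word,
  -- still with letters in `I`.
  obtain ⟨l, ⟨hl, hlw⟩, hmin⟩ := exists_minimal_of_wellFoundedLT
    (fun n => ∃ l : List ι, ((∀ i ∈ l, i ∈ I) ∧ (l.map (refl P)).prod = w) ∧ l.length = n)
    ⟨_, l₀, hl₀, rfl⟩ |>.elim fun n hn => by
      obtain ⟨l, hl, rfl⟩ := hn.prop
      exact (⟨l, hl, fun l' hl' => not_lt.1 fun hlt =>
        absurd (hn.le_of_le ⟨l', hl', rfl⟩ hlt.le) (not_le.2 hlt)⟩ :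
        ∃ l : List ι, ((∀ i ∈ l, i ∈ I) ∧ (l.map (refl P)).prod = w) ∧
          ∀ l' : List ι, ((∀ i ∈ l', i ∈ I) ∧ (l'.map (refl P)).prod = w) →
            l.length ≤ l'.length)
  cases l with
  | nil => exact absurd hlw.symm (by simpa using h1)
  | cons j l =>
    refine ⟨j, hl j (by simp), fun hp => ?_⟩
    have hj : b.IsPos j := b.isPos_of_mem (hI (hl j (by simp)))
    rw [← hlw, List.map_cons, List.prod_cons, mul_inv_rev, refl_inv, mul_smul, smul_neg_idx,
      b.isPos_neg_iff] at hp
    obtain ⟨l', h2, h3, h4⟩ := b.exchange l (fun i hi => hI (hl i (by simp [hi]))) j hj hp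
    have := hmin l' ⟨fun i hi => hl i (by simp [h3 i hi]), by rw [h4, ← hlw]; simp⟩
    simp at this
    omega

theorem SimpleRoots.exists_right_descent {I : Set ι} (hI : I ⊆ b.support) {w : P.weylGroup}
    (hw : w ∈ parabolic P I) (h1 : w ≠ 1) : ∃ j ∈ I, ¬ b.IsPos (w • j) := by
  simpa using b.exists_descent hI (inv_mem hw) (inv_ne_one.2 h1)

/-- If `x` and `w x` are both dominant for `R_I⁺`, with `w ∈ W_I`, then every right descent of `w`
is orthogonal to `x`. -/
theorem SimpleRoots.pr_eq_zero_of_descent {I : Set ι} (hI : I ⊆ b.support) {w : P.weylGroup}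
    (hw : w ∈ parabolic P I) {x : M} (hx : ∀ i ∈ b.posRoots I, 0 ≤ pr P x i)
    (hwx : ∀ i ∈ b.posRoots I, 0 ≤ pr P (w • x) i) {j : ι} (hj : j ∈ I)
    (h : ¬ b.IsPos (w • j)) : pr P x j = 0 := by
  refine le_antisymm ?_ (hx j (b.mem_posRoots_of_mem hI hj))
  -- The root `-w α_j` lies in `R_I⁺`, and its coroot pairs with `w x` to `-⟨x, α_j^∨⟩`.
  have h2 : refl P (w • j) • (w • j) ∈ b.posRoots I := by
    refine ⟨?_, b.isPos_neg_iff.2 h⟩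
    rw [refl_smul_self_idx_root, root_smul]
    exact neg_mem (smul_mem_span_of_mem_parabolic hw (Submodule.subset_span ⟨j, hj, rfl⟩))
  have h3 := hwx _ h2
  rw [pr_neg_idx, pr_smul_smul] at h3
  linarith

/-- If `x` and `w x` are both dominant for `R_I⁺`, with `w ∈ W_I`, then `w` is a product of simple
reflections in `I` that fix `x`. -/
theorem SimpleRoots.mem_parabolic_of_dominant {I : Set ι} (hI : I ⊆ b.support) {w : P.weylGroup}
    (hw : w ∈ parabolic P I) {x : M} (hx : ∀ i ∈ b.posRoots I, 0 ≤ pr P x i)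
    (hwx : ∀ i ∈ b.posRoots I, 0 ≤ pr P (w • x) i) :
    w ∈ parabolic P {j ∈ I | pr P x j = 0} := by
  induction hn : b.length w using Nat.strong_induction_on generalizing w with
  | _ n ih =>
  subst hn
  by_cases h1 : w = 1
  · rw [h1]; exact one_mem _
  obtain ⟨j, hj, h⟩ := b.exists_right_descent hI hw h1
  have h0 := b.pr_eq_zero_of_descent hI hw hx hwx hj h
  have hmem : refl P j ∈ parabolic P {j ∈ I | pr P x j = 0} := refl_mem_parabolic ⟨hj, h0⟩
  have := ih _ (b.length_mul_refl_lt (b.isPos_of_mem (hI hj)) h)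
    (mul_mem hw (refl_mem_parabolic hj))
    (by rw [mul_smul, refl_smul, h0, zero_smul, sub_zero]; exact hwx) rfl
  simpa using mul_mem this hmem

theorem smul_eq_of_mem_parabolic {J : Set ι} {w : P.weylGroup} (hw : w ∈ parabolic P J) {x : M}
    (hJ : ∀ j ∈ J, pr P x j = 0) : w • x = x := by
  have : parabolic P J ≤ MulAction.stabilizer P.weylGroup x := by
    rw [parabolic, Subgroup.closure_le]
    rintro _ ⟨j, hj, rfl⟩
    change refl P j • x = x
    rw [refl_smul, hJ j hj, zero_smul, sub_zero]
  exact this hw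

theorem SimpleRoots.smul_eq_of_dominant {I : Set ι} (hI : I ⊆ b.support) {w : P.weylGroup}
    (hw : w ∈ parabolic P I) {x : M} (hx : ∀ i ∈ b.posRoots I, 0 ≤ pr P x i)
    (hwx : ∀ i ∈ b.posRoots I, 0 ≤ pr P (w • x) i) : w • x = x :=
  smul_eq_of_mem_parabolic (b.mem_parabolic_of_dominant hI hw hx hwx) fun _ hj => hj.2

/-- Elements of minimal length in a coset of the stabilizer in `W_I` of a vector that is dominant
for `R_I⁺` are unique. -/
theorem SimpleRoots.eq_one_of_minimal {I : Set ι} (hI : I ⊆ b.support) {w u : P.weylGroup}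
    {x : M} (hx : ∀ i ∈ b.posRoots I, 0 ≤ pr P x i) (hu : u ∈ parabolic P I) (hux : u • x = x)
    (hw : ∀ v ∈ parabolic P I, v • x = x → b.length w ≤ b.length (w * v))
    (hwu : ∀ v ∈ parabolic P I, v • x = x → b.length (w * u) ≤ b.length (w * u * v)) : u = 1 := by
  by_contra h1
  obtain ⟨j, hj, h⟩ := b.exists_right_descent hI hu h1
  have h0 := b.pr_eq_zero_of_descent hI hu hx (by rwa [hux]) hj h
  have hjx : refl P j • x = x := by rw [refl_smul, h0, zero_smul, sub_zero]
  have h2 : b.IsPos ((w * u) • j) := by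
    by_contra h2
    exact absurd (b.length_mul_refl_lt (b.isPos_of_mem (hI hj)) h2)
      (not_lt.2 (hwu _ (refl_mem_parabolic hj) hjx))
  -- The root `β = -u α_j` is positive and `w β = -w u α_j` is negative, so `w s_β` is shorter than
  -- `w`. Since `s_β = u s_j u⁻¹` fixes `x`, this contradicts the minimality of `w`.
  have h3 : ¬ b.IsPos (w • (refl P (u • j) • (u • j))) := by
    rw [smul_neg_idx, b.not_isPos_neg_iff, ← mul_smul]; exact h2
  refine absurd (b.length_mul_refl_lt (b.isPos_neg_iff.2 h) h3) (not_lt.2 ?_)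
  rw [refl_neg_idx, refl_conj]
  refine hw _ (mul_mem (mul_mem hu (refl_mem_parabolic hj)) (inv_mem hu)) ?_
  rw [mul_smul, mul_smul, inv_smul_eq_iff.2 hux.symm, hjx, hux]

end Length

/-! ### The orders on Weyl orbits and on the weight lattice -/

section Orders

variable {ι M N : Type*} [AddCommGroup M] [Module ℝ M] [AddCommGroup N] [Module ℝ N]
variable {P : RootPairing ι ℝ M N} (b : SimpleRoots P)

@[simp] theorem coe_weyl_smul (w : P.weylGroup) (x : weightLattice P) :
    ((w • x : weightLattice P) : M) = w • (x : M) := rfl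

/-- The pairing of a weight with a coroot, as an integer. -/
def ipr (x : weightLattice P) (i : ι) : ℤ := (x.2 i).choose

theorem ipr_cast (x : weightLattice P) (i : ι) : (ipr x i : ℝ) = pr P (x : M) i :=
  (x.2 i).choose_spec.symm

theorem refl_smul_weight [P.IsCrystallographic] (i : ι) (x : weightLattice P) :
    refl P i • x = x - ipr x i • rootWeight P i := by
  refine Subtype.ext ?_
  rw [coe_weyl_smul, refl_smul, ← ipr_cast, AddSubgroup.coe_sub, AddSubgroup.coe_zsmul,
    Int.cast_smul_eq_zsmul]
  rfl

theorem SimpleRoots.relDominant_support : b.relDominant b.support = b.dominant := by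
  ext x
  exact ⟨fun h i hi => h i (b.mem_posRoots_support.2 hi),
    fun h i hi => h i (b.mem_posRoots_support.1 hi)⟩

/-- A reflection that increases a weight in the order on its Weyl group orbit for which the
dominant weight is the smallest. -/
def SimpleRoots.orbitStep (y x : weightLattice P) : Prop :=
  ∃ i, b.IsPos i ∧ x = refl P i • y ∧ 0 < pr P (y : M) i

/-- The order on Weyl group orbits of weights that is generated by reflections. -/
def SimpleRoots.orbitLE : weightLattice P → weightLattice P → Prop :=
  Relation.ReflTransGen b.orbitStep

variable {b}

/-- Every step subtracts a positive integral multiple of a positive root. -/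
theorem SimpleRoots.orbitLE.sub_mem {x y : weightLattice P} (h : b.orbitLE y x) :
    ((y - x : weightLattice P) : M) ∈ b.rootCone := by
  induction h with
  | refl => simp
  | @tail x x' _ hs ih =>
    obtain ⟨i, hi, rfl, hp⟩ := hs
    have : ((y - refl P i • x : weightLattice P) : M) =
        ((y - x : weightLattice P) : M) + (ipr x i).toNat • P.root i := by
      have hn : ((ipr x i).toNat : ℝ) = pr P (x : M) i := by
        rw [← ipr_cast] at hp ⊢
        have h1 : 0 < ipr x i := by exact_mod_cast hp
        have h2 := Int.toNat_of_nonneg h1.le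
        exact_mod_cast congrArg (Int.cast (R := ℝ)) h2
      rw [AddSubgroup.coe_sub, AddSubgroup.coe_sub, coe_weyl_smul, refl_smul, ← hn,
        Nat.cast_smul_eq_nsmul]
      abel
    rw [this]
    exact add_mem ih (AddSubmonoid.nsmul_mem _ hi _)

theorem SimpleRoots.orbitLE.mem_orbit {x y : weightLattice P} (h : b.orbitLE y x) :
    ∃ w : P.weylGroup, w • y = x := by
  induction h with
  | refl => exact ⟨1, one_smul _ _⟩
  | tail _ hs ih =>
    obtain ⟨w, rfl⟩ := ih
    obtain ⟨i, hi, rfl, hp⟩ := hs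
    exact ⟨refl P i * w, mul_smul _ _ _⟩

theorem SimpleRoots.orbitLE_refl_smul {i : ι} (hi : b.IsPos i) {x : weightLattice P}
    (h : 0 ≤ pr P (x : M) i) : b.orbitLE x (refl P i • x) := by
  rcases h.eq_or_lt with h | h
  · have : refl P i • x = x := Subtype.ext (by
      rw [coe_weyl_smul, refl_smul, ← h, zero_smul, sub_zero])
    rw [this]; exact Relation.ReflTransGen.refl
  · exact Relation.ReflTransGen.single ⟨i, hi, rfl, h⟩

variable [Finite ι] [P.IsRootSystem]

/-- Conjugation by `s_j` carries a step along `α` to a step along `s_j α`. This fails only when `s_j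
α` is negative, and then the step is `s_j` itself. -/
theorem SimpleRoots.orbitStep.smul {j : ι} (hj : j ∈ b.support) {x y : weightLattice P}
    (h : b.orbitStep y x) : x = refl P j • y ∨ b.orbitStep (refl P j • y) (refl P j • x) := by
  obtain ⟨i, hi, rfl, hp⟩ := h
  by_cases h : b.IsPos (refl P j • i)
  · refine Or.inr ⟨_, h, ?_, by rw [coe_weyl_smul, pr_smul_smul]; exact hp⟩
    rw [refl_conj, ← mul_smul, ← mul_smul]
    simp [mul_assoc]
  · rw [b.refl_eq hj hi h]; exact Or.inl rfl

/-- This and the next lemma are the lifting property of the Bruhat order, transferred to orbits: a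
chain is conjugated by `s_j` step by step until a step is `s_j` itself. -/
theorem SimpleRoots.orbitLE.smul_left {j : ι} (hj : j ∈ b.support) {x y : weightLattice P}
    (h : b.orbitLE y x) : b.orbitLE (refl P j • y) x ∨ b.orbitLE (refl P j • y) (refl P j • x) := by
  induction h using Relation.ReflTransGen.head_induction_on with
  | refl => exact Or.inr Relation.ReflTransGen.refl
  | head hs h ih =>
    rcases hs.smul hj with rfl | hs
    · exact Or.inl h
    · exact ih.imp (Relation.ReflTransGen.head hs) (Relation.ReflTransGen.head hs)

theorem SimpleRoots.orbitLE.smul_right {j : ι} (hj : j ∈ b.support) {x y : weightLattice P}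
    (h : b.orbitLE y x) : b.orbitLE y (refl P j • x) ∨ b.orbitLE (refl P j • y) (refl P j • x) := by
  induction h with
  | refl => exact Or.inr Relation.ReflTransGen.refl
  | tail h hs ih =>
    rcases hs.smul hj with rfl | hs
    · rw [refl_smul_smul]; exact Or.inl h
    · exact ih.imp (fun h => h.tail hs) (fun h => h.tail hs)

theorem SimpleRoots.orbitLE.refl_smul_of_fixed {j : ι} (hj : j ∈ b.support)
    {x y : weightLattice P} (h : b.orbitLE y x) (hx : refl P j • x = x) :
    b.orbitLE (refl P j • y) x := by
  have := h.smul_left hj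
  rwa [hx, or_self] at this

/-- A weight that is dominant for `R_I⁺` and below `y` is below the whole `W_I`-orbit of `y`. -/
theorem SimpleRoots.orbitLE.parabolic_smul {I : Set ι} (hI : I ⊆ b.support)
    {x y : weightLattice P} (hx : x ∈ b.relDominant I) (h : b.orbitLE x y) {w : P.weylGroup}
    (hw : w ∈ parabolic P I) : b.orbitLE x (w • y) := by
  have key : ∀ j ∈ I, ∀ y : weightLattice P, b.orbitLE x y → b.orbitLE x (refl P j • y) := by
    intro j hj y h
    rcases h.smul_right (hI hj) with h | h
    · exact h
    -- In this case `s_j x ≤ s_j y`, and `x ≤ s_j x` because `x` is dominant for `R_I⁺`.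
    · exact (orbitLE_refl_smul (b.isPos_of_mem (hI hj))
        (hx j (b.mem_posRoots_of_mem hI hj))).trans h
  rw [parabolic] at hw
  induction hw using Subgroup.closure_induction'' generalizing y with
  | one => simpa using h
  | mem w hw =>
    obtain ⟨i, hi, rfl⟩ := hw
    exact key i hi y h
  | inv_mem w hw =>
    obtain ⟨i, hi, rfl⟩ := hw
    rw [refl_inv]
    exact key i hi y h
  | mul v w _ _ hv hw => rw [mul_smul]; exact hv (hw h)

variable [P.IsCrystallographic]

/-- An element of maximal height in the finite `W_I`-orbit is dominant: reflecting it in a simple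
root of `I` cannot raise the height. -/
theorem SimpleRoots.exists_relDominant {I : Set ι} (hI : I ⊆ b.support) (x : weightLattice P) :
    ∃ w ∈ parabolic P I, w • x ∈ b.relDominant I := by
  have := finite_weylGroup P
  obtain ⟨w, hw⟩ := Finite.exists_max fun w : parabolic P I =>
    b.height (((w : P.weylGroup) • x : weightLattice P) : M)
  refine ⟨w, w.2, fun i hi => b.pr_nonneg_of_simple hI (fun j hj => ?_) hi⟩
  have h := hw (⟨refl P j, refl_mem_parabolic hj⟩ * w)
  simp only [Subgroup.coe_mul, mul_smul, coe_weyl_smul] at h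
  rw [refl_smul, map_sub, map_smul b.height (pr P _ j), b.height_root (hI hj), smul_eq_mul,
    mul_one] at h
  simp only [coe_weyl_smul]
  linarith

theorem SimpleRoots.eq_of_relDominant {I : Set ι} (hI : I ⊆ b.support) {x : weightLattice P}
    (hx : x ∈ b.relDominant I) {w : P.weylGroup} (hw : w ∈ parabolic P I)
    (hwx : w • x ∈ b.relDominant I) : w • x = x :=
  Subtype.ext (b.smul_eq_of_dominant hI hw hx hwx)

theorem SimpleRoots.mem_parabolic_support (w : P.weylGroup) : w ∈ parabolic P b.support := by
  rw [b.parabolic_support]; trivial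

theorem SimpleRoots.domRep_eq {x y : weightLattice P} (hy : y ∈ b.dominant) {w : P.weylGroup}
    (h : w • y = x) : b.domRep x = y := by
  obtain ⟨⟨v, hv⟩, hd⟩ := b.domRep_spec x
  rw [← relDominant_support] at hd hy
  simp only at hv
  subst h
  rw [← mul_smul] at hv
  rw [← hv]
  exact eq_of_relDominant subset_rfl hy (mem_parabolic_support _) (hv ▸ hd)

theorem SimpleRoots.domRep_of_dominant {x : weightLattice P} (hx : x ∈ b.dominant) :
    b.domRep x = x := domRep_eq hx (one_smul _ _)

theorem SimpleRoots.domRep_smul (w : P.weylGroup) (x : weightLattice P) :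
    b.domRep (w • x) = b.domRep x := by
  refine domRep_eq (b.domRep_spec x).2 (w := w * b.vbar x) ?_
  rw [mul_smul, (b.vbar_spec x).1]

theorem SimpleRoots.orbitLE.domRep_eq {x y : weightLattice P} (h : b.orbitLE y x) :
    b.domRep y = b.domRep x := by
  obtain ⟨w, rfl⟩ := h.mem_orbit
  rw [domRep_smul]

theorem SimpleRoots.bruhatLE.length {u w : P.weylGroup} (h : b.bruhatLE u w) :
    u = w ∨ b.length u < b.length w := by
  induction h with
  | refl => exact Or.inl rfl
  | tail _ hs ih =>
    rcases ih with rfl | ih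
    · exact Or.inr hs.2
    · exact Or.inr (ih.trans hs.2)

/-- For positive `α`, `w < s_α w` means that `w⁻¹ α` is positive, so `⟨w x, α^∨⟩ ≥ 0` for dominant
`x`. Hence Bruhat chains act as chains of reflections on the orbit. -/
theorem SimpleRoots.bruhatLE.orbitLE {u w : P.weylGroup} (h : b.bruhatLE u w)
    {x : weightLattice P} (hx : x ∈ b.dominant) : b.orbitLE (u • x) (w • x) := by
  induction h with
  | refl => exact Relation.ReflTransGen.refl
  | @tail w w' _ hs ih =>
    refine ih.trans ?_
    obtain ⟨⟨i, rfl⟩, hlt⟩ := hs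
    have key : ∀ i, b.IsPos i → b.length w < b.length (refl P i * w) →
        b.orbitLE (w • x) ((refl P i * w) • x) := by
      intro i hi hlt
      have hp : b.IsPos (w⁻¹ • i) := by
        by_contra h
        exact lt_asymm hlt (b.length_refl_mul_lt hi h)
      rw [mul_smul]
      refine orbitLE_refl_smul hi ?_
      rw [coe_weyl_smul, pr_smul]
      exact hx _ hp
    by_cases hi : b.IsPos i
    · exact key i hi hlt
    · have h := key _ (b.isPos_neg_iff.2 hi)
      rw [refl_neg_idx] at h
      exact h hlt

/-- The shortest element that sends `x₊` to `x` is also smallest in the Bruhat order. If `w ≠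
v̄(x)`, a right descent `j` of `v̄(x)⁻¹ w` is orthogonal to `x₊`. It must be a descent of `w` too,
as otherwise `v̄(x)` could be shortened; so `w s_j < w` still sends `x₊` to `x`. -/
theorem SimpleRoots.bruhatLE_vbar {x : weightLattice P} {w : P.weylGroup}
    (hw : w • b.domRep x = x) : b.bruhatLE (b.vbar x) w := by
  induction hn : b.length w using Nat.strong_induction_on generalizing w with
  | _ n ih =>
  subst hn
  obtain ⟨hv, hmin⟩ := b.vbar_spec x
  set v := b.vbar x
  have hd := (b.domRep_spec x).2
  rw [← relDominant_support] at hd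
  set d := b.domRep x
  have hd' : ∀ i ∈ b.posRoots b.support, 0 ≤ pr P (d : M) i := hd
  by_cases h1 : v⁻¹ * w = 1
  · rw [inv_mul_eq_one.1 h1]; exact Relation.ReflTransGen.refl
  have hfix : (v⁻¹ * w) • d = d := by rw [mul_smul, hw, inv_smul_eq_iff, hv]
  have hfix' : (v⁻¹ * w) • (d : M) = d := congrArg Subtype.val hfix
  obtain ⟨j, hj, hneg⟩ := b.exists_right_descent subset_rfl (mem_parabolic_support _) h1
  have h0 := b.pr_eq_zero_of_descent subset_rfl (mem_parabolic_support _) hd'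
    (by rw [hfix']; exact hd') hj hneg
  have hjd : refl P j • d = d := Subtype.ext (by
    rw [coe_weyl_smul, refl_smul, h0, zero_smul, sub_zero])
  have hwj : ¬ b.IsPos (w • j) := by
    intro hp
    have h2 : ¬ b.IsPos (v • (refl P ((v⁻¹ * w) • j) • ((v⁻¹ * w) • j))) := by
      rw [smul_neg_idx, b.not_isPos_neg_iff, ← mul_smul, mul_inv_cancel_left]
      exact hp
    refine absurd (b.length_mul_refl_lt (b.isPos_neg_iff.2 hneg) h2) (not_lt.2 (hmin _ ?_))
    rw [refl_neg_idx, refl_conj, mul_smul, mul_smul, mul_smul, inv_smul_eq_iff.2 hfix.symm, hjd,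
      hfix, hv]
  have hlt := b.length_mul_refl_lt (b.isPos_of_mem hj) hwj
  refine (ih _ hlt (by rw [mul_smul, hjd, hw]) rfl).tail ⟨⟨w • j, ?_⟩, hlt⟩
  change w = refl P (w • j) * _
  rw [refl_conj]
  simp [mul_assoc]

/-- As `⟨x, α^∨⟩ < 0`, the root `v̄(x)⁻¹ α` is negative and `s_α v̄(x) < v̄(x)`. This shorter
element sends the dominant weight to `y`, so it lies above `v̄(y)`. -/
theorem SimpleRoots.orbitStep.bruhatLE {x y : weightLattice P} (h : b.orbitStep y x) :
    b.bruhatLE (b.vbar y) (b.vbar x) := by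
  obtain ⟨i, hi, rfl, hp⟩ := h
  set x := refl P i • y
  obtain ⟨hv, hmin⟩ := b.vbar_spec x
  have hd : b.domRep x = b.domRep y := domRep_smul _ _
  have hneg : ¬ b.IsPos ((b.vbar x)⁻¹ • i) := by
    intro h
    have h2 := (b.domRep_spec x).2 _ h
    have h3 := pr_smul (b.vbar x) (b.domRep x : M) i
    rw [← coe_weyl_smul, hv, coe_weyl_smul, pr_smul, refl_inv, pr_neg_idx] at h3
    simp only [pr] at *
    linarith
  have hlt := b.length_refl_mul_lt hi hneg
  refine (bruhatLE_vbar (w := refl P i * b.vbar x) ?_).tail ⟨⟨i, ?_⟩, hlt⟩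
  · rw [← hd, mul_smul, hv, refl_smul_smul]
  · exact (refl_mul_cancel_left _ _).symm

theorem SimpleRoots.orbitLE.bruhatLE {x y : weightLattice P} (h : b.orbitLE y x) :
    b.bruhatLE (b.vbar y) (b.vbar x) := by
  induction h with
  | refl => exact Relation.ReflTransGen.refl
  | tail _ hs ih => exact ih.trans hs.bruhatLE

theorem SimpleRoots.domLE_refl (x : weightLattice P) : b.domLE x x := by
  simp [SimpleRoots.domLE]

theorem SimpleRoots.domLE.trans {x y z : weightLattice P} (h : b.domLE x y) (h' : b.domLE y z) :
    b.domLE x z := by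
  have := add_mem h' h
  rwa [← AddSubgroup.coe_add, sub_add_sub_cancel] at this

theorem SimpleRoots.domLE.antisymm {x y : weightLattice P} (h : b.domLE x y)
    (h' : b.domLE y x) : x = y := by
  have h1 := b.height_nonneg h
  have h2 := b.height_nonneg h'
  have h3 := b.eq_zero_of_height h (le_antisymm ?_ h1)
  · exact (sub_eq_zero.1 (Subtype.ext h3)).symm
  · rw [← neg_sub, AddSubgroup.coe_neg, map_neg] at h2
    linarith

/-- Within one orbit, the Bruhat order of the elements `v̄` is the order generated by reflections;
this form avoids `v̄` in everything that follows. -/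
theorem SimpleRoots.weightLE_iff {x y : weightLattice P} : b.weightLE y x ↔
    (b.domLE (b.domRep y) (b.domRep x) ∧ b.domRep y ≠ b.domRep x) ∨ b.orbitLE y x := by
  constructor
  · rintro ⟨h1, h2⟩
    by_cases h : b.domRep y = b.domRep x
    · refine Or.inr ?_
      have h3 := (h2 h).orbitLE (b.domRep_spec y).2
      rw [(b.vbar_spec y).1, h, (b.vbar_spec x).1] at h3
      exact h3
    · exact Or.inl ⟨h1, h⟩
  · rintro (⟨h1, h2⟩ | h)
    · exact ⟨h1, fun h => absurd h h2⟩
    · exact ⟨by rw [h.domRep_eq]; exact domLE_refl _, fun _ => h.bruhatLE⟩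

theorem SimpleRoots.weightLE_refl (x : weightLattice P) : b.weightLE x x :=
  ⟨domLE_refl _, fun _ => Relation.ReflTransGen.refl⟩

theorem SimpleRoots.weightLE.trans {x y z : weightLattice P} (h : b.weightLE x y)
    (h' : b.weightLE y z) : b.weightLE x z := by
  refine ⟨h.1.trans h'.1, fun hxz => ?_⟩
  have hxy : b.domRep x = b.domRep y := h.1.antisymm (hxz ▸ h'.1)
  exact (h.2 hxy).trans (h'.2 (hxy ▸ hxz))

theorem SimpleRoots.weightLE.antisymm {x y : weightLattice P} (h : b.weightLE x y)
    (h' : b.weightLE y x) : x = y := by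
  have hxy : b.domRep x = b.domRep y := h.1.antisymm h'.1
  rcases (h.2 hxy).length with h1 | h1
  · rw [← (b.vbar_spec x).1, ← (b.vbar_spec y).1, h1, hxy]
  · rcases (h'.2 hxy.symm).length with h2 | h2
    · rw [← (b.vbar_spec x).1, ← (b.vbar_spec y).1, h2, hxy]
    · exact absurd h1 h2.asymm

theorem SimpleRoots.weightLE.refl_smul_of_fixed {j : ι} (hj : j ∈ b.support)
    {x y : weightLattice P} (h : b.weightLE y x) (hx : refl P j • x = x) :
    b.weightLE (refl P j • y) x := by
  rw [weightLE_iff] at *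
  rw [domRep_smul]
  exact h.imp_right fun h => h.refl_smul_of_fixed hj hx

/-- A weight that is dominant for `R_I⁺` is the smallest element of its `W_I`-orbit. -/
theorem SimpleRoots.orbitLE_of_relDominant {I : Set ι} (hI : I ⊆ b.support)
    {x : weightLattice P} (hx : x ∈ b.relDominant I) {w : P.weylGroup}
    (hw : w ∈ parabolic P I) : b.orbitLE x (w • x) :=
  SimpleRoots.orbitLE.parabolic_smul hI hx Relation.ReflTransGen.refl hw

theorem SimpleRoots.domRep_sub_mem (w : P.weylGroup) (x : weightLattice P) :
    b.domLE (w • x) (b.domRep x) := by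
  have hd := (b.domRep_spec x).2
  rw [← relDominant_support] at hd
  have h := orbitLE_of_relDominant subset_rfl hd (w := w * b.vbar x) (mem_parabolic_support _)
  rw [mul_smul, (b.vbar_spec x).1] at h
  exact h.sub_mem

/-- The dominant representative of a weight in the interior of a root string is strictly smaller
than that of the end points. -/
theorem SimpleRoots.domRep_string {x : weightLattice P} {i : ι} {n : ℤ} (h0 : 0 < n)
    (h1 : n < ipr x i) :
    b.domLE (b.domRep (x - n • rootWeight P i)) (b.domRep x) ∧
      b.domRep (x - n • rootWeight P i) ≠ b.domRep x := by
  set y := x - n • rootWeight P i with hy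
  obtain ⟨w, hw⟩ := (b.domRep_spec y).1
  simp only at hw
  -- Descending from some `z ⪯ x₊` by a positive multiple of a positive root strictly lowers the
  -- height, so the result cannot be `x₊`.
  have key : ∀ (z : weightLattice P) (j : ι) (m : ℤ), 0 < m → b.IsPos j →
      b.domLE z (b.domRep x) → b.domRep y = z - m • rootWeight P j →
      b.domLE (b.domRep y) (b.domRep x) ∧ b.domRep y ≠ b.domRep x := by
    intro z j m hm hj hz h
    obtain ⟨k, rfl⟩ := Int.eq_ofNat_of_zero_le hm.le
    have h2 : ((b.domRep x - b.domRep y : weightLattice P) : M) =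
        ((b.domRep x - z : weightLattice P) : M) + k • P.root j := by
      rw [h, sub_sub_eq_add_sub, add_sub_right_comm, AddSubgroup.coe_add]
      simp [rootWeight]
    refine ⟨?_, fun heq => ?_⟩
    · rw [SimpleRoots.domLE, h2]
      exact add_mem hz (AddSubmonoid.nsmul_mem _ hj _)
    · have h3 := congrArg b.height h2
      rw [heq, sub_self, map_add, AddSubgroup.coe_zero, map_zero, map_nsmul, nsmul_eq_mul] at h3
      have h4 := b.height_nonneg hz
      have h5 := hj.height_pos
      have h6 : (0 : ℝ) < k := by exact_mod_cast hm
      have := mul_pos h6 h5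
      linarith
  have hroot : ∀ j : ι, (w • rootWeight P j : weightLattice P) = rootWeight P (w • j) :=
    fun j => Subtype.ext (root_smul w j).symm
  have hzsmul : ∀ (m : ℤ) (z : weightLattice P), w • (m • z) = m • (w • z) := fun m z =>
    map_zsmul (DistribSMul.toAddMonoidHom (weightLattice P) w) m z
  -- With `w` making the interior point dominant, the descent starts from `w x` if `w α` is
  -- positive, and from the other end `w s_α x` of the string if it is negative.
  by_cases hp : b.IsPos (w • i)
  · refine key (w • x) (w • i) n h0 hp (domRep_sub_mem w x) ?_
    rw [← hw, hy, smul_sub, hzsmul, hroot]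
  · refine key ((w * refl P i) • x) (refl P (w • i) • (w • i)) (ipr x i - n) (by linarith)
      (b.isPos_neg_iff.2 hp) (domRep_sub_mem _ x) ?_
    have hneg : rootWeight P (refl P (w • i) • (w • i)) = -rootWeight P (w • i) :=
      Subtype.ext (refl_smul_self_idx_root _)
    rw [← hw, hy, smul_sub, hzsmul, hroot, hneg, mul_smul, refl_smul_weight, smul_sub, hzsmul,
      hroot, smul_neg, sub_smul]
    abel

end Orders

/-! ### Finiteness of the set of weights below a given weight -/

section Finiteness

variable {ι M N : Type*} [AddCommGroup M] [Module ℝ M] [AddCommGroup N] [Module ℝ N]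
variable {P : RootPairing ι ℝ M N} {b : SimpleRoots P} [Fintype ι] [P.IsRootSystem]
  [P.IsCrystallographic]

/-- Invariance of the root form under `s_j` gives `2 (α_j, x) = ⟨x, α_j^∨⟩ (α_j, α_j)`. -/
theorem SimpleRoots.rootForm_nonneg {x z : M} (hx : ∀ i, b.IsPos i → 0 ≤ pr P x i)
    (hz : z ∈ b.rootCone) : 0 ≤ P.RootForm z x := by
  rw [SimpleRoots.rootCone] at hz
  induction hz using AddSubmonoid.closure_induction with
  | mem z hz =>
    obtain ⟨j, hj, rfl⟩ := hz
    have h := P.rootForm_reflection_reflection_apply j (P.root j) x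
    rw [P.reflection_apply_self, P.reflection_apply, map_neg, LinearMap.neg_apply, map_sub,
      map_smul, smul_eq_mul] at h
    have h1 : 0 ≤ P.RootForm (P.root j) (P.root j) := by
      rw [P.rootForm_apply_apply]
      exact Finset.sum_nonneg fun i _ => mul_self_nonneg _
    have h2 : 0 ≤ P.coroot' j x := hx j (b.isPos_of_mem hj)
    nlinarith [mul_nonneg h2 h1]
  | zero => simp
  | add y z _ _ hy hz => rw [map_add, LinearMap.add_apply]; exact add_nonneg hy hz

theorem rootForm_smul_smul (w : P.weylGroup) (x : M) :
    P.RootForm (w • x) (w • x) = P.RootForm x x := by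
  obtain ⟨g, hg⟩ := w
  change P.RootForm (g • x) (g • x) = _
  induction hg using RootPairing.weylGroup.induction generalizing x with
  | mem i => exact P.rootForm_reflection_reflection_apply i x x
  | one => rw [one_smul]
  | mul g₁ g₂ _ _ h₁ h₂ => rw [mul_smul, h₁, h₂]

theorem weight_ext {x y : weightLattice P} (h : ∀ i, ipr x i = ipr y i) : x = y := by
  refine Subtype.ext ((P.toPerfPair.injective ?_))
  refine LinearMap.ext_on_range (RootPairing.IsRootSystem.span_coroot_eq_top (P := P)) fun i => ?_
  have := congrArg (Int.cast (R := ℝ)) (h i)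
  rwa [ipr_cast, ipr_cast] at this

/-- The root form is the sum of the squares of the pairings with the coroots. A bound on it bounds
every integer `⟨x, α^∨⟩`, and these integers determine the weight. -/
theorem finite_rootForm_le (C : ℝ) :
    {x : weightLattice P | P.RootForm (x : M) (x : M) ≤ C}.Finite := by
  have hinj : Function.Injective fun (x : weightLattice P) (i : ι) => ipr x i :=
    fun x y h => weight_ext fun i => congrFun h i
  refine Set.Finite.of_finite_image (f := fun x i => ipr x i) ?_ hinj.injOn
  refine (Set.Finite.pi' (t := fun _ : ι => Set.Icc (-⌈C⌉) ⌈C⌉) fun _ => Set.finite_Icc _ _).subset ?_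
  rintro _ ⟨x, hx, rfl⟩
  have key : ∀ i, |ipr x i| ≤ ⌈C⌉ := by
    intro i
    have h1 : ((ipr x i : ℤ) : ℝ) ^ 2 ≤ C := by
      refine le_trans ?_ hx
      rw [P.rootForm_apply_apply, ipr_cast, sq]
      exact Finset.single_le_sum (f := fun i => P.coroot' i (x : M) * P.coroot' i (x : M))
        (fun i _ => mul_self_nonneg _) (Finset.mem_univ i)
    have h2 : (ipr x i) ^ 2 ≤ ⌈C⌉ := by
      have := h1.trans (Int.le_ceil C)
      exact_mod_cast this
    rw [← sq_abs] at h2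
    nlinarith [abs_nonneg (ipr x i), sq_nonneg (|ipr x i|)]
  exact fun i => ⟨(abs_le.1 (key i)).1, (abs_le.1 (key i)).2⟩

/-- `(x, x) - (y, y) = (x - y, x) + (x - y, y)`, and both terms are non-negative by dominance. -/
theorem SimpleRoots.rootForm_le_of_domLE {x y : weightLattice P} (hx : x ∈ b.dominant)
    (hy : y ∈ b.dominant) (h : b.domLE y x) :
    P.RootForm (y : M) (y : M) ≤ P.RootForm (x : M) (x : M) := by
  have h1 := rootForm_nonneg (x := (x : M)) hx h
  have h2 := rootForm_nonneg (x := (y : M)) hy h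
  have h3 := P.rootForm_symmetric.eq (x : M) (y : M)
  simp only [AddSubgroup.coe_sub, map_sub, LinearMap.sub_apply, RingHom.id_apply] at h1 h2 h3
  linarith

theorem SimpleRoots.finite_weightLE (x : weightLattice P) :
    {y | b.weightLE y x}.Finite := by
  refine (finite_rootForm_le (P.RootForm (b.domRep x : M) (b.domRep x : M))).subset ?_
  intro y hy
  have := rootForm_le_of_domLE (b.domRep_spec x).2 (b.domRep_spec y).2 hy.1
  rw [Set.mem_ofPred_eq]
  conv_lhs => rw [← (b.vbar_spec y).1]
  rwa [coe_weyl_smul, rootForm_smul_smul]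

end Finiteness

/-! ### Characters, compactness and reflections of the torus -/

section TorusBasics

variable {ι M N : Type*} [AddCommGroup M] [Module ℝ M] [NormedAddCommGroup N] [NormedSpace ℝ N]
variable {P : RootPairing ι ℝ M N}

/-- The point of the torus that is represented by a vector. -/
def torusMk (P : RootPairing ι ℝ M N) (h : N) : Torus P :=
  (QuotientAddGroup.mk h : N ⧸ corootLattice P)

theorem torusMk_surjective : Function.Surjective (torusMk P) := QuotientAddGroup.mk_surjective

theorem torusMk_add (h h' : N) : torusMk P (h + h') = torusMk P h + torusMk P h' := rfl

theorem continuous_torusMk : Continuous (torusMk P) := QuotientAddGroup.continuous_mk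

theorem isQuotientMap_torusMk : Topology.IsQuotientMap (torusMk P) :=
  QuotientAddGroup.isQuotientMap_mk _

theorem character_torusMk (x : weightLattice P) (h : N) : character P x (torusMk P h) =
    Complex.exp (2 * Real.pi * Complex.I * (P.toLinearMap (x : M) h : ℝ)) := character_mk P x h

theorem character_zero_left (t : Torus P) : character P 0 t = 1 := by
  obtain ⟨h, rfl⟩ := torusMk_surjective t
  simp [character_torusMk]

theorem character_add_left (x y : weightLattice P) (t : Torus P) :
    character P (x + y) t = character P x t * character P y t := by
  obtain ⟨h, rfl⟩ := torusMk_surjective t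
  rw [character_torusMk, character_torusMk, character_torusMk, ← Complex.exp_add]
  congr 1
  rw [AddSubgroup.coe_add, map_add, LinearMap.add_apply]
  push_cast
  ring

theorem character_add_right (x : weightLattice P) (t t' : Torus P) :
    character P x (t + t') = character P x t * character P x t' := by
  rw [character, map_add, AddCircle.toCircle_add, Circle.coe_mul]
  rfl

theorem norm_character (x : weightLattice P) (t : Torus P) : ‖character P x t‖ = 1 :=
  Circle.norm_coe _

theorem character_ne_zero (x : weightLattice P) (t : Torus P) : character P x t ≠ 0 :=
  Circle.coe_ne_zero _

theorem character_neg (x : weightLattice P) (t : Torus P) :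
    character P (-x) t = (character P x t)⁻¹ := by
  refine eq_inv_of_mul_eq_one_left ?_
  rw [← character_add_left, neg_add_cancel, character_zero_left]

theorem conj_character (x : weightLattice P) (t : Torus P) :
    (starRingEnd ℂ) (character P x t) = character P (-x) t := by
  rw [character_neg, Complex.inv_def, Complex.normSq_eq_norm_sq, norm_character]
  simp

theorem character_sub (x y : weightLattice P) (t : Torus P) :
    character P (x - y) t = character P x t * (character P y t)⁻¹ := by
  rw [sub_eq_add_neg, character_add_left, character_neg]

theorem character_nsmul (x : weightLattice P) (n : ℕ) (t : Torus P) :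
    character P (n • x) t = character P x t ^ n := by
  induction n with
  | zero => simp [character_zero_left]
  | succ n ih => rw [add_smul, one_smul, character_add_left, ih, pow_succ]

/-- Evaluation at a point of the torus, as an algebra homomorphism. -/
def evalHom (P : RootPairing ι ℝ M N) (t : Torus P) : Laurent P →ₐ[ℂ] ℂ :=
  AddMonoidAlgebra.lift ℂ ℂ (weightLattice P)
    { toFun := fun x => character P x.toAdd t
      map_one' := character_zero_left t
      map_mul' := fun x y => character_add_left x.toAdd y.toAdd t }

theorem evalHom_eq (p : Laurent P) (t : Torus P) : evalHom P t p = evalTorus P p t := by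
  rw [evalHom, AddMonoidAlgebra.lift_apply]
  rfl

@[simp] theorem evalHom_expW (x : weightLattice P) (t : Torus P) :
    evalHom P t (expW x) = character P x t := by
  rw [evalHom, expW, AddMonoidAlgebra.lift_single, one_smul]
  rfl

theorem expW_span : Submodule.span ℂ (Set.range (expW (P := P))) = ⊤ := by
  rw [eq_top_iff]
  rintro p -
  induction p using AddMonoidAlgebra.induction_linear with
  | zero => exact zero_mem _
  | add p q hp hq => exact add_mem hp hq
  | single x c =>
    have : AddMonoidAlgebra.single x c = c • expW (P := P) x := by
      rw [expW, AddMonoidAlgebra.smul_single, smul_eq_mul, mul_one]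
    rw [this]
    exact Submodule.smul_mem _ _ (Submodule.subset_span ⟨x, rfl⟩)

variable [Finite ι] [P.IsRootSystem]

theorem finiteDimensional_coroots (P : RootPairing ι ℝ M N) [P.IsRootSystem] :
    FiniteDimensional ℝ N :=
  Module.finite_def.2 (Submodule.fg_def.2 ⟨_, Set.finite_range P.coroot,
    RootPairing.IsRootSystem.span_coroot_eq_top⟩)

theorem continuous_character (x : weightLattice P) : Continuous (character P x) := by
  have := finiteDimensional_coroots P
  rw [isQuotientMap_torusMk.continuous_iff]
  have h : Continuous (P.toLinearMap (x : M)) := LinearMap.continuous_of_finiteDimensional _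
  have : character P x ∘ torusMk P = fun h : N =>
      Complex.exp (2 * Real.pi * Complex.I * (P.toLinearMap (x : M) h : ℝ)) :=
    funext fun h => character_torusMk x h
  rw [this]
  fun_prop

theorem continuous_evalHom (p : Laurent P) : Continuous fun t => evalHom P t p := by
  induction p using AddMonoidAlgebra.induction_linear with
  | zero => simpa using continuous_const
  | add p q hp hq => simp only [map_add]; exact hp.add hq
  | single x c =>
    have : AddMonoidAlgebra.single x c = c • expW (P := P) x := by
      rw [expW, AddMonoidAlgebra.smul_single, smul_eq_mul, mul_one]
    simp only [this, map_smul, evalHom_expW, smul_eq_mul]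
    exact continuous_const.mul (continuous_character x)

instance compactSpace_torus : CompactSpace (Torus P) := by
  cases nonempty_fintype ι
  let F : (ι → ℝ) → Torus P := fun c => torusMk P (∑ i, c i • P.coroot i)
  have hF : Continuous F := continuous_torusMk.comp (by fun_prop)
  have hK : IsCompact (Set.Icc (0 : ι → ℝ) 1) := isCompact_Icc
  refine ⟨?_⟩
  convert hK.image hF
  refine (Set.eq_univ_of_forall fun t => ?_).symm
  obtain ⟨h, rfl⟩ := torusMk_surjective t
  have hh : h ∈ Submodule.span ℝ (Set.range P.coroot) := by
    rw [RootPairing.IsRootSystem.span_coroot_eq_top]; trivial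
  obtain ⟨c, rfl⟩ := (Submodule.mem_span_range_iff_exists_fun ℝ).1 hh
  -- The coroots span, so reducing coefficients to fractional parts changes a vector by an element
  -- of the coroot lattice. Hence the unit cube surjects onto the torus.
  refine ⟨fun i => Int.fract (c i), ⟨fun i => Int.fract_nonneg _,
    fun i => (Int.fract_lt_one _).le⟩, ?_⟩
  refine QuotientAddGroup.eq.2 ?_
  have : -∑ i, Int.fract (c i) • P.coroot i + ∑ i, c i • P.coroot i =
      ∑ i, ⌊c i⌋ • P.coroot i := by
    rw [neg_add_eq_sub, ← Finset.sum_sub_distrib]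
    refine Finset.sum_congr rfl fun i _ => ?_
    rw [← sub_smul, Int.self_sub_fract, Int.cast_smul_eq_zsmul]
  rw [this]
  exact sum_mem fun i _ => zsmul_mem
    (AddSubgroup.subset_closure ⟨i, rfl⟩ : P.coroot i ∈ corootLattice P) _

variable (vol : Measure (Torus P)) [vol.IsAddHaarMeasure]

instance isFiniteMeasure_torus : IsFiniteMeasure vol := inferInstance

theorem integrable_of_continuous {E : Type*} [NormedAddCommGroup E]
    [SecondCountableTopology E] {f : Torus P → E} (hf : Continuous f) : Integrable f vol := by
  obtain ⟨C, hC⟩ := isCompact_univ.exists_bound_of_continuousOn hf.continuousOn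
  exact Integrable.of_bound hf.aestronglyMeasurable C (ae_of_all _ fun t => hC t trivial)

/-- The action of a reflection on the torus. -/
def torusRefl (P : RootPairing ι ℝ M N) (i : ι) : Torus P →+ Torus P :=
  QuotientAddGroup.map (corootLattice P) (corootLattice P) (P.coreflection i).toAddMonoidHom (by
    rw [corootLattice, AddSubgroup.closure_le]
    rintro _ ⟨j, rfl⟩
    refine AddSubgroup.subset_closure ⟨P.reflectionPerm i j, ?_⟩
    exact P.coroot_reflectionPerm i j)

theorem torusRefl_mk (i : ι) (h : N) :
    torusRefl P i (torusMk P h) = torusMk P (P.coreflection i h) := rfl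

theorem torusRefl_torusRefl (i : ι) (t : Torus P) : torusRefl P i (torusRefl P i t) = t := by
  obtain ⟨h, rfl⟩ := torusMk_surjective t
  rw [torusRefl_mk, torusRefl_mk, P.coreflection_same]

theorem continuous_torusRefl (i : ι) : Continuous (torusRefl P i) := by
  have := finiteDimensional_coroots P
  rw [isQuotientMap_torusMk.continuous_iff]
  exact continuous_torusMk.comp
    (LinearMap.continuous_of_finiteDimensional (P.coreflection i : N →ₗ[ℝ] N))

theorem character_torusRefl (i : ι) (x : weightLattice P) (t : Torus P) :
    character P x (torusRefl P i t) = character P (refl P i • x) t := by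
  obtain ⟨h, rfl⟩ := torusMk_surjective t
  rw [torusRefl_mk, character_torusMk, character_torusMk]
  congr 3
  rw [coe_weyl_smul, refl_smul, P.coreflection_apply]
  simp only [map_sub, map_smul, LinearMap.sub_apply, LinearMap.smul_apply, smul_eq_mul, pr]
  rw [mul_comm]

theorem measurePreserving_torusRefl (i : ι) : MeasurePreserving (torusRefl P i) vol vol :=
  AddMonoidHom.measurePreserving (continuous_torusRefl i)
    (fun t => ⟨torusRefl P i t, torusRefl_torusRefl i t⟩) rfl

theorem integral_comp_torusRefl (i : ι) (f : Torus P → ℂ) :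
    ∫ t, f (torusRefl P i t) ∂vol = ∫ t, f t ∂vol :=
  (measurePreserving_torusRefl vol i).integral_comp
    (Homeomorph.measurableEmbedding ⟨⟨torusRefl P i, torusRefl P i, torusRefl_torusRefl i,
      torusRefl_torusRefl i⟩, continuous_torusRefl i, continuous_torusRefl i⟩) f

end TorusBasics

/-! ### Positive definiteness and invariance of the inner product -/

section InnerProduct

variable {ι M N : Type*} [AddCommGroup M] [Module ℝ M] [NormedAddCommGroup N] [NormedSpace ℝ N]
variable {P : RootPairing ι ℝ M N} [Fintype ι] [P.IsRootSystem] [P.IsCrystallographic]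

theorem delta_nonneg (k : ι → ℝ) (t : Torus P) : 0 ≤ delta P k t :=
  Finset.prod_nonneg fun _ _ => Real.rpow_nonneg (norm_nonneg _) _

theorem continuous_delta {k : ι → ℝ} (hk : ∀ i, 0 ≤ k i) : Continuous (delta P k) :=
  continuous_finsetProd _ fun i _ =>
    (continuous_const.sub (continuous_character _)).norm.rpow_const fun _ => Or.inr (hk i)

theorem refl_smul_rootWeight (i j : ι) :
    refl P i • rootWeight P j = rootWeight P (P.reflectionPerm i j) :=
  Subtype.ext (by rw [← refl_smul_idx]; exact (root_smul _ _).symm)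

theorem delta_torusRefl {k : ι → ℝ} (hk : ∀ i j, k (P.reflectionPerm i j) = k j) (i : ι)
    (t : Torus P) : delta P k (torusRefl P i t) = delta P k t := by
  unfold delta
  refine Fintype.prod_equiv (P.reflectionPerm i) _ _ fun j => ?_
  rw [character_torusRefl, refl_smul_rootWeight, hk]

theorem evalHom_act_refl (i : ι) (p : Laurent P) (t : Torus P) :
    evalHom P t (act (refl P i) p) = evalHom P (torusRefl P i t) p := by
  induction p using AddMonoidAlgebra.induction_linear with
  | zero => simp [act]
  | add p q hp hq =>
    rw [map_add, ← hp, ← hq, ← map_add, act, AddMonoidAlgebra.mapDomain_add]; rfl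
  | single x c =>
    have : ∀ x, AddMonoidAlgebra.single x c = c • expW (P := P) x := fun x => by
      rw [expW, AddMonoidAlgebra.smul_single, smul_eq_mul, mul_one]
    rw [act, AddMonoidAlgebra.mapDomain_single, this, this, map_smul, map_smul, evalHom_expW,
      evalHom_expW, character_torusRefl]

/-- The weight lattice embeds in a rational vector space, which has unique sums; hence its group
algebra is a domain. -/
instance noZeroDivisors_laurent (P : RootPairing ι ℝ M N) : NoZeroDivisors (Laurent P) := by
  let _ : Module ℚ M := Module.compHom M (algebraMap ℚ ℝ)
  have : UniqueSums (weightLattice P) :=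
    UniqueSums.of_injective_addHom (weightLattice P).subtype.toAddHom
      Subtype.val_injective inferInstance
  infer_instance

theorem character_injective {x y : weightLattice P} (h : character P x = character P y) :
    x = y := by
  have hx : ∀ z : weightLattice P, (∀ t, character P z t = 1) → z = 0 := by
    intro z hz
    have key : ∀ h : N, P.toLinearMap (z : M) h = 0 := by
      intro h
      by_contra hne
      -- At `h / (2⟨z, h⟩)` the character takes the value `e^{πi} = -1`.
      have h1 := hz (torusMk P ((2 * P.toLinearMap (z : M) h)⁻¹ • h))
      rw [character_torusMk, map_smul, smul_eq_mul, mul_inv,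
        mul_assoc (2⁻¹ : ℝ), inv_mul_cancel₀ hne] at h1
      have h2 : (2 * Real.pi * Complex.I * ((2⁻¹ * 1 : ℝ) : ℂ)) = Real.pi * Complex.I := by
        push_cast; ring
      rw [h2, Complex.exp_pi_mul_I] at h1
      norm_num at h1
    exact Subtype.ext (P.toPerfPair.injective (LinearMap.ext fun h => by
      rw [AddSubgroup.coe_zero, map_zero]; exact key h))
  refine sub_eq_zero.1 (hx _ fun t => ?_)
  rw [character_sub, h, mul_inv_cancel₀ (character_ne_zero _ _)]

/-- A Laurent polynomial is determined by its values on the torus. -/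
theorem laurent_eq_zero {p : Laurent P} (h : ∀ t, evalHom P t p = 0) : p = 0 := by
  let F : weightLattice P → (Multiplicative (Torus P) →* ℂ) := fun x =>
    { toFun := fun t => character P x t.toAdd
      map_one' := by
        have := character_add_right x (0 : Torus P) 0
        rw [add_zero] at this
        exact (mul_eq_left₀ (character_ne_zero x 0)).1 this.symm
      map_mul' := fun t t' => character_add_right x t.toAdd t'.toAdd }
  have hF : Function.Injective F := fun x y hxy =>
    character_injective (funext fun t => DFunLike.congr_fun hxy (Multiplicative.ofAdd t))
  -- Dedekind's theorem: distinct characters are linearly independent.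
  have hli := (linearIndependent_monoidHom (Multiplicative (Torus P)) ℂ).comp F hF
  rw [linearIndependent_iff] at hli
  have h0 := hli p.coeff (funext fun t => by
    rw [Finsupp.linearCombination_apply, Finsupp.sum_apply', Pi.zero_apply]
    have := h t.toAdd
    rw [evalHom_eq] at this
    exact this)
  exact AddMonoidAlgebra.coeff_eq_zero.1 h0

theorem innerK_eq (k : ι → ℝ) (vol : Measure (Torus P)) (p q : Laurent P) : innerK P k vol p q =
    ∫ t, (starRingEnd ℂ) (evalHom P t p) * evalHom P t q * (delta P k t : ℂ) ∂vol := by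
  simp only [evalHom_eq]; rfl

theorem continuous_innerK_integrand {k : ι → ℝ} (hk : ∀ i, 0 ≤ k i) (p q : Laurent P) :
    Continuous fun t => (starRingEnd ℂ) (evalHom P t p) * evalHom P t q * (delta P k t : ℂ) :=
  ((Complex.continuous_conj.comp (continuous_evalHom p)).mul (continuous_evalHom q)).mul
    (Complex.continuous_ofReal.comp (continuous_delta hk))

/-- A zero of `δ_k` is a zero of some `1 - e^α`. So `p ∏ (1 - e^α)` vanishes on the whole torus, and
the group algebra is a domain. -/
theorem eq_zero_of_delta_mul {k : ι → ℝ} {p : Laurent P}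
    (h : ∀ t, evalHom P t p ≠ 0 → delta P k t = 0) : p = 0 := by
  have h1 : p * ∏ i, (expW 0 - expW (rootWeight P i)) = 0 := by
    refine laurent_eq_zero fun t => ?_
    rw [map_mul, map_prod]
    by_cases hp : evalHom P t p = 0
    · rw [hp, zero_mul]
    · have h2 := h t hp
      rw [delta, Finset.prod_eq_zero_iff] at h2
      obtain ⟨i, hi, h2⟩ := h2
      rw [Finset.prod_eq_zero hi, mul_zero]
      rw [map_sub, evalHom_expW, evalHom_expW, character_zero_left]
      exact norm_eq_zero.1 ((Real.rpow_eq_zero_iff_of_nonneg (norm_nonneg _)).1 h2).1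
  have : Nontrivial (Laurent P) := inferInstance
  rcases mul_eq_zero.1 h1 with h1 | h1
  · exact h1
  · obtain ⟨i, -, hi⟩ := Finset.prod_eq_zero_iff.1 h1
    have h2 := AddMonoidAlgebra.single_left_injective one_ne_zero (sub_eq_zero.1 hi)
    exact absurd (congrArg Subtype.val h2).symm (P.ne_zero i)

/-- The inner product `(·, ·)_k` on the Laurent polynomials. -/
abbrev innerCore (P : RootPairing ι ℝ M N) [P.IsRootSystem] [P.IsCrystallographic] (k : ι → ℝ)
    (hk : ∀ i, 0 ≤ k i) (vol : Measure (Torus P)) [vol.IsAddHaarMeasure] :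
    InnerProductSpace.Core ℂ (Laurent P) where
  inner p q := innerK P k vol p q
  conj_inner_symm p q := by
    rw [innerK_eq, innerK_eq, ← integral_conj]
    congr 1
    funext t
    simp only [map_mul, Complex.conj_conj, Complex.conj_ofReal]
    ring
  re_inner_nonneg p := by
    rw [innerK_eq]
    have : ∀ t, (starRingEnd ℂ) (evalHom P t p) * evalHom P t p * (delta P k t : ℂ) =
        ((Complex.normSq (evalHom P t p) * delta P k t : ℝ) : ℂ) := fun t => by
      rw [mul_comm (starRingEnd ℂ _), Complex.mul_conj]; push_cast; rfl
    simp only [this]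
    rw [integral_complex_ofReal]
    exact integral_nonneg fun t => mul_nonneg (Complex.normSq_nonneg _) (delta_nonneg _ _)
  add_left p q r := by
    rw [innerK_eq, innerK_eq, innerK_eq, ← integral_add]
    · congr 1; funext t; rw [map_add, map_add]; ring
    · exact integrable_of_continuous vol (continuous_innerK_integrand hk _ _)
    · exact integrable_of_continuous vol (continuous_innerK_integrand hk _ _)
  smul_left p q c := by
    rw [innerK_eq, innerK_eq, ← integral_const_mul]
    congr 1; funext t; rw [map_smul, smul_eq_mul, map_mul]; ring
  definite p hp := by
    change innerK P k vol p p = 0 at hp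
    rw [innerK_eq] at hp
    have h1 : ∀ t, (starRingEnd ℂ) (evalHom P t p) * evalHom P t p * (delta P k t : ℂ) =
        ((Complex.normSq (evalHom P t p) * delta P k t : ℝ) : ℂ) := fun t => by
      rw [mul_comm (starRingEnd ℂ _), Complex.mul_conj]; push_cast; rfl
    simp only [h1] at hp
    rw [integral_complex_ofReal] at hp
    have hc : Continuous fun t => Complex.normSq (evalHom P t p) * delta P k t :=
      (Complex.continuous_normSq.comp (continuous_evalHom p)).mul (continuous_delta hk)
    have h2 := (integral_eq_zero_iff_of_nonneg
      (fun t => mul_nonneg (Complex.normSq_nonneg _) (delta_nonneg _ _))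
      (integrable_of_continuous vol hc)).1 (by exact_mod_cast hp)
    -- Haar measure charges every nonempty open set, so a continuous function that vanishes almost
    -- everywhere vanishes everywhere.
    have h3 := (Continuous.ae_eq_iff_eq vol hc continuous_const).1 h2
    refine eq_zero_of_delta_mul (k := k) fun t ht => ?_
    exact (mul_eq_zero.1 (congrFun h3 t)).resolve_left fun h => ht (Complex.normSq_eq_zero.1 h)

theorem innerK_act_refl {k : ι → ℝ} (hk : ∀ i j, k (P.reflectionPerm i j) = k j)
    (vol : Measure (Torus P)) [vol.IsAddHaarMeasure] (i : ι) (p q : Laurent P) :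
    innerK P k vol (act (refl P i) p) (act (refl P i) q) = innerK P k vol p q := by
  rw [innerK_eq, innerK_eq, ← integral_comp_torusRefl vol i]
  simp only [evalHom_act_refl, torusRefl_torusRefl, delta_torusRefl hk]

end InnerProduct

/-! ### Divided differences and integration by parts -/

section Cherednik

variable {ι M N : Type*} [AddCommGroup M] [Module ℝ M] [NormedAddCommGroup N] [NormedSpace ℝ N]
variable {P : RootPairing ι ℝ M N} [Fintype ι] [P.IsRootSystem] [P.IsCrystallographic]

/-- The Laurent polynomial `(e^x - e^{s x}) / (1 - e^{-α})`, where `s` is the reflection in the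
root `α` with index `i`. -/
def stringSum (i : ι) (x : weightLattice P) : Laurent P :=
  ∑ j ∈ Finset.range (ipr x i).toNat, expW (x - (j : ℤ) • rootWeight P i) -
    ∑ j ∈ Finset.range (-ipr x i).toNat, expW (x - (-(j + 1 : ℤ)) • rootWeight P i)

theorem character_sub_zsmul (x y : weightLattice P) (n : ℤ) (t : Torus P) :
    character P (x - n • y) t = character P x t * (character P y t) ^ (-n) := by
  rw [character_sub, zpow_neg]
  congr 2
  cases n with
  | ofNat n => simpa using character_nsmul y n t
  | negSucc n =>
    rw [negSucc_zsmul, character_neg, character_nsmul, zpow_negSucc]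

/-- A geometric sum along the root string. The identity is kept in multiplied form since `1 -
e^{-α}` has zeros on the torus. -/
theorem evalHom_stringSum (i : ι) (x : weightLattice P) (t : Torus P) :
    (1 - (character P (rootWeight P i) t)⁻¹) * evalHom P t (stringSum i x) =
      character P x t - character P (refl P i • x) t := by
  rw [refl_smul_weight, stringSum, map_sub, map_sum, map_sum]
  simp only [evalHom_expW, character_sub_zsmul]
  set u := character P (rootWeight P i) t with hu
  have hu0 : u ≠ 0 := character_ne_zero _ _
  rcases le_total 0 (ipr x i) with h | h
  · obtain ⟨n, hn⟩ := Int.eq_ofNat_of_zero_le h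
    rw [hn]
    simp only [Int.toNat_natCast, Int.toNat_neg_natCast, Finset.range_zero, Finset.sum_empty,
      ← Finset.mul_sum, zpow_neg, zpow_natCast]
    have := mul_neg_geom_sum u⁻¹ n
    simp only [inv_pow] at this
    linear_combination character P x t * this
  · obtain ⟨n, hn⟩ := Int.eq_ofNat_of_zero_le (neg_nonneg.2 h)
    have hn' : ipr x i = -(n : ℤ) := by rw [← hn, neg_neg]
    rw [hn']
    simp only [neg_neg, Int.toNat_natCast, Int.toNat_neg_natCast, Finset.range_zero,
      Finset.sum_empty, ← Finset.mul_sum]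
    have h1 : ∀ j : ℕ, u ^ ((j : ℤ) + 1) = u * u ^ j := fun j => by
      rw [zpow_add_one₀ hu0, zpow_natCast, mul_comm]
    simp only [h1, ← Finset.mul_sum, zpow_natCast]
    have h2 := mul_neg_geom_sum u n
    have h3 : (1 - u⁻¹) * u = -(1 - u) := by field_simp; ring
    linear_combination -(character P x t * ∑ j ∈ Finset.range n, u ^ j) * h3 +
      character P x t * h2

/-- The function `|1 - e^α|²`. -/
def rootSq (i : ι) (t : Torus P) : ℝ := ‖1 - character P (rootWeight P i) t‖ ^ 2

theorem rootSq_nonneg (i : ι) (t : Torus P) : 0 ≤ rootSq i t := sq_nonneg _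

theorem rootSq_eq (i : ι) (t : Torus P) :
    rootSq i t = 2 - 2 * (character P (rootWeight P i) t).re := by
  have h := norm_character (rootWeight P i) t
  rw [rootSq, ← Complex.normSq_eq_norm_sq, Complex.normSq_apply]
  rw [← sq_eq_sq₀ (norm_nonneg _) zero_le_one, ← Complex.normSq_eq_norm_sq,
    Complex.normSq_apply] at h
  simp only [Complex.sub_re, Complex.sub_im, Complex.one_re, Complex.one_im]
  linarith

theorem rootSq_cast (i : ι) (t : Torus P) : (rootSq i t : ℂ) =
    (1 - character P (rootWeight P i) t) * (1 - (character P (rootWeight P i) t)⁻¹) := by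
  rw [rootSq, ← Complex.normSq_eq_norm_sq, Complex.normSq_eq_conj_mul_self, map_sub, map_one,
    conj_character, character_neg, mul_comm]

theorem continuous_rootSq (i : ι) : Continuous (rootSq (P := P) i) :=
  (continuous_const.sub (continuous_character _)).norm.pow 2

theorem rootSq_le (i : ι) (t : Torus P) : rootSq i t ≤ 4 := by
  have h := Complex.abs_re_le_norm (character P (rootWeight P i) t)
  rw [norm_character, abs_le] at h
  rw [rootSq_eq]
  linarith

/-- A smooth approximation to the weight function `δ_k`. -/
def deltaReg (k : ι → ℝ) (ε : ℝ) (t : Torus P) : ℝ :=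
  Real.exp (∑ i, k i / 2 * Real.log (rootSq i t + ε))

variable {k : ι → ℝ}

theorem continuous_deltaReg {ε : ℝ} (hε : 0 < ε) : Continuous (deltaReg (P := P) k ε) := by
  refine Real.continuous_exp.comp (continuous_finsetSum _ fun i _ => continuous_const.mul ?_)
  exact ((continuous_rootSq i).add continuous_const).log fun t =>
    (add_pos_of_nonneg_of_pos (rootSq_nonneg i t) hε).ne'

/-- Uniform in `ε`, for dominated convergence; the constant `5` is the bound `4` on `|1 - e^α|²`
plus the bound `1` on `ε`. -/
theorem deltaReg_le (hk : ∀ i, 0 ≤ k i) {ε : ℝ} (hε : 0 < ε) (hε1 : ε ≤ 1) (t : Torus P) :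
    deltaReg k ε t ≤ Real.exp (∑ i, k i / 2 * Real.log 5) := by
  refine Real.exp_le_exp.2 (Finset.sum_le_sum fun i _ => ?_)
  refine mul_le_mul_of_nonneg_left (Real.log_le_log
    (add_pos_of_nonneg_of_pos (rootSq_nonneg i t) hε) ?_) (by linarith [hk i])
  linarith [rootSq_le i t]

theorem tendsto_deltaReg (hk : ∀ i, 0 ≤ k i) {e : ℕ → ℝ} (he : ∀ n, 0 < e n)
    (h0 : Filter.Tendsto e Filter.atTop (nhds 0)) (t : Torus P) :
    Filter.Tendsto (fun n => deltaReg k (e n) t) Filter.atTop (nhds (delta P k t)) := by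
  have h1 : ∀ n, deltaReg k (e n) t = ∏ i, (rootSq i t + e n) ^ (k i / 2) := fun n => by
    rw [deltaReg, Real.exp_sum]
    refine Finset.prod_congr rfl fun i _ => ?_
    rw [Real.rpow_def_of_pos (add_pos_of_nonneg_of_pos (rootSq_nonneg i t) (he n)), mul_comm]
  have h2 : delta P k t = ∏ i, (rootSq i t) ^ (k i / 2) := by
    refine Finset.prod_congr rfl fun i _ => ?_
    rw [rootSq, ← Real.rpow_natCast_mul (norm_nonneg _)]
    congr 1
    push_cast; ring
  simp only [h1, h2]
  refine tendsto_finsetProd _ fun i _ => ?_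
  have h3 : Filter.Tendsto (fun n => rootSq i t + e n) Filter.atTop (nhds (rootSq i t)) := by
    simpa using h0.const_add (rootSq i t)
  exact h3.rpow_const (Or.inr (by linarith [hk i]))

theorem rootSq_torusRefl (i j : ι) (t : Torus P) :
    rootSq j (torusRefl P i t) = rootSq (P.reflectionPerm i j) t := by
  rw [rootSq, rootSq, character_torusRefl, refl_smul_rootWeight]

theorem deltaReg_torusRefl (hk : ∀ i j, k (P.reflectionPerm i j) = k j) (ε : ℝ) (i : ι)
    (t : Torus P) : deltaReg k ε (torusRefl P i t) = deltaReg k ε t := by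
  unfold deltaReg
  congr 1
  refine Fintype.sum_equiv (P.reflectionPerm i) _ _ fun j => ?_
  rw [rootSq_torusRefl, hk]

theorem hasDerivAt_character (x : weightLattice P) (ξ : N) (t : Torus P) :
    HasDerivAt (fun s : ℝ => character P x (t + torusMk P (s • ξ)))
      (2 * Real.pi * Complex.I * (P.toLinearMap (x : M) ξ : ℝ) * character P x t) 0 := by
  have h1 : ∀ s : ℝ, character P x (t + torusMk P (s • ξ)) = character P x t *
      Complex.exp (2 * Real.pi * Complex.I * (P.toLinearMap (x : M) ξ : ℝ) * (s : ℂ)) := by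
    intro s
    rw [character_add_right, character_torusMk, map_smul, smul_eq_mul]
    congr 2
    push_cast; ring
  simp only [h1]
  have h2 : HasDerivAt (fun s : ℝ => 2 * Real.pi * Complex.I * (P.toLinearMap (x : M) ξ : ℝ) *
      (s : ℂ)) (2 * Real.pi * Complex.I * (P.toLinearMap (x : M) ξ : ℝ) * 1) 0 :=
    (Complex.ofRealCLM.hasDerivAt (x := (0 : ℝ))).const_mul _
  refine (h2.cexp.const_mul (character P x t)).congr_deriv ?_
  simp only [Complex.ofReal_zero, mul_zero, Complex.exp_zero, one_mul, mul_one]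
  ring

theorem torusMk_zero_smul (ξ : N) (t : Torus P) : t + torusMk P ((0 : ℝ) • ξ) = t := by
  have : torusMk P ((0 : ℝ) • ξ) = 0 := by rw [zero_smul]; rfl
  rw [this, add_zero]

theorem hasDerivAt_rootSq (i : ι) (ξ : N) (t : Torus P) :
    HasDerivAt (fun s : ℝ => rootSq i (t + torusMk P (s • ξ)))
      (4 * Real.pi * P.toLinearMap (P.root i) ξ * (character P (rootWeight P i) t).im) 0 := by
  simp only [rootSq_eq]
  have h := Complex.reCLM.hasFDerivAt.comp_hasDerivAt (0 : ℝ)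
    (hasDerivAt_character (rootWeight P i) ξ t)
  refine ((h.const_mul 2).const_sub 2).congr_deriv ?_
  simp [rootWeight]
  ring

theorem hasDerivAt_deltaReg {ε : ℝ} (hε : 0 < ε) (ξ : N) (t : Torus P) :
    HasDerivAt (fun s : ℝ => deltaReg k ε (t + torusMk P (s • ξ)))
      (deltaReg k ε t * ∑ i, k i / 2 * ((4 * Real.pi * P.toLinearMap (P.root i) ξ *
        (character P (rootWeight P i) t).im) / (rootSq i t + ε))) 0 := by
  have h : HasDerivAt (fun s : ℝ => ∑ i, k i / 2 *
      Real.log (rootSq i (t + torusMk P (s • ξ)) + ε))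
      (∑ i, k i / 2 * ((4 * Real.pi * P.toLinearMap (P.root i) ξ *
        (character P (rootWeight P i) t).im) / (rootSq i t + ε))) 0 := by
    refine HasDerivAt.fun_sum fun i _ => HasDerivAt.const_mul _ ?_
    have := ((hasDerivAt_rootSq i ξ t).add_const ε).log
      (add_pos_of_nonneg_of_pos (rootSq_nonneg _ _) hε).ne'
    rwa [torusMk_zero_smul] at this
  have := h.exp
  rwa [torusMk_zero_smul] at this

variable (vol : Measure (Torus P)) [vol.IsAddHaarMeasure]

/-- The integral of a derivative over the torus vanishes. -/
theorem integral_deriv_eq_zero {F F' : Torus P → ℂ} (hF : Continuous F) (hF' : Continuous F')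
    (ξ : N) (h : ∀ t, HasDerivAt (fun s : ℝ => F (t + torusMk P (s • ξ))) (F' t) 0) :
    ∫ t, F' t ∂vol = 0 := by
  have hd : ∀ t, ∀ s : ℝ, HasDerivAt (fun s : ℝ => F (t + torusMk P (s • ξ)))
      (F' (t + torusMk P (s • ξ))) s := by
    intro t s
    have h1 := h (t + torusMk P (s • ξ))
    have h2 := HasDerivAt.scomp (h := fun r : ℝ => r - s) s (by rwa [sub_self])
      ((hasDerivAt_id s).sub_const s)
    rw [one_smul] at h2
    refine h2.congr_of_eventuallyEq (Filter.Eventually.of_forall fun r => ?_)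
    simp only [Function.comp, sub_smul]
    rw [add_assoc, ← torusMk_add, add_sub_cancel]
  obtain ⟨C, hC⟩ := isCompact_univ.exists_bound_of_continuousOn hF'.continuousOn
  have hcont : ∀ (G : Torus P → ℂ), Continuous G → ∀ s : ℝ,
      Continuous fun t => G (t + torusMk P (s • ξ)) := fun G hG s =>
    hG.comp (continuous_id.add continuous_const)
  have key := (hasDerivAt_integral_of_dominated_loc_of_deriv_le (μ := vol) (𝕜 := ℝ)
    (F := fun s t => F (t + torusMk P (s • ξ))) (F' := fun s t => F' (t + torusMk P (s • ξ)))
    (x₀ := 0) (s := Set.univ) (bound := fun _ => C) Filter.univ_mem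
    (Filter.Eventually.of_forall fun s => (hcont F hF s).aestronglyMeasurable)
    (integrable_of_continuous vol (hcont F hF 0))
    (hcont F' hF' 0).aestronglyMeasurable
    (ae_of_all _ fun t s _ => hC _ trivial) (integrable_const C)
    (ae_of_all _ fun t s _ => hd t s)).2
  simp only [torusMk_zero_smul] at key
  -- By translation invariance the integral does not depend on `s`, so its derivative is zero.
  have hc : (fun s : ℝ => ∫ t, F (t + torusMk P (s • ξ)) ∂vol) = fun _ => ∫ t, F t ∂vol :=
    funext fun s => integral_add_right_eq_self F _
  rw [hc] at key
  exact key.unique (hasDerivAt_const _ _)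

/-- The contribution of a root to the derivative of the regularised weight function, after
symmetrisation. -/
def symTerm (i : ι) (z : weightLattice P) (d q : ℝ) (t : Torus P) : ℂ :=
  (d : ℂ) * ((1 / 2) * (character P z t - character P (refl P i • z) t) *
    ((character P (rootWeight P i) t).im / q : ℝ))

theorem neg_rootWeight (i : ι) : refl P i • rootWeight P i = -rootWeight P i :=
  Subtype.ext (by
    rw [refl_smul_rootWeight]
    change P.root _ = _
    rw [← refl_smul_idx, refl_smul_self_idx_root]; rfl)

theorem im_character_torusRefl (i : ι) (t : Torus P) :
    (character P (rootWeight P i) (torusRefl P i t)).im =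
      -(character P (rootWeight P i) t).im := by
  rw [character_torusRefl, neg_rootWeight, ← conj_character, Complex.conj_im]

theorem rootSq_torusRefl_self (i : ι) (t : Torus P) :
    rootSq i (torusRefl P i t) = rootSq i t := by
  rw [rootSq_eq, rootSq_eq, character_torusRefl, neg_rootWeight, ← conj_character,
    Complex.conj_re]

theorem integral_symm (i : ι) {f g : Torus P → ℂ} (hf : Continuous f)
    (h : ∀ t, g t = (1 / 2) * (f t + f (torusRefl P i t))) : ∫ t, g t ∂vol = ∫ t, f t ∂vol := by
  have h2 : Integrable (fun t => f (torusRefl P i t)) vol :=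
    integrable_of_continuous vol (hf.comp (continuous_torusRefl i))
  simp only [h]
  rw [integral_const_mul, integral_add (integrable_of_continuous vol hf) h2,
    integral_comp_torusRefl]
  ring

theorem continuous_im_div (i : ι) {ε : ℝ} (hε : 0 < ε) : Continuous fun t : Torus P =>
    (((character P (rootWeight P i) t).im / (rootSq i t + ε) : ℝ) : ℂ) :=
  Complex.continuous_ofReal.comp ((Complex.continuous_im.comp (continuous_character _)).div₀
    ((continuous_rootSq i).add continuous_const)
    fun t => (add_pos_of_nonneg_of_pos (rootSq_nonneg i t) hε).ne')

/-- The factor `Im e^α / (|1 - e^α|² + ε)` is odd under `s_α`, so only the antisymmetric part of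
`e^z` contributes. That part is divisible by `1 - e^{-α}`, which keeps the integrand bounded as `ε →
0`. -/
theorem integral_symTerm_reg (hk' : ∀ i j, k (P.reflectionPerm i j) = k j) (i : ι)
    (z : weightLattice P) {ε : ℝ} (hε : 0 < ε) :
    ∫ t, symTerm i z (deltaReg k ε t) (rootSq i t + ε) t ∂vol =
      ∫ t, (deltaReg k ε t : ℂ) * (character P z t *
        ((character P (rootWeight P i) t).im / (rootSq i t + ε) : ℝ)) ∂vol := by
  refine integral_symm vol i ?_ fun t => ?_
  · exact (Complex.continuous_ofReal.comp (continuous_deltaReg hε)).mul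
      ((continuous_character z).mul (continuous_im_div i hε))
  · rw [deltaReg_torusRefl hk', rootSq_torusRefl_self, im_character_torusRefl,
      character_torusRefl, symTerm]
    push_cast
    ring

theorem norm_one_sub_inv_character (i : ι) (t : Torus P) :
    ‖1 - (character P (rootWeight P i) t)⁻¹‖ = ‖1 - character P (rootWeight P i) t‖ := by
  rw [← character_neg, ← conj_character, ← Complex.norm_conj (1 - _)]
  simp

/-- Dominated convergence: `|1 - e^{-α}| |Im e^α| ≤ |1 - e^α|²` cancels the denominator, and the
remaining quotient is a Laurent polynomial. -/
theorem tendsto_symTerm (hk : ∀ i, 0 ≤ k i) (i : ι) (z : weightLattice P) :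
    Filter.Tendsto (fun n : ℕ => ∫ t, symTerm i z (deltaReg k (1 / ((n : ℝ) + 1)) t)
        (rootSq i t + 1 / ((n : ℝ) + 1)) t ∂vol) Filter.atTop
      (nhds (∫ t, symTerm i z (delta P k t) (rootSq i t) t ∂vol)) := by
  have he : ∀ n : ℕ, (0 : ℝ) < 1 / ((n : ℝ) + 1) := fun n => Nat.one_div_pos_of_nat
  have he1 : ∀ n : ℕ, 1 / ((n : ℝ) + 1) ≤ (1 : ℝ) := fun n => by
    rw [div_le_one (by positivity)]
    linarith [n.cast_nonneg (α := ℝ)]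
  have h0 := tendsto_one_div_add_atTop_nhds_zero_nat (𝕜 := ℝ)
  obtain ⟨C, hC⟩ := isCompact_univ.exists_bound_of_continuousOn
    (continuous_evalHom (stringSum (P := P) i z)).continuousOn
  set D := Real.exp (∑ i, k i / 2 * Real.log 5)
  refine tendsto_integral_of_dominated_convergence (fun _ => D * (1 / 2 * C)) ?_
    (integrable_const _) ?_ ?_
  · intro n
    refine Continuous.aestronglyMeasurable ?_
    exact (Complex.continuous_ofReal.comp (continuous_deltaReg (he n))).mul
      ((continuous_const.mul ((continuous_character _).sub (continuous_character _))).mul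
      (continuous_im_div i (he n)))
  · intro n
    refine ae_of_all _ fun t => ?_
    have hd := deltaReg_le hk (he n) (he1 n) t
    have hd0 : 0 ≤ deltaReg k (1 / ((n : ℝ) + 1)) t := (Real.exp_pos _).le
    rw [symTerm, norm_mul, Complex.norm_real, Real.norm_of_nonneg hd0]
    refine mul_le_mul hd ?_ (norm_nonneg _) (Real.exp_pos _).le
    have h1 : ‖(1 / 2 : ℂ)‖ = 1 / 2 := by norm_num
    rw [← evalHom_stringSum, norm_mul, norm_mul, norm_mul, h1, norm_one_sub_inv_character,
      Complex.norm_real, norm_div, mul_assoc]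
    refine mul_le_mul_of_nonneg_left ?_ (by norm_num)
    have hq := rootSq_nonneg i t
    have hqe := add_pos_of_nonneg_of_pos hq (he n)
    have h2 : ‖(character P (rootWeight P i) t).im‖ ≤ ‖1 - character P (rootWeight P i) t‖ := by
      have := Complex.abs_im_le_norm (1 - character P (rootWeight P i) t)
      simpa using this
    rw [Real.norm_of_nonneg hqe.le, mul_right_comm, ← mul_div_assoc]
    have h3 : ‖1 - character P (rootWeight P i) t‖ * ‖(character P (rootWeight P i) t).im‖ /
        (rootSq i t + 1 / ((n : ℝ) + 1)) ≤ 1 := by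
      rw [div_le_one hqe]
      have : ‖1 - character P (rootWeight P i) t‖ * ‖(character P (rootWeight P i) t).im‖ ≤
          rootSq i t := by
        rw [rootSq, sq]
        exact mul_le_mul_of_nonneg_left h2 (norm_nonneg _)
      linarith [he n]
    calc _ ≤ 1 * C := mul_le_mul h3 (hC t trivial) (norm_nonneg _) zero_le_one
      _ = C := one_mul C
  · refine ae_of_all _ fun t => ?_
    refine ((Complex.continuous_ofReal.tendsto _).comp (tendsto_deltaReg hk he h0 t)).mul ?_
    -- Where `e^α = 1` the numerator `Im e^α` is zero, so all terms and the limit vanish whatever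
    -- the denominator.
    by_cases hq : rootSq i t = 0
    · have h1 : character P (rootWeight P i) t = 1 := by
        have := norm_eq_zero.1 (pow_eq_zero_iff two_ne_zero |>.1 hq)
        exact (sub_eq_zero.1 this).symm
      simp [h1]
    · refine Filter.Tendsto.const_mul _ ((Complex.continuous_ofReal.tendsto _).comp ?_)
      refine tendsto_const_nhds.div ?_ hq
      simpa using h0.const_add (rootSq i t)

/-- The weight `δ_k` need not be differentiable where some `e^α = 1`. The derivative of `e^z δ` is
therefore integrated for the regularised weight, symmetrised root by root, and only then is `ε` sent
to zero. -/
theorem integral_by_parts (hk : ∀ i, 0 ≤ k i) (hk' : ∀ i j, k (P.reflectionPerm i j) = k j)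
    (z : weightLattice P) (ξ : N) :
    2 * Real.pi * Complex.I * (P.toLinearMap (z : M) ξ : ℝ) *
        ∫ t, character P z t * (delta P k t : ℂ) ∂vol +
      ∑ i, (k i / 2 * (4 * Real.pi * P.toLinearMap (P.root i) ξ) : ℝ) *
        ∫ t, symTerm i z (delta P k t) (rootSq i t) t ∂vol = 0 := by
  have he : ∀ n : ℕ, (0 : ℝ) < 1 / ((n : ℝ) + 1) := fun n => Nat.one_div_pos_of_nat
  have he1 : ∀ n : ℕ, 1 / ((n : ℝ) + 1) ≤ (1 : ℝ) := fun n => by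
    rw [div_le_one (by positivity)]
    linarith [n.cast_nonneg (α := ℝ)]
  have h0 := tendsto_one_div_add_atTop_nhds_zero_nat (𝕜 := ℝ)
  have hreg : ∀ ε : ℝ, 0 < ε → 2 * Real.pi * Complex.I * (P.toLinearMap (z : M) ξ : ℝ) *
        ∫ t, character P z t * (deltaReg k ε t : ℂ) ∂vol +
      ∑ i, (k i / 2 * (4 * Real.pi * P.toLinearMap (P.root i) ξ) : ℝ) *
        ∫ t, symTerm i z (deltaReg k ε t) (rootSq i t + ε) t ∂vol = 0 := by
    intro ε hε
    have hc1 : Continuous fun t => character P z t * (deltaReg k ε t : ℂ) :=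
      (continuous_character z).mul (Complex.continuous_ofReal.comp (continuous_deltaReg hε))
    have hc2 : ∀ i, Continuous fun t => (deltaReg k ε t : ℂ) * (character P z t *
        ((character P (rootWeight P i) t).im / (rootSq i t + ε) : ℝ)) := fun i =>
      (Complex.continuous_ofReal.comp (continuous_deltaReg hε)).mul
        ((continuous_character z).mul (continuous_im_div i hε))
    simp only [integral_symTerm_reg vol hk' _ z hε]
    have h := integral_deriv_eq_zero vol (F := fun t => character P z t * (deltaReg k ε t : ℂ))
      (F' := fun t => 2 * Real.pi * Complex.I * (P.toLinearMap (z : M) ξ : ℝ) *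
        (character P z t * (deltaReg k ε t : ℂ)) +
        ∑ i, (k i / 2 * (4 * Real.pi * P.toLinearMap (P.root i) ξ) : ℝ) *
        ((deltaReg k ε t : ℂ) * (character P z t *
        ((character P (rootWeight P i) t).im / (rootSq i t + ε) : ℝ)))) hc1
      ((continuous_const.mul hc1).add (continuous_finsetSum _ fun i _ =>
        continuous_const.mul (hc2 i))) ξ (fun t => by
        have h1 := (hasDerivAt_character z ξ t).mul
          (hasDerivAt_deltaReg (k := k) hε ξ t).ofReal_comp
        simp only [torusMk_zero_smul] at h1
        refine h1.congr_deriv ?_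
        rw [mul_assoc (2 * Real.pi * Complex.I * _)]
        congr 1
        push_cast
        rw [Finset.mul_sum, Finset.mul_sum]
        refine Finset.sum_congr rfl fun i _ => ?_
        ring)
    have hi1 : Integrable (fun t => 2 * Real.pi * Complex.I * (P.toLinearMap (z : M) ξ : ℝ) *
        (character P z t * (deltaReg k ε t : ℂ))) vol :=
      integrable_of_continuous vol (continuous_const.mul hc1)
    have hi2 : ∀ i ∈ Finset.univ, Integrable (fun t =>
        ((k i / 2 * (4 * Real.pi * P.toLinearMap (P.root i) ξ) : ℝ) : ℂ) *
        ((deltaReg k ε t : ℂ) * (character P z t *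
        ((character P (rootWeight P i) t).im / (rootSq i t + ε) : ℝ)))) vol := fun i _ =>
      integrable_of_continuous vol (continuous_const.mul (hc2 i))
    rw [integral_add hi1 (integrable_finsetSum _ hi2), integral_const_mul,
      integral_finsetSum _ hi2] at h
    simpa only [integral_const_mul] using h
  have hlim1 : Filter.Tendsto (fun n : ℕ => ∫ t, character P z t *
      (deltaReg k (1 / ((n : ℝ) + 1)) t : ℂ) ∂vol) Filter.atTop
      (nhds (∫ t, character P z t * (delta P k t : ℂ) ∂vol)) := by
    refine tendsto_integral_of_dominated_convergence
      (fun _ => Real.exp (∑ i, k i / 2 * Real.log 5)) ?_ (integrable_const _) ?_ ?_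
    · exact fun n => ((continuous_character z).mul
        (Complex.continuous_ofReal.comp (continuous_deltaReg (he n)))).aestronglyMeasurable
    · intro n
      refine ae_of_all _ fun t => ?_
      have hd0 : 0 ≤ deltaReg k (1 / ((n : ℝ) + 1)) t := (Real.exp_pos _).le
      rw [norm_mul, norm_character, one_mul, Complex.norm_real, Real.norm_of_nonneg hd0]
      exact deltaReg_le hk (he n) (he1 n) t
    · exact ae_of_all _ fun t => Filter.Tendsto.const_mul _
        ((Complex.continuous_ofReal.tendsto _).comp (tendsto_deltaReg hk he h0 t))
  have hlim := (hlim1.const_mul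
    (2 * Real.pi * Complex.I * (P.toLinearMap (z : M) ξ : ℝ) : ℂ)).add
    (tendsto_finsetSum Finset.univ fun i _ => (tendsto_symTerm vol hk i z).const_mul
      ((k i / 2 * (4 * Real.pi * P.toLinearMap (P.root i) ξ) : ℝ) : ℂ))
  refine tendsto_nhds_unique hlim ?_
  simp only [fun n => hreg _ (he n)]
  exact tendsto_const_nhds

end Cherednik

/-! ### Symmetry of the Cherednik operators -/

section Symmetry

variable {ι M N : Type*} [AddCommGroup M] [Module ℝ M] [NormedAddCommGroup N] [NormedSpace ℝ N]
variable {P : RootPairing ι ℝ M N} [Fintype ι] [P.IsRootSystem] [P.IsCrystallographic]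

/-- The inner product `(·, ·)_k` as a sesquilinear map. -/
def innerForm (P : RootPairing ι ℝ M N) [P.IsRootSystem] [P.IsCrystallographic] {k : ι → ℝ}
    (hk : ∀ i, 0 ≤ k i) (vol : Measure (Torus P)) [vol.IsAddHaarMeasure] :
    Laurent P →ₗ⋆[ℂ] Laurent P →ₗ[ℂ] ℂ :=
  LinearMap.mk₂'ₛₗ (starRingEnd ℂ) (RingHom.id ℂ) (innerK P k vol)
    (fun p q r => (innerCore P k hk vol).add_left p q r)
    (fun c p q => (innerCore P k hk vol).smul_left p q c)
    (fun p q r => by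
      rw [innerK_eq, innerK_eq, innerK_eq, ← integral_add]
      · congr 1; funext t; rw [map_add]; ring
      · exact integrable_of_continuous vol (continuous_innerK_integrand hk _ _)
      · exact integrable_of_continuous vol (continuous_innerK_integrand hk _ _))
    (fun c p q => by
      rw [innerK_eq, innerK_eq, smul_eq_mul, ← integral_const_mul]
      congr 1; funext t; rw [map_smul, smul_eq_mul, RingHom.id_apply]; ring)

theorem innerForm_apply {k : ι → ℝ} (hk : ∀ i, 0 ≤ k i) (vol : Measure (Torus P))
    [vol.IsAddHaarMeasure] (p q : Laurent P) : innerForm P hk vol p q = innerK P k vol p q := rfl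

variable (b : SimpleRoots P)

/-- The finite set of positive roots. -/
def SimpleRoots.posIdx : Finset ι := (Set.toFinite {i | b.IsPos i}).toFinset

variable {b}

theorem SimpleRoots.mem_posIdx {i : ι} : i ∈ b.posIdx ↔ b.IsPos i :=
  Set.Finite.mem_toFinset _

theorem neg_idx_neg_idx (i : ι) : refl P (refl P i • i) • (refl P i • i) = i := by
  rw [refl_neg_idx, refl_smul_smul]

theorem SimpleRoots.sum_eq_sum_posIdx {A : Type*} [AddCommMonoid A] (F : ι → A) :
    ∑ i, F i = ∑ i ∈ b.posIdx, (F i + F (refl P i • i)) := by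
  classical
  rw [← Finset.sum_add_sum_compl b.posIdx, Finset.sum_add_distrib]
  congr 1
  refine Finset.sum_nbij' (fun i => refl P i • i) (fun i => refl P i • i) ?_ ?_ ?_ ?_ ?_
  · intro i hi
    rw [Finset.mem_compl, mem_posIdx] at hi
    rw [mem_posIdx, b.isPos_neg_iff]; exact hi
  · intro i hi
    rw [mem_posIdx] at hi
    rw [Finset.mem_compl, mem_posIdx, b.isPos_neg_iff, not_not]; exact hi
  · exact fun i _ => neg_idx_neg_idx i
  · exact fun i _ => neg_idx_neg_idx i
  · exact fun i _ => by rw [neg_idx_neg_idx]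

variable {k : ι → ℝ}

theorem mult_smul (hk' : ∀ i j, k (P.reflectionPerm i j) = k j) (w : P.weylGroup) (j : ι) :
    k (w • j) = k j := by
  obtain ⟨g, hg⟩ := w
  change k (g • j) = k j
  induction hg using RootPairing.weylGroup.induction generalizing j with
  | mem i =>
    have : RootPairing.Equiv.reflection P i • j = P.reflectionPerm i j := refl_smul_idx i j
    rw [this, hk']
  | one => rw [one_smul]
  | mul g₁ g₂ _ _ h₁ h₂ => rw [mul_smul, h₁, h₂]

variable (b k)

/-- The Cherednik operator, without its constant term, on the basis of exponentials. -/
def cherednikExp (ξ : N) (x : weightLattice P) : Laurent P :=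
  ((P.toLinearMap (x : M) ξ : ℝ) : ℂ) • expW x +
    ∑ i ∈ b.posIdx, ((k i * P.toLinearMap (P.root i) ξ : ℝ) : ℂ) • stringSum i x

/-- The Cherednik operator
`∂_ξ + ∑_{α > 0} k_α α(ξ) (1 - e^{-α})⁻¹ (1 - s_α)` on the Laurent polynomials. -/
def cherednik (ξ : N) : Laurent P →ₗ[ℂ] Laurent P :=
  Finsupp.linearCombination ℂ (cherednikExp b k ξ) ∘ₗ
    (AddMonoidAlgebra.coeffLinearEquiv ℂ : Laurent P ≃ₗ[ℂ] (weightLattice P →₀ ℂ)).toLinearMap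

theorem cherednik_expW (ξ : N) (x : weightLattice P) :
    cherednik b k ξ (expW x) = cherednikExp b k ξ x := by
  change Finsupp.linearCombination ℂ (cherednikExp b k ξ) (Finsupp.single x 1) = _
  rw [Finsupp.linearCombination_single, one_smul]

variable {b k} (vol : Measure (Torus P)) [vol.IsAddHaarMeasure]

theorem innerK_expW_expW (x y : weightLattice P) : innerK P k vol (expW x) (expW y) =
    ∫ t, character P (y - x) t * (delta P k t : ℂ) ∂vol := by
  rw [innerK_eq]
  congr 1; funext t
  rw [evalHom_expW, evalHom_expW, conj_character, ← character_add_left, neg_add_eq_sub]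

/-- The sign cancels against that of `α(ξ)`, so `α` and `-α` contribute equally and sums over all
roots fold onto the positive ones. -/
theorem symTerm_neg_idx (i : ι) (z : weightLattice P) (t : Torus P) :
    symTerm (refl P i • i) z (delta P k t) (rootSq (refl P i • i) t) t =
      -symTerm i z (delta P k t) (rootSq i t) t := by
  have h : rootWeight P (refl P i • i) = -rootWeight P i :=
    Subtype.ext (refl_smul_self_idx_root i)
  have hq : rootSq (refl P i • i) t = rootSq i t := by
    rw [rootSq_eq, rootSq_eq, h, ← conj_character, Complex.conj_re]
  rw [symTerm, symTerm, refl_neg_idx, hq, h, ← conj_character, Complex.conj_im]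
  push_cast
  ring

/-- The two integrands agree pointwise only after averaging the right-hand one over `s_α`; what
remains is a rational identity in the values of the characters. -/
theorem integral_symTerm_eq (hk : ∀ i, 0 ≤ k i) (hk' : ∀ i j, k (P.reflectionPerm i j) = k j)
    {i : ι} (hi : k i ≠ 0) (x y : weightLattice P) :
    -2 * Complex.I * ∫ t, symTerm i (y - x) (delta P k t) (rootSq i t) t ∂vol =
      innerK P k vol (expW x) (stringSum i y) - innerK P k vol (stringSum i x) (expW y) := by
  have hc1 := continuous_innerK_integrand hk (expW x) (stringSum (P := P) i y)
  have hc2 := continuous_innerK_integrand hk (stringSum (P := P) i x) (expW y)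
  rw [innerK_eq, innerK_eq, ← integral_sub (integrable_of_continuous vol hc1)
    (integrable_of_continuous vol hc2), ← integral_const_mul]
  refine integral_symm vol i (hc1.sub hc2) fun t => ?_
  -- On the locus `e^α = 1` both sides vanish with `δ_k`; this is where `k_α ≠ 0` enters.
  by_cases hq : rootSq i t = 0
  · have hd : delta P k t = 0 := by
      refine Finset.prod_eq_zero (Finset.mem_univ i) ?_
      rw [pow_eq_zero_iff two_ne_zero |>.1 hq, Real.zero_rpow hi]
    simp [symTerm, hd, delta_torusRefl hk']
  · have hq' : (rootSq i t : ℂ) ≠ 0 := by exact_mod_cast hq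
    rw [rootSq_cast] at hq'
    obtain ⟨h1, h2⟩ := mul_ne_zero_iff.1 hq'
    have e1 := evalHom_stringSum i y t
    have e2 := evalHom_stringSum i y (torusRefl P i t)
    have e3 := congrArg (starRingEnd ℂ) (evalHom_stringSum i x t)
    have e4 := congrArg (starRingEnd ℂ) (evalHom_stringSum i x (torusRefl P i t))
    have him : ((character P (rootWeight P i) t).im : ℂ) =
        (character P (rootWeight P i) t - (character P (rootWeight P i) t)⁻¹) /
          (2 * Complex.I) := by
      rw [← character_neg, ← conj_character, Complex.im_eq_sub_conj]
    rw [symTerm, Complex.ofReal_div, him, rootSq_cast, smul_sub]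
    simp only [evalHom_expW, delta_torusRefl hk', map_sub, map_mul, map_one, map_inv₀,
      conj_character, character_neg, inv_inv, character_torusRefl, neg_rootWeight,
      refl_smul_smul, character_sub] at *
    set u := character P (rootWeight P i) t
    have hu : u ≠ 0 := character_ne_zero _ _
    have hx : character P x t ≠ 0 := character_ne_zero _ _
    have hx' : character P (refl P i • x) t ≠ 0 := character_ne_zero _ _
    set X := character P x t
    set X' := character P (refl P i • x) t
    set Y := character P y t
    set Y' := character P (refl P i • y) t
    rw [mul_comm] at e1
    replace e1 := eq_div_of_mul_eq h2 e1
    rw [mul_comm] at e2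
    replace e2 := eq_div_of_mul_eq h1 e2
    rw [mul_comm] at e3
    replace e3 := eq_div_of_mul_eq h1 e3
    rw [mul_comm] at e4
    replace e4 := eq_div_of_mul_eq h2 e4
    rw [e1, e2, e3, e4]
    have h3 : (1 - u⁻¹) = -(1 - u) * u⁻¹ := by field_simp; ring
    rw [h3]
    have hI := Complex.I_ne_zero
    field_simp
    ring

theorem innerK_cherednikExp (hk : ∀ i, 0 ≤ k i) (hk' : ∀ i j, k (P.reflectionPerm i j) = k j)
    (ξ : N) (x y : weightLattice P) : innerK P k vol (cherednikExp b k ξ x) (expW y) =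
      innerK P k vol (expW x) (cherednikExp b k ξ y) := by
  rw [← sub_eq_zero, ← neg_eq_zero, neg_sub]
  simp only [← innerForm_apply hk, cherednikExp, map_add, map_sum, map_smul, map_smulₛₗ,
    Complex.conj_ofReal, LinearMap.add_apply, LinearMap.sum_apply, LinearMap.smul_apply,
    smul_eq_mul]
  have h := integral_by_parts vol hk hk' (y - x) ξ
  rw [SimpleRoots.sum_eq_sum_posIdx (b := b), ← innerK_expW_expW, ← innerForm_apply hk] at h
  -- The contributions of `α` and `-α` to the integration by parts formula combine, up to the factor
  -- `2πi`, into the defect of symmetry of one divided difference. For `k_α = 0` both sides are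
  -- zero.
  have h2 : ∀ i ∈ b.posIdx, ((k i * P.toLinearMap (P.root i) ξ : ℝ) : ℂ) *
      innerForm P hk vol (expW x) (stringSum i y) - ((k i * P.toLinearMap (P.root i) ξ : ℝ) : ℂ) *
        innerForm P hk vol (stringSum i x) (expW y) =
      (2 * Real.pi * Complex.I)⁻¹ * (((k i / 2 * (4 * Real.pi * P.toLinearMap (P.root i) ξ) : ℝ) : ℂ) *
        ∫ t, symTerm i (y - x) (delta P k t) (rootSq i t) t ∂vol +
        ((k (refl P i • i) / 2 * (4 * Real.pi * P.toLinearMap (P.root (refl P i • i)) ξ) : ℝ) : ℂ) *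
        ∫ t, symTerm (refl P i • i) (y - x) (delta P k t) (rootSq (refl P i • i) t) t ∂vol) := by
    intro i _
    simp only [symTerm_neg_idx, integral_neg, mult_smul hk', refl_smul_self_idx_root, map_neg,
      LinearMap.neg_apply]
    by_cases hi : k i = 0
    · simp [hi]
    rw [← mul_sub, innerForm_apply, innerForm_apply, ← integral_symTerm_eq vol hk hk' hi]
    have hpi : (Real.pi : ℂ) ≠ 0 := by exact_mod_cast Real.pi_ne_zero
    push_cast
    generalize (∫ t, symTerm i (y - x) (delta P k t) (rootSq i t) t ∂vol) = J
    field_simp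
    rw [Complex.I_sq]
    ring
  rw [add_sub_add_comm, ← Finset.sum_sub_distrib, Finset.sum_congr rfl h2, ← Finset.mul_sum]
  have hpi : (2 * Real.pi * Complex.I : ℂ) ≠ 0 := by
    have : (Real.pi : ℂ) ≠ 0 := by exact_mod_cast Real.pi_ne_zero
    simp [this]
  rw [eq_neg_of_add_eq_zero_right h]
  rw [AddSubgroup.coe_sub, map_sub, LinearMap.sub_apply]
  push_cast
  field_simp
  ring

/-- The Cherednik operators are symmetric. -/
theorem innerK_cherednik (hk : ∀ i, 0 ≤ k i) (hk' : ∀ i j, k (P.reflectionPerm i j) = k j)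
    (ξ : N) (p q : Laurent P) : innerK P k vol (cherednik b k ξ p) q =
      innerK P k vol p (cherednik b k ξ q) := by
  have hp : p ∈ Submodule.span ℂ (Set.range (expW (P := P))) := by rw [expW_span]; trivial
  have hq : q ∈ Submodule.span ℂ (Set.range (expW (P := P))) := by rw [expW_span]; trivial
  simp only [← innerForm_apply hk]
  induction hp using Submodule.span_induction with
  | zero => simp
  | add p p' _ _ h h' => simp only [map_add, LinearMap.add_apply, h, h']
  | smul c p _ h =>
    simp only [map_smul, map_smulₛₗ, LinearMap.smul_apply, h]
  | mem p hp =>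
    obtain ⟨x, rfl⟩ := hp
    induction hq using Submodule.span_induction with
    | zero => simp
    | add p p' _ _ h h' => simp only [map_add, h, h']
    | smul c p _ h => simp only [map_smul, h]
    | mem q hq =>
      obtain ⟨y, rfl⟩ := hq
      rw [cherednik_expW, cherednik_expW]
      exact innerK_cherednikExp vol hk hk' ξ x y

end Symmetry

/-! ### Orthogonal projection -/

section Projection

variable {V : Type*} [AddCommGroup V] [Module ℂ V]

/-- Orthogonal projection onto the span of a finite set. -/
theorem exists_sub_mem_span_orthogonal (c : InnerProductSpace.Core ℂ V) {S : Set V}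
    (hS : S.Finite) (v : V) :
    ∃ p, p - v ∈ Submodule.span ℂ S ∧ ∀ s ∈ S, c.inner p s = 0 := by
  let _ := c
  let _ : NormedAddCommGroup V := InnerProductSpace.Core.toNormedAddCommGroup (𝕜 := ℂ)
  let _ : InnerProductSpace ℂ V := InnerProductSpace.ofCore c.toCore
  have : FiniteDimensional ℂ (Submodule.span ℂ S) := FiniteDimensional.span_of_finite ℂ hS
  refine ⟨v - (Submodule.span ℂ S).starProjection v, ?_, fun s hs => ?_⟩
  · rw [sub_sub_cancel_left]
    exact neg_mem (Submodule.starProjection_apply_mem _ _)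
  · exact Submodule.starProjection_inner_eq_zero (K := Submodule.span ℂ S) v s
      (Submodule.subset_span hs)

end Projection

/-! ### Existence, eigenfunctions and separation of the spectrum -/

section Eigenfunctions

variable {ι M N : Type*} [AddCommGroup M] [Module ℝ M] [NormedAddCommGroup N] [NormedSpace ℝ N]
variable {P : RootPairing ι ℝ M N} [Fintype ι] [P.IsRootSystem] [P.IsCrystallographic]
variable {b : SimpleRoots P} {k : ι → ℝ}

section Uniqueness

variable (hk : ∀ i, 0 ≤ k i) (vol : Measure (Torus P)) [vol.IsAddHaarMeasure]
include hk

theorem innerK_eq_zero_of_mem_span {S : Set (Laurent P)} {p q : Laurent P}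
    (hp : ∀ s ∈ S, innerK P k vol p s = 0) (hq : q ∈ Submodule.span ℂ S) :
    innerK P k vol p q = 0 := by
  have : Submodule.span ℂ S ≤ LinearMap.ker (innerForm P hk vol p) := Submodule.span_le.2 hp
  exact this hq

/-- The difference lies in the span and is orthogonal to it, hence to itself. -/
theorem eq_of_sub_mem_span {S : Set (Laurent P)} {p q : Laurent P}
    (h : p - q ∈ Submodule.span ℂ S) (hp : ∀ s ∈ S, innerK P k vol p s = 0)
    (hq : ∀ s ∈ S, innerK P k vol q s = 0) : p = q := by
  refine sub_eq_zero.1 ((innerCore P k hk vol).definite _ ?_)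
  change innerK P k vol (p - q) (p - q) = 0
  refine innerK_eq_zero_of_mem_span hk vol (fun s hs => ?_) h
  rw [← innerForm_apply hk, map_sub, LinearMap.sub_apply, innerForm_apply, innerForm_apply,
    hp s hs, hq s hs, sub_zero]

theorem existsUnique_projection {S : Set (Laurent P)} (hS : S.Finite) (v : Laurent P) :
    ∃! p, p - v ∈ Submodule.span ℂ S ∧ ∀ s ∈ S, innerK P k vol p s = 0 := by
  obtain ⟨p, hp, hp'⟩ := exists_sub_mem_span_orthogonal (innerCore P k hk vol) hS v
  refine ⟨p, ⟨hp, hp'⟩, fun q hq => eq_of_sub_mem_span hk vol ?_ hq.2 hp'⟩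
  simpa using sub_mem hq.1 hp

end Uniqueness

variable (b) in
/-- The span of the exponentials of the weights strictly below a weight. -/
def SimpleRoots.lowerSpan (x : weightLattice P) : Submodule ℂ (Laurent P) :=
  Submodule.span ℂ (expW '' {y : weightLattice P | b.weightLE y x ∧ y ≠ x})

theorem SimpleRoots.expW_mem_lowerSpan {x y : weightLattice P} (h : b.weightLE y x)
    (hne : y ≠ x) : expW y ∈ b.lowerSpan x := Submodule.subset_span ⟨y, ⟨h, hne⟩, rfl⟩

theorem SimpleRoots.weightLE.ne_of_ne {x y z : weightLattice P} (h : b.weightLE z y)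
    (h' : b.weightLE y x) (hne : y ≠ x) : z ≠ x := by
  rintro rfl
  exact hne (h'.antisymm h)

theorem SimpleRoots.lowerSpan_mono {x y : weightLattice P} (h : b.weightLE y x) :
    b.lowerSpan y ≤ b.lowerSpan x := by
  refine Submodule.span_mono (Set.image_mono ?_)
  rintro z ⟨hz, hne⟩
  exact ⟨hz.trans h, fun hzx => hne (hz.antisymm (hzx ▸ h))⟩

theorem ipr_neg_idx (x : weightLattice P) (i : ι) : ipr x (refl P i • i) = -ipr x i := by
  have h := pr_neg_idx (P := P) (x : M) i
  rw [← ipr_cast, ← ipr_cast] at h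
  exact_mod_cast h

theorem rootWeight_neg_idx (i : ι) : rootWeight P (refl P i • i) = -rootWeight P i :=
  Subtype.ext (refl_smul_self_idx_root i)

theorem SimpleRoots.expW_string_mem_lowerSpan {x : weightLattice P} {i : ι} {n : ℤ} (h0 : 0 < n)
    (h1 : n < ipr x i) : expW (x - n • rootWeight P i) ∈ b.lowerSpan x := by
  have h := domRep_string (b := b) h0 h1
  exact expW_mem_lowerSpan (weightLE_iff.2 (Or.inl h)) fun h' => h.2 (by rw [h'])

open Classical in
-- Interior points of the string lie in strictly lower orbits. The end `x` occurs only for a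
-- positive pairing, and the end `s_α x` only for a negative one, when it is strictly below `x`.
theorem SimpleRoots.stringSum_sub_mem {i : ι} (hi : b.IsPos i) (x : weightLattice P) :
    stringSum i x - (if 0 < pr P (x : M) i then expW x else 0) ∈ b.lowerSpan x := by
  rw [← ipr_cast, stringSum]
  rcases lt_trichotomy 0 (ipr x i) with h | h | h
  · rw [if_pos (by exact_mod_cast h)]
    obtain ⟨n, hn⟩ : ∃ n : ℕ, ipr x i = n + 1 :=
      ⟨(ipr x i - 1).toNat, by rw [Int.toNat_of_nonneg (by linarith)]; ring⟩
    have h1 : (ipr x i).toNat = n + 1 := by omega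
    have h2 : (-ipr x i).toNat = 0 := by omega
    rw [h1, h2, Finset.range_zero, Finset.sum_empty, sub_zero, Finset.sum_range_succ', Nat.cast_zero,
      zero_smul, sub_zero, add_sub_cancel_right]
    refine sum_mem fun j hj => expW_string_mem_lowerSpan ?_ ?_
    · push_cast; positivity
    · rw [hn]
      have := Finset.mem_range.1 hj
      push_cast; linarith [(Nat.cast_lt (α := ℤ)).2 this]
  · rw [← h]; simp
  · rw [if_neg (by exact_mod_cast h.not_gt), sub_zero]
    have h1 : (ipr x i).toNat = 0 := by omega
    rw [h1, Finset.range_zero, Finset.sum_empty, zero_sub]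
    refine neg_mem (sum_mem fun j hj => ?_)
    have hj' := Finset.mem_range.1 hj
    -- The last term of the string is `s_α x`; the others are interior points, seen from `x` in the
    -- direction of `-α`.
    rcases (Nat.succ_le_of_lt hj').eq_or_lt with h2 | h2
    · have h3 : -((j : ℤ) + 1) = ipr x i := by omega
      rw [h3, ← refl_smul_weight]
      have hlt : pr P (x : M) i < 0 := by rw [← ipr_cast]; exact_mod_cast h
      have hstep : b.orbitStep (refl P i • x) x := by
        refine ⟨i, hi, (refl_smul_smul _ _).symm, ?_⟩
        rw [coe_weyl_smul, pr_smul, refl_inv, pr_neg_idx]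
        linarith
      refine expW_mem_lowerSpan (weightLE_iff.2 (Or.inr (Relation.ReflTransGen.single hstep))) ?_
      intro heq
      have h4 := congrArg (fun z : weightLattice P => pr P (z : M) i) heq
      simp only [coe_weyl_smul] at h4
      rw [pr_smul, refl_inv, pr_neg_idx] at h4
      linarith
    · have := expW_string_mem_lowerSpan (b := b) (x := x) (i := refl P i • i) (n := j + 1)
        (by positivity) (by rw [ipr_neg_idx]; omega)
      rwa [rootWeight_neg_idx, smul_neg, ← neg_smul] at this

variable (b k)

/-- The eigenvalue of the Cherednik operators on the non-symmetric polynomial `E(x, k)`. -/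
def spectralVector (x : weightLattice P) : M := by
  classical
  exact (x : M) + ∑ i ∈ b.posIdx, if 0 < pr P (x : M) i then k i • P.root i else 0

variable {b k}

theorem cherednikExp_sub_mem (ξ : N) (x : weightLattice P) :
    cherednikExp b k ξ x - ((P.toLinearMap (spectralVector b k x) ξ : ℝ) : ℂ) • expW x ∈
      b.lowerSpan x := by
  classical
  have h : cherednikExp b k ξ x - ((P.toLinearMap (spectralVector b k x) ξ : ℝ) : ℂ) • expW x =
      ∑ i ∈ b.posIdx, ((k i * P.toLinearMap (P.root i) ξ : ℝ) : ℂ) •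
        (stringSum i x - (if 0 < pr P (x : M) i then expW x else 0)) := by
    rw [cherednikExp, spectralVector]
    simp only [map_add, LinearMap.add_apply, map_sum, LinearMap.sum_apply, Complex.ofReal_add,
      add_smul, add_sub_add_left_eq_sub, Complex.ofReal_sum, Finset.sum_smul]
    rw [← Finset.sum_sub_distrib]
    refine Finset.sum_congr rfl fun i _ => ?_
    rw [smul_sub]
    congr 1
    split_ifs <;> simp
  rw [h]
  exact sum_mem fun i hi =>
    Submodule.smul_mem _ _ (SimpleRoots.stringSum_sub_mem (SimpleRoots.mem_posIdx.1 hi) x)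

theorem cherednik_mem_lowerSpan (ξ : N) {x : weightLattice P} {p : Laurent P}
    (hp : p ∈ b.lowerSpan x) : cherednik b k ξ p ∈ b.lowerSpan x := by
  have : b.lowerSpan x ≤ (b.lowerSpan x).comap (cherednik b k ξ) := by
    refine Submodule.span_le.2 ?_
    rintro _ ⟨y, ⟨hy, hne⟩, rfl⟩
    change cherednik b k ξ (expW y) ∈ b.lowerSpan x
    rw [cherednik_expW]
    have h := add_mem (SimpleRoots.lowerSpan_mono hy (cherednikExp_sub_mem (b := b) (k := k) ξ y))
      (Submodule.smul_mem _ ((P.toLinearMap (spectralVector b k y) ξ : ℝ) : ℂ)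
        (SimpleRoots.expW_mem_lowerSpan hy hne))
    rwa [sub_add_cancel] at h
  exact this hp

section Orthogonality

variable (hk : ∀ i, 0 ≤ k i) (hk' : ∀ i j, k (P.reflectionPerm i j) = k j)
  {vol : Measure (Torus P)} [vol.IsAddHaarMeasure]
include hk hk'

/-- The non-symmetric polynomials are eigenfunctions of the Cherednik operators. -/
theorem IsNonsymmetric.cherednik_eq {x : weightLattice P} {E : Laurent P}
    (hE : IsNonsymmetric b k vol x E) (ξ : N) :
    cherednik b k ξ E = ((P.toLinearMap (spectralVector b k x) ξ : ℝ) : ℂ) • E := by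
  set c : ℂ := ((P.toLinearMap (spectralVector b k x) ξ : ℝ) : ℂ)
  have horth : ∀ s ∈ expW '' {y : weightLattice P | b.weightLE y x ∧ y ≠ x},
      innerK P k vol E s = 0 := by
    rintro _ ⟨y, ⟨hy, hne⟩, rfl⟩
    exact hE.orthogonal y hy hne
  -- `D E` and `c E` differ by lower terms. Both are orthogonal to all lower terms, `D E` because
  -- `D` is symmetric and preserves the lower span. Hence they are equal.
  refine eq_of_sub_mem_span hk vol (S := expW '' {y : weightLattice P | b.weightLE y x ∧ y ≠ x})
    ?_ ?_ ?_
  · have h1 : cherednik b k ξ E - c • E = cherednik b k ξ (E - expW x) +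
        (cherednikExp b k ξ x - c • expW x) - c • (E - expW x) := by
      rw [map_sub, cherednik_expW, smul_sub]
      abel
    rw [h1]
    exact sub_mem (add_mem (cherednik_mem_lowerSpan ξ hE.triangular) (cherednikExp_sub_mem ξ x))
      (Submodule.smul_mem _ _ hE.triangular)
  · intro s hs
    rw [innerK_cherednik vol hk hk']
    exact innerK_eq_zero_of_mem_span hk vol horth
      (cherednik_mem_lowerSpan ξ (Submodule.subset_span hs))
  · intro s hs
    rw [← innerForm_apply hk, map_smulₛₗ, LinearMap.smul_apply, innerForm_apply, horth s hs,
      smul_zero]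

/-- Some operator of the family has distinct real eigenvalues on the two polynomials, and it is
symmetric. -/
theorem IsNonsymmetric.inner_eq_zero {x y : weightLattice P} {E F : Laurent P}
    (hE : IsNonsymmetric b k vol x E) (hF : IsNonsymmetric b k vol y F)
    (hne : spectralVector b k x ≠ spectralVector b k y) : innerK P k vol E F = 0 := by
  obtain ⟨ξ, hξ⟩ : ∃ ξ : N, P.toLinearMap (spectralVector b k x) ξ ≠
      P.toLinearMap (spectralVector b k y) ξ := by
    by_contra! h
    exact hne (P.toPerfPair.injective (LinearMap.ext h))
  have h := innerK_cherednik (b := b) vol hk hk' ξ E F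
  rw [hE.cherednik_eq hk hk', hF.cherednik_eq hk hk', ← innerForm_apply hk, ← innerForm_apply hk,
    map_smulₛₗ, map_smul, LinearMap.smul_apply, Complex.conj_ofReal, smul_eq_mul, smul_eq_mul,
    ← sub_eq_zero, ← sub_mul] at h
  refine (mul_eq_zero.1 h).resolve_left fun h0 => hξ ?_
  exact_mod_cast sub_eq_zero.1 h0

end Orthogonality

section Separation

variable (b k) in
/-- The vector `∑ k_α α`, the sum over the positive roots. -/
def rhoVector : M := ∑ i ∈ b.posIdx, k i • P.root i

open Classical in
theorem smul_rhoVector (hk' : ∀ i j, k (P.reflectionPerm i j) = k j) (w : P.weylGroup) :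
    w • rhoVector b k = ∑ i ∈ b.posIdx,
      if b.IsPos (w⁻¹ • i) then k i • P.root i else -(k i • P.root i) := by
  have h1 : w • rhoVector b k = ∑ i, if b.IsPos (w⁻¹ • i) then k i • P.root i else 0 := by
    rw [rhoVector, Finset.smul_sum, ← Finset.sum_filter]
    refine Finset.sum_nbij' (fun i => w • i) (fun i => w⁻¹ • i) ?_ ?_ ?_ ?_ ?_
    · intro i hi
      simpa using SimpleRoots.mem_posIdx.1 hi
    · intro i hi
      exact SimpleRoots.mem_posIdx.2 (Finset.mem_filter.1 hi).2
    · intro i _; simp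
    · intro i _; simp
    · intro i _
      rw [weyl_smul_smul, mult_smul hk', root_smul]
  rw [h1, SimpleRoots.sum_eq_sum_posIdx (b := b)]
  refine Finset.sum_congr rfl fun i _ => ?_
  rw [smul_neg_idx, b.isPos_neg_iff, mult_smul hk', refl_smul_self_idx_root, smul_neg]
  by_cases h : b.IsPos (w⁻¹ • i) <;> simp [h]

/-- It suffices to treat a simple coroot, whose pairing with `ρ = ∑ k_α α` is the height of `ρ - s_j
ρ`. That difference is the sum of `2 k_α α` over the positive roots made negative by `s_j`. -/
theorem pr_rhoVector_nonneg (hk : ∀ i, 0 ≤ k i) (hk' : ∀ i j, k (P.reflectionPerm i j) = k j)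
    {i : ι} (hi : b.IsPos i) : 0 ≤ pr P (rhoVector b k) i := by
  classical
  refine b.pr_nonneg_of_simple (I := b.support) subset_rfl (fun j hj => ?_)
    (b.mem_posRoots_support.2 hi)
  have h1 := smul_rhoVector (b := b) hk' (refl P j)
  have h2 : pr P (rhoVector b k) j = b.height (rhoVector b k - refl P j • rhoVector b k) := by
    rw [refl_smul, sub_sub_cancel, map_smul, b.height_root hj, smul_eq_mul, mul_one]
  rw [h2, h1]
  conv_rhs => rw [rhoVector]
  rw [← Finset.sum_sub_distrib, map_sum]
  refine Finset.sum_nonneg fun a ha => ?_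
  split_ifs
  · simp
  · have := (SimpleRoots.mem_posIdx.1 ha).height_pos
    rw [sub_neg_eq_add, map_add, map_smul, smul_eq_mul]
    have := mul_nonneg (hk a) this.le
    linarith

theorem exists_smul_spectralVector (hk' : ∀ i j, k (P.reflectionPerm i j) = k j)
    (x : weightLattice P) : ∃ w : P.weylGroup, w • b.domRep x = x ∧
      (2 : ℝ) • spectralVector b k x =
        w • ((2 : ℝ) • (b.domRep x : M) + rhoVector b k) + rhoVector b k := by
  classical
  have := finite_weylGroup P
  -- The longest `w` with `w x₊ = x`. For positive `α` orthogonal to `x`, maximality forces `w⁻¹ α`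
  -- to be negative, which matches the strict inequality in the spectral vector.
  obtain ⟨w, hw, hmax⟩ := Set.exists_max_image {w : P.weylGroup | w • b.domRep x = x} b.length
    (Set.toFinite _) ⟨_, (b.vbar_spec x).1⟩
  refine ⟨w, hw, ?_⟩
  have hd := (b.domRep_spec x).2
  have hx : ∀ i, pr P (x : M) i = pr P (b.domRep x : M) (w⁻¹ • i) := fun i => by
    rw [← pr_smul, ← coe_weyl_smul, hw]
  have key : ∀ i ∈ b.posIdx, (0 < pr P (x : M) i ↔ b.IsPos (w⁻¹ • i)) := by
    intro i hi
    rw [SimpleRoots.mem_posIdx] at hi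
    rw [hx]
    constructor
    · intro h
      by_contra hneg
      have := hd _ (b.isPos_neg_iff.2 hneg)
      change 0 ≤ pr P _ _ at this
      rw [pr_neg_idx] at this
      linarith
    · intro h
      refine lt_of_le_of_ne' (hd _ h) fun h0 => ?_
      change pr P _ _ = 0 at h0
      have h1 := b.length_lt_refl_mul hi h
      refine absurd (hmax (refl P i * w) ?_) (not_le.2 h1)
      refine Subtype.ext ?_
      rw [mul_smul, hw, coe_weyl_smul, refl_smul, hx, h0, zero_smul, sub_zero]
  rw [smul_add, weyl_smul_smul, ← coe_weyl_smul, hw, smul_rhoVector hk', spectralVector, smul_add,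
    add_assoc]
  congr 1
  rw [rhoVector, ← Finset.sum_add_distrib, Finset.smul_sum]
  refine Finset.sum_congr rfl fun i hi => ?_
  simp only [key i hi]
  split_ifs
  · rw [two_smul]
  · simp

/-- The spectral vectors of distinct weights in one Weyl group orbit are distinct. -/
theorem spectralVector_injOn_orbit (hk : ∀ i, 0 ≤ k i)
    (hk' : ∀ i j, k (P.reflectionPerm i j) = k j) {x y : weightLattice P}
    (hxy : b.domRep x = b.domRep y) (h : spectralVector b k x = spectralVector b k y) : x = y := by
  obtain ⟨w, hw, h1⟩ := exists_smul_spectralVector (b := b) hk' x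
  obtain ⟨u, hu, h2⟩ := exists_smul_spectralVector (b := b) hk' y
  rw [h, h2, add_right_cancel_iff, hxy] at h1
  have hd := (b.domRep_spec y).2
  set d := b.domRep y
  set v : M := (2 : ℝ) • (d : M) + rhoVector b k with hv
  have hpr : ∀ i, pr P v i = 2 * pr P (d : M) i + pr P (rhoVector b k) i := fun i => by
    simp [pr, hv]
  have hdom : ∀ i ∈ b.posRoots b.support, 0 ≤ pr P v i := fun i hi => by
    have h3 : 0 ≤ pr P (d : M) i := hd i hi.2
    have h4 := pr_rhoVector_nonneg (b := b) hk hk' hi.2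
    rw [hpr]; linarith
  have hfix : (u⁻¹ * w) • v = v := by rw [mul_smul, ← h1, inv_smul_smul]
  have hmem := b.mem_parabolic_of_dominant subset_rfl
    (SimpleRoots.mem_parabolic_support (u⁻¹ * w)) hdom (by rwa [hfix])
  -- Both `x₊` and `∑ k_α α` pair non-negatively with positive coroots. So a simple reflection that
  -- fixes `2 x₊ + ∑ k_α α` already fixes `x₊`, even when some `k_α` vanish.
  have hfix2 : (u⁻¹ * w) • (d : M) = d := smul_eq_of_mem_parabolic hmem fun j hj => by
    have h3 : 0 ≤ pr P (d : M) j := hd j (b.isPos_of_mem hj.1)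
    have h4 := pr_rhoVector_nonneg (b := b) hk hk' (b.isPos_of_mem hj.1)
    have h5 := hj.2
    rw [hpr] at h5
    linarith
  have h3 : (u⁻¹ * w) • d = d := Subtype.ext hfix2
  rw [mul_smul, inv_smul_eq_iff] at h3
  rw [← hw, ← hu, hxy, h3]

end Separation

section Existence

variable (b) (hk : ∀ i, 0 ≤ k i) (vol : Measure (Torus P)) [vol.IsAddHaarMeasure]
include hk

theorem existsUnique_isNonsymmetric (x : weightLattice P) :
    ∃! E : Laurent P, IsNonsymmetric b k vol x E := by
  have hfin : (expW '' {y : weightLattice P | b.weightLE y x ∧ y ≠ x}).Finite :=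
    ((SimpleRoots.finite_weightLE x).subset fun y hy => hy.1).image _
  obtain ⟨E, ⟨h1, h2⟩, h3⟩ := existsUnique_projection hk vol hfin (expW x)
  exact ⟨E, ⟨h1, fun y hy hne => h2 _ ⟨y, ⟨hy, hne⟩, rfl⟩⟩, fun F hF =>
    h3 F ⟨hF.triangular, by rintro _ ⟨y, ⟨hy, hne⟩, rfl⟩; exact hF.orthogonal y hy hne⟩⟩

end Existence

/-- The polynomial `E(x, k)` is orthogonal to all exponentials `e^y` in the same orbit for which
`y` is not above `x`. -/
theorem IsNonsymmetric.inner_expW_eq_zero (hk : ∀ i, 0 ≤ k i)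
    (hk' : ∀ i j, k (P.reflectionPerm i j) = k j) {vol : Measure (Torus P)}
    [vol.IsAddHaarMeasure] {x y : weightLattice P} {E : Laurent P}
    (hE : IsNonsymmetric b k vol x E) (hy : b.domRep y = b.domRep x)
    (hxy : ¬ b.weightLE x y) : innerK P k vol E (expW y) = 0 := by
  induction hn : {z | b.weightLE z y}.ncard using Nat.strong_induction_on generalizing y with
  | _ n ih =>
  subst hn
  obtain ⟨F, hF, -⟩ := existsUnique_isNonsymmetric b hk vol y
  have h1 : innerK P k vol E F = 0 := by
    refine hE.inner_eq_zero hk hk' hF fun h => hxy ?_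
    rw [spectralVector_injOn_orbit hk hk' hy.symm h]
    exact SimpleRoots.weightLE_refl _
  have h2 : innerK P k vol E (F - expW y) = 0 := by
    refine innerK_eq_zero_of_mem_span hk vol ?_ hF.triangular
    rintro _ ⟨z, ⟨hz, hne⟩, rfl⟩
    -- Terms of `F` in the orbit of `x` are handled by induction on the number of weights below;
    -- those in lower orbits lie below `x`, so the definition of `E` applies.
    by_cases hd : b.domRep z = b.domRep x
    · refine ih _ (Set.ncard_lt_ncard ?_ (SimpleRoots.finite_weightLE y)) hd
        (fun h => hxy (h.trans hz)) rfl
      refine ⟨fun a ha => SimpleRoots.weightLE.trans ha hz, fun h => hne ?_⟩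
      exact hz.antisymm (h (SimpleRoots.weightLE_refl y))
    · refine hE.orthogonal z (SimpleRoots.weightLE_iff.2 (Or.inl ⟨hy ▸ hz.1, hd⟩)) ?_
      rintro rfl
      exact hd rfl
  rw [← innerForm_apply hk, map_sub, innerForm_apply, innerForm_apply, h1, zero_sub,
    neg_eq_zero] at h2
  exact h2

end Eigenfunctions

/-! ### Symmetrization over a parabolic subgroup -/

section Symmetrization

variable {ι M N : Type*} [AddCommGroup M] [Module ℝ M] [NormedAddCommGroup N] [NormedSpace ℝ N]
variable {P : RootPairing ι ℝ M N} [Fintype ι] [P.IsRootSystem] [P.IsCrystallographic]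
variable {b : SimpleRoots P} {k : ι → ℝ}

/-- The action of the Weyl group on Laurent polynomials, as a linear map. -/
def actHom (w : P.weylGroup) : Laurent P →ₗ[ℂ] Laurent P :=
  (AddMonoidAlgebra.mapDomainAlgHom ℂ ℂ
    (DistribSMul.toAddMonoidHom (weightLattice P) w)).toLinearMap

theorem actHom_apply (w : P.weylGroup) (p : Laurent P) : actHom w p = act w p := rfl

theorem act_expW (w : P.weylGroup) (x : weightLattice P) : act w (expW x) = expW (w • x) :=
  AddMonoidAlgebra.mapDomain_single

theorem laurent_hom_ext {f g : Laurent P →ₗ[ℂ] Laurent P} (h : ∀ x, f (expW x) = g (expW x)) :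
    f = g :=
  LinearMap.ext_on_range expW_span h

theorem act_act (v w : P.weylGroup) (p : Laurent P) : act v (act w p) = act (v * w) p := by
  have : actHom v ∘ₗ actHom w = actHom (v * w) := laurent_hom_ext fun x => by
    simp only [LinearMap.comp_apply, actHom_apply, act_expW, mul_smul]
  exact LinearMap.congr_fun this p

theorem act_one (p : Laurent P) : act 1 p = p := by
  have : actHom (1 : P.weylGroup) = LinearMap.id := laurent_hom_ext fun x => by
    rw [actHom_apply, act_expW, one_smul, LinearMap.id_apply]
  exact LinearMap.congr_fun this p

theorem innerK_act_act (hk' : ∀ i j, k (P.reflectionPerm i j) = k j) (vol : Measure (Torus P))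
    [vol.IsAddHaarMeasure] (w : P.weylGroup) (p q : Laurent P) :
    innerK P k vol (act w p) (act w q) = innerK P k vol p q := by
  obtain ⟨g, hg⟩ := w
  induction hg using RootPairing.weylGroup.induction generalizing p q with
  | mem i => exact innerK_act_refl hk' vol i p q
  | one =>
    have h := act_one (P := P)
    exact congrArg₂ (innerK P k vol) (h p) (h q)
  | mul v w hv hw h1 h2 =>
    have h := h1 (act ⟨w, hw⟩ p) (act ⟨w, hw⟩ q)
    rw [h2, act_act, act_act] at h
    exact h

theorem innerK_act_left (hk' : ∀ i j, k (P.reflectionPerm i j) = k j) (vol : Measure (Torus P))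
    [vol.IsAddHaarMeasure] (w : P.weylGroup) (p q : Laurent P) :
    innerK P k vol (act w p) q = innerK P k vol p (act w⁻¹ q) := by
  rw [← innerK_act_act hk' vol w p, act_act, mul_inv_cancel, act_one]

theorem mem_orbit_parabolic {I : Set ι} {x y : weightLattice P} :
    y ∈ MulAction.orbit (parabolic P I) x ↔ ∃ w ∈ parabolic P I, w • x = y :=
  ⟨fun ⟨w, h⟩ => ⟨w, w.2, h⟩, fun ⟨w, hw, h⟩ => ⟨⟨w, hw⟩, h⟩⟩

instance : Finite P.weylGroup := finite_weylGroup P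

theorem finite_orbit (I : Set ι) (x : weightLattice P) :
    (MulAction.orbit (parabolic P I) x).Finite :=
  Set.finite_range _

theorem act_orbitSum {I : Set ι} {w : P.weylGroup} (hw : w ∈ parabolic P I)
    (x : weightLattice P) : act w (orbitSum (parabolic P I) x) = orbitSum (parabolic P I) x := by
  rw [← actHom_apply, orbitSum]
  have h1 := (actHom w).toAddMonoidHom.map_finsum_mem (fun y => expW (P := P) y)
    (finite_orbit I x)
  simp only [LinearMap.toAddMonoidHom_coe] at h1
  rw [h1]
  refine finsum_mem_eq_of_bijOn (fun y => w • y) ⟨?_, (MulAction.injective w).injOn, ?_⟩ ?_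
  · intro y hy
    obtain ⟨v, hv, rfl⟩ := mem_orbit_parabolic.1 hy
    exact mem_orbit_parabolic.2 ⟨w * v, mul_mem hw hv, mul_smul _ _ _⟩
  · intro y hy
    obtain ⟨v, hv, rfl⟩ := mem_orbit_parabolic.1 hy
    exact ⟨w⁻¹ • v • x, mem_orbit_parabolic.2 ⟨w⁻¹ * v, mul_mem (inv_mem hw) hv, mul_smul _ _ _⟩,
      smul_inv_smul _ _⟩
  · intro y _
    exact act_expW w y

/-- The elements of a parabolic subgroup, as a finite set. -/
def parabolicFinset (P : RootPairing ι ℝ M N) [P.IsRootSystem] (I : Set ι) : Finset P.weylGroup :=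
  (Set.toFinite (parabolic P I : Set P.weylGroup)).toFinset

theorem mem_parabolicFinset {I : Set ι} {w : P.weylGroup} :
    w ∈ parabolicFinset P I ↔ w ∈ parabolic P I := by
  rw [parabolicFinset, Set.Finite.mem_toFinset, SetLike.mem_coe]

/-- The stabilizer of a weight in a parabolic subgroup, as a finite set. -/
def stabilizerFinset (I : Set ι) (x : weightLattice P) : Finset P.weylGroup := by
  classical exact {w ∈ parabolicFinset P I | w • x = x}

theorem mem_stabilizerFinset {I : Set ι} {x : weightLattice P} {w : P.weylGroup} :
    w ∈ stabilizerFinset I x ↔ w ∈ parabolic P I ∧ w • x = x := by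
  classical
  rw [stabilizerFinset, Finset.mem_filter, mem_parabolicFinset]

theorem SimpleRoots.exists_mul_mem_minCosetReps {I : Set ι} (x : weightLattice P)
    {u : P.weylGroup} (hu : u ∈ parabolic P I) :
    ∃ v ∈ stabilizerFinset I x, u * v ∈ b.minCosetReps I x := by
  obtain ⟨v, hv, hmin⟩ := Finset.exists_min_image (stabilizerFinset I x) (fun v => b.length (u * v))
    ⟨1, mem_stabilizerFinset.2 ⟨one_mem _, one_smul _ _⟩⟩
  have hv' := mem_stabilizerFinset.1 hv
  refine ⟨v, hv, mul_mem hu hv'.1, fun a ha hax => ?_⟩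
  rw [mul_assoc]
  exact hmin _ (mem_stabilizerFinset.2 ⟨mul_mem hv'.1 ha, by rw [mul_smul, hax, hv'.2]⟩)

theorem SimpleRoots.minCosetReps_unique {I : Set ι} (hI : I ⊆ b.support) {x : weightLattice P}
    (hx : x ∈ b.relDominant I) {w w' : P.weylGroup} (hw : w ∈ b.minCosetReps I x)
    (hw' : w' ∈ b.minCosetReps I x) (h : w • x = w' • x) : w = w' := by
  have hmul : w * (w⁻¹ * w') = w' := mul_inv_cancel_left _ _
  have h1 : (w⁻¹ * w') • x = x := by rw [mul_smul, ← h, inv_smul_smul]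
  have hfix : ∀ v : P.weylGroup, v • (x : M) = x → v • x = x := fun v hv => Subtype.ext hv
  have h2 := b.eq_one_of_minimal hI (w := w) (u := w⁻¹ * w') (x := (x : M)) hx
    (mul_mem (inv_mem hw.1) hw'.1) (congrArg Subtype.val h1)
    (fun v hv hvx => hw.2 v hv (hfix v hvx))
    (fun v hv hvx => by rw [hmul]; exact hw'.2 v hv (hfix v hvx))
  rw [← hmul, h2, mul_one]

/-- Every element of `W_I` factors uniquely as a minimal coset representative times an element of
the stabilizer. -/
theorem SimpleRoots.sum_parabolic {A : Type*} [AddCommMonoid A] {I : Set ι} (hI : I ⊆ b.support)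
    {x : weightLattice P} (hx : x ∈ b.relDominant I) (f : P.weylGroup → A)
    (hf : ∀ w, ∀ v ∈ stabilizerFinset I x, f (w * v) = f w) :
    ∑ w ∈ parabolicFinset P I, f w =
      (stabilizerFinset I x).card • ∑ᶠ w ∈ b.minCosetReps I x, f w := by
  rw [finsum_mem_eq_finite_toFinset_sum _ (Set.toFinite _), Finset.smul_sum]
  have h1 : ∀ w ∈ (Set.toFinite (b.minCosetReps I x)).toFinset,
      (stabilizerFinset I x).card • f w = ∑ v ∈ stabilizerFinset I x, f (w * v) := fun w _ => by
    rw [Finset.sum_congr rfl (hf w), Finset.sum_const]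
  rw [Finset.sum_congr rfl h1, ← Finset.sum_product']
  symm
  refine Finset.sum_bij (fun a _ => a.1 * a.2) ?_ ?_ ?_ ?_
  · intro a ha
    rw [Finset.mem_product, Set.Finite.mem_toFinset, mem_stabilizerFinset] at ha
    exact mem_parabolicFinset.2 (mul_mem ha.1.1 ha.2.1)
  · rintro ⟨w, v⟩ ha ⟨w', v'⟩ ha' h
    rw [Finset.mem_product, Set.Finite.mem_toFinset, mem_stabilizerFinset] at ha ha'
    simp only at h ha ha'
    have h2 : w = w' := minCosetReps_unique hI hx ha.1 ha'.1 (by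
      rw [← ha.2.2, ← mul_smul, h, mul_smul, ha'.2.2, ha.2.2])
    subst h2
    rw [mul_left_cancel h]
  · intro u hu
    obtain ⟨v, hv, hm⟩ := exists_mul_mem_minCosetReps (b := b) x (mem_parabolicFinset.1 hu)
    refine ⟨(u * v, v⁻¹), ?_, by simp⟩
    rw [Finset.mem_product, Set.Finite.mem_toFinset, mem_stabilizerFinset]
    rw [mem_stabilizerFinset] at hv
    exact ⟨hm, inv_mem hv.1, inv_smul_eq_iff.2 hv.2.symm⟩
  · intro a _; rfl

theorem SimpleRoots.orbitSum_eq {I : Set ι} (hI : I ⊆ b.support)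
    {x : weightLattice P} (hx : x ∈ b.relDominant I) :
    orbitSum (parabolic P I) x = ∑ᶠ w ∈ b.minCosetReps I x, expW (w • x) := by
  symm
  refine finsum_mem_eq_of_bijOn (fun w => w • x) ⟨?_, ?_, ?_⟩ fun w _ => rfl
  · intro w hw
    exact mem_orbit_parabolic.2 ⟨w, hw.1, rfl⟩
  · intro w hw w' hw' h
    exact minCosetReps_unique hI hx hw hw' h
  · intro y hy
    obtain ⟨u, hu, rfl⟩ := mem_orbit_parabolic.1 hy
    obtain ⟨v, hv, hm⟩ := exists_mul_mem_minCosetReps (b := b) x hu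
    refine ⟨u * v, hm, ?_⟩
    simp only [mul_smul, (mem_stabilizerFinset.1 hv).2]

/-- The sum over all translates under a parabolic subgroup, as a linear map. -/
def symmetrize (P : RootPairing ι ℝ M N) [P.IsRootSystem] (I : Set ι) : Laurent P →ₗ[ℂ] Laurent P :=
  ∑ w ∈ parabolicFinset P I, actHom w

theorem symmetrize_apply (I : Set ι) (p : Laurent P) :
    symmetrize P I p = ∑ w ∈ parabolicFinset P I, act w p := by
  simp only [symmetrize, LinearMap.sum_apply, actHom_apply]

theorem symmetrize_act {I : Set ι} {w : P.weylGroup} (hw : w ∈ parabolic P I) (p : Laurent P) :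
    symmetrize P I (act w p) = symmetrize P I p := by
  simp only [symmetrize_apply, act_act]
  refine Finset.sum_nbij' (fun v => v * w) (fun v => v * w⁻¹) ?_ ?_ ?_ ?_ ?_
  · exact fun v hv => mem_parabolicFinset.2 (mul_mem (mem_parabolicFinset.1 hv) hw)
  · exact fun v hv => mem_parabolicFinset.2 (mul_mem (mem_parabolicFinset.1 hv) (inv_mem hw))
  · exact fun v _ => mul_inv_cancel_right v w
  · exact fun v _ => inv_mul_cancel_right v w
  · exact fun _ _ => rfl

theorem act_symmetrize {I : Set ι} {w : P.weylGroup} (hw : w ∈ parabolic P I) (p : Laurent P) :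
    act w (symmetrize P I p) = symmetrize P I p := by
  rw [symmetrize_apply, ← actHom_apply, map_sum]
  simp only [actHom_apply, act_act]
  refine Finset.sum_nbij' (fun v => w * v) (fun v => w⁻¹ * v) ?_ ?_ ?_ ?_ ?_
  · exact fun v hv => mem_parabolicFinset.2 (mul_mem hw (mem_parabolicFinset.1 hv))
  · exact fun v hv => mem_parabolicFinset.2 (mul_mem (inv_mem hw) (mem_parabolicFinset.1 hv))
  · exact fun v _ => inv_mul_cancel_left w v
  · exact fun v _ => mul_inv_cancel_left w v
  · exact fun _ _ => rfl

theorem SimpleRoots.symmetrize_expW {I : Set ι} (hI : I ⊆ b.support) {x : weightLattice P}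
    (hx : x ∈ b.relDominant I) : symmetrize P I (expW x) =
      (stabilizerFinset I x).card • orbitSum (parabolic P I) x := by
  rw [orbitSum_eq hI hx, symmetrize_apply]
  simp only [act_expW]
  refine sum_parabolic hI hx (fun w => expW (w • x)) fun w v hv => ?_
  rw [mul_smul, (mem_stabilizerFinset.1 hv).2]

variable (hk : ∀ i, 0 ≤ k i) (hk' : ∀ i j, k (P.reflectionPerm i j) = k j)
  {vol : Measure (Torus P)} [vol.IsAddHaarMeasure]
include hk hk'

/-- If `s_j` fixes `x`, it permutes the weights below `x`. Then `s_j E` meets the conditions that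
determine `E`. -/
theorem IsNonsymmetric.act_refl_eq {j : ι} (hj : j ∈ b.support) {x : weightLattice P}
    (hjx : refl P j • x = x) {E : Laurent P} (hE : IsNonsymmetric b k vol x E) :
    act (refl P j) E = E := by
  have hlow : ∀ y, b.weightLE y x → y ≠ x →
      b.weightLE (refl P j • y) x ∧ refl P j • y ≠ x := by
    refine fun y hy hne => ⟨hy.refl_smul_of_fixed hj hjx, fun h => hne ?_⟩
    rw [← hjx] at h
    exact MulAction.injective _ h
  refine (existsUnique_isNonsymmetric b hk vol x).unique ⟨?_, fun y hy hne => ?_⟩ hE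
  · have h1 : act (refl P j) E - expW x = actHom (refl P j) (E - expW x) := by
      rw [map_sub, actHom_apply, actHom_apply, act_expW, hjx]
    have h2 : b.lowerSpan x ≤ (b.lowerSpan x).comap (actHom (refl P j)) := by
      refine Submodule.span_le.2 ?_
      rintro _ ⟨y, ⟨hy, hne⟩, rfl⟩
      change act (refl P j) (expW y) ∈ b.lowerSpan x
      rw [act_expW]
      exact SimpleRoots.expW_mem_lowerSpan (hlow y hy hne).1 (hlow y hy hne).2
    rw [h1]
    exact h2 hE.triangular
  · rw [innerK_act_left hk', refl_inv, act_expW]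
    exact hE.orthogonal _ (hlow y hy hne).1 (hlow y hy hne).2

/-- The stabilizer in `W_I` of a weight in `P_I⁺` is generated by the simple reflections in `I` that
fix it. -/
theorem IsNonsymmetric.act_eq {I : Set ι} (hI : I ⊆ b.support) {x : weightLattice P}
    (hx : x ∈ b.relDominant I) {E : Laurent P} (hE : IsNonsymmetric b k vol x E)
    {v : P.weylGroup} (hv : v ∈ stabilizerFinset I x) : act v E = E := by
  rw [mem_stabilizerFinset] at hv
  have h0 : v • (x : M) = x := congrArg Subtype.val hv.2
  have h := b.mem_parabolic_of_dominant hI hv.1 hx (by rw [h0]; exact hx)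
  have key : ∀ j ∈ {j ∈ I | pr P (x : M) j = 0}, act (refl P j) E = E := fun j hj =>
    hE.act_refl_eq hk hk' (hI hj.1) (Subtype.ext (by
      rw [coe_weyl_smul, refl_smul, hj.2, zero_smul, sub_zero]))
  rw [parabolic] at h
  clear hv h0
  induction h using Subgroup.closure_induction'' with
  | one => exact act_one E
  | mem w hw => obtain ⟨j, hj, rfl⟩ := hw; exact key j hj
  | inv_mem w hw => obtain ⟨j, hj, rfl⟩ := hw; rw [refl_inv]; exact key j hj
  | mul v w _ _ h1 h2 => rw [← act_act, h2, h1]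

theorem IsNonsymmetric.inner_orbitSum_eq_zero {I : Set ι} (hI : I ⊆ b.support)
    {x : weightLattice P} (hx : x ∈ b.relDominant I) {E : Laurent P}
    (hE : IsNonsymmetric b k vol x E) {y : weightLattice P} (hy : b.weightLE y x) (hne : y ≠ x) :
    innerK P k vol E (orbitSum (parabolic P I) y) = 0 := by
  rw [orbitSum, finsum_mem_eq_finite_toFinset_sum _ (finite_orbit I y), ← innerForm_apply hk,
    map_sum]
  refine Finset.sum_eq_zero fun z hz => ?_
  rw [Set.Finite.mem_toFinset, mem_orbit_parabolic] at hz
  obtain ⟨w, hw, rfl⟩ := hz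
  rw [innerForm_apply]
  by_cases hd : b.domRep y = b.domRep x
  · refine hE.inner_expW_eq_zero hk hk' (by rw [SimpleRoots.domRep_smul, hd]) fun h => hne ?_
    rcases SimpleRoots.weightLE_iff.1 h with h | h
    · rw [SimpleRoots.domRep_smul, hd] at h
      exact absurd rfl h.2
    · have h2 := h.parabolic_smul hI hx (inv_mem hw)
      rw [inv_smul_smul] at h2
      exact hy.antisymm (SimpleRoots.weightLE_iff.2 (Or.inr h2))
  · have hd' : b.domRep (w • y) ≠ b.domRep x := by rwa [SimpleRoots.domRep_smul]
    refine hE.orthogonal _ (SimpleRoots.weightLE_iff.2 (Or.inl ⟨?_, hd'⟩)) ?_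
    · rw [SimpleRoots.domRep_smul]; exact hy.1
    · rintro rfl
      exact hd' rfl

/-- The sum of the translates of `E(x, k)` under the minimal coset representatives satisfies the
conditions that define `p_I(x, k)`. -/
theorem IsNonsymmetric.isJacobi_sum {I : Set ι} (hI : I ⊆ b.support)
    {x : weightLattice P} (hx : x ∈ b.relDominant I) {E : Laurent P}
    (hE : IsNonsymmetric b k vol x E) :
    IsJacobi b k vol I x (∑ᶠ w ∈ b.minCosetReps I x, act w E) := by
  set q := ∑ᶠ w ∈ b.minCosetReps I x, act w E with hq
  -- The constant is the order of the stabilizer of `x` in `W_I`.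
  obtain ⟨c, hc, hcq, hcx⟩ : ∃ c : ℂ, c ≠ 0 ∧ symmetrize P I E = c • q ∧
      symmetrize P I (expW x) = c • orbitSum (parabolic P I) x := by
    refine ⟨(stabilizerFinset I x).card, ?_, ?_, ?_⟩
    · rw [Nat.cast_ne_zero, ← Nat.pos_iff_ne_zero, Finset.card_pos]
      exact ⟨1, mem_stabilizerFinset.2 ⟨one_mem _, one_smul _ _⟩⟩
    · rw [Nat.cast_smul_eq_nsmul, symmetrize_apply, hq]
      refine SimpleRoots.sum_parabolic hI hx (fun w => act w E) fun w v hv => ?_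
      rw [← act_act, hE.act_eq hk hk' hI hx hv]
    · rw [Nat.cast_smul_eq_nsmul, SimpleRoots.symmetrize_expW hI hx]
  have hqc : q = c⁻¹ • symmetrize P I E := by rw [hcq, inv_smul_smul₀ hc]
  refine ⟨fun w hw => ?_, ?_, fun y hy hyx hne => ?_⟩
  · rw [hqc, ← actHom_apply, map_smul, actHom_apply, act_symmetrize hw]
  · have h1 : q - orbitSum (parabolic P I) x = c⁻¹ • symmetrize P I (E - expW x) := by
      rw [map_sub, hcq, hcx, ← smul_sub, inv_smul_smul₀ hc]
    rw [h1]
    refine Submodule.smul_mem _ _ ?_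
    have h2 : b.lowerSpan x ≤ (Submodule.span ℂ (orbitSum (parabolic P I) ''
        {y : weightLattice P | y ∈ b.relDominant I ∧ b.weightLE y x ∧ y ≠ x})).comap
        (symmetrize P I) := by
      refine Submodule.span_le.2 ?_
      rintro _ ⟨y, ⟨hy, hne⟩, rfl⟩
      -- Symmetrizing `e^y` gives a multiple of the orbit sum of the representative of `y` in
      -- `P_I⁺`, which is the smallest element of the `W_I`-orbit and so stays below `x`.
      obtain ⟨w, hw, hwy⟩ := SimpleRoots.exists_relDominant (b := b) hI y
      have h3 : b.weightLE (w • y) y := by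
        have h4 := SimpleRoots.orbitLE_of_relDominant hI hwy (inv_mem hw)
        rw [inv_smul_smul] at h4
        exact SimpleRoots.weightLE_iff.2 (Or.inr h4)
      change symmetrize P I (expW y) ∈ Submodule.span ℂ (orbitSum (parabolic P I) ''
        {y : weightLattice P | y ∈ b.relDominant I ∧ b.weightLE y x ∧ y ≠ x})
      rw [← symmetrize_act hw, act_expW, SimpleRoots.symmetrize_expW hI hwy]
      refine nsmul_mem (Submodule.subset_span ?_) _
      exact ⟨w • y, ⟨hwy, h3.trans hy, h3.ne_of_ne hy hne⟩, rfl⟩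
    exact h2 hE.triangular
  · rw [hqc, ← innerForm_apply hk, map_smulₛₗ, symmetrize_apply, map_sum, LinearMap.smul_apply,
      LinearMap.sum_apply, Finset.sum_eq_zero, smul_zero]
    intro w hw
    rw [innerForm_apply, innerK_act_left hk', act_orbitSum (inv_mem (mem_parabolicFinset.1 hw))]
    exact hE.inner_orbitSum_eq_zero hk hk' hI hx hyx hne

omit hk' in
-- Invariance is automatic: the leading term and all corrections are orbit sums.
theorem existsUnique_isJacobi (I : Set ι) (x : weightLattice P) :
    ∃! p : Laurent P, IsJacobi b k vol I x p := by
  set S := {y : weightLattice P | y ∈ b.relDominant I ∧ b.weightLE y x ∧ y ≠ x}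
  have hfin : (orbitSum (parabolic P I) '' S).Finite :=
    ((SimpleRoots.finite_weightLE (b := b) x).subset fun y hy => hy.2.1).image _
  obtain ⟨p, ⟨h1, h2⟩, h3⟩ := existsUnique_projection hk vol hfin (orbitSum (parabolic P I) x)
  refine ⟨p, ⟨fun w hw => ?_, h1, fun y hy hyx hne => h2 _ ⟨y, ⟨hy, hyx, hne⟩, rfl⟩⟩,
    fun q hq => h3 q ⟨hq.triangular, ?_⟩⟩
  · have h4 : Submodule.span ℂ (orbitSum (parabolic P I) '' S) ≤
        LinearMap.eqLocus (actHom w) LinearMap.id := by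
      refine Submodule.span_le.2 ?_
      rintro _ ⟨y, -, rfl⟩
      exact act_orbitSum hw y
    have h5 : actHom w (p - orbitSum (parabolic P I) x) = p - orbitSum (parabolic P I) x := h4 h1
    rw [map_sub, actHom_apply, actHom_apply, act_orbitSum hw] at h5
    exact sub_left_injective h5
  · rintro _ ⟨y, ⟨hy, hyx, hne⟩, rfl⟩
    exact hq.orthogonal y hy hyx hne

omit hk hk'

theorem SimpleRoots.mem_relDominant_empty (x : weightLattice P) : x ∈ b.relDominant ∅ := by
  rintro i ⟨hi, -⟩
  rw [Set.image_empty, Submodule.span_empty, Submodule.mem_bot] at hi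
  exact absurd hi (P.ne_zero i)

theorem orbitSum_parabolic_empty (x : weightLattice P) : orbitSum (parabolic P ∅) x = expW x := by
  have h : MulAction.orbit (parabolic P ∅) x = {x} := by
    ext y
    rw [mem_orbit_parabolic, parabolic, Set.image_empty, Subgroup.closure_empty]
    simp [eq_comm]
  rw [orbitSum, h, finsum_mem_singleton]

theorem isJacobi_empty_iff {x : weightLattice P} {p : Laurent P} :
    IsJacobi b k vol ∅ x p ↔ IsNonsymmetric b k vol x p := by
  have h1 : orbitSum (parabolic P ∅) = expW := funext orbitSum_parabolic_empty
  have h2 := SimpleRoots.mem_relDominant_empty (b := b)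
  constructor
  · rintro ⟨-, h3, h4⟩
    rw [h1] at h3 h4
    exact ⟨by simpa only [h2, true_and] using h3, fun y => h4 y (h2 y)⟩
  · rintro ⟨h3, h4⟩
    refine ⟨fun w hw => ?_, ?_, fun y _ => ?_⟩
    · rw [parabolic, Set.image_empty, Subgroup.closure_empty, Subgroup.mem_bot] at hw
      rw [hw, act_one]
    · rw [h1]
      simpa only [h2, true_and] using h3
    · rw [h1]; exact h4 y

theorem SimpleRoots.weightLE_iff_domLE {x y : weightLattice P} (hx : x ∈ b.dominant)
    (hy : y ∈ b.dominant) : b.weightLE y x ↔ b.domLE y x := by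
  rw [SimpleRoots.weightLE, domRep_of_dominant hx, domRep_of_dominant hy]
  refine ⟨fun h => h.1, fun h => ⟨h, ?_⟩⟩
  rintro rfl
  exact Relation.ReflTransGen.refl

include hk in
theorem isJacobi_support_iff {x : weightLattice P} (hx : x ∈ b.dominant) {p : Laurent P} :
    IsJacobi b k vol b.support x p ↔ IsSymmetric b k vol x p := by
  have hset : {y : weightLattice P | y ∈ b.dominant ∧ b.weightLE y x ∧ y ≠ x} =
      {y : weightLattice P | y ∈ b.dominant ∧ b.domLE y x ∧ y ≠ x} := by
    ext y
    exact and_congr_right fun hy => by rw [SimpleRoots.weightLE_iff_domLE hx hy]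
  have key : ∀ p, IsJacobi b k vol b.support x p → IsSymmetric b k vol x p := by
    rintro p ⟨-, h3, h4⟩
    rw [b.parabolic_support, b.relDominant_support] at h3 h4
    rw [hset] at h3
    exact ⟨h3, fun y hy hyx => h4 y hy ((SimpleRoots.weightLE_iff_domLE hx hy).2 hyx)⟩
  refine ⟨key p, fun h => ?_⟩
  -- Invariance is not part of the conditions for `P(x, k)`; it is obtained by comparison with the
  -- Jacobi polynomial, which satisfies the same conditions.
  obtain ⟨q, hq, -⟩ := existsUnique_isJacobi (b := b) (vol := vol) hk b.support x
  have hq' := key q hq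
  have : p = q := by
    refine eq_of_sub_mem_span hk vol (S := orbitSum ⊤ ''
      {y : weightLattice P | y ∈ b.dominant ∧ b.domLE y x ∧ y ≠ x}) ?_ ?_ ?_
    · simpa using sub_mem h.triangular hq'.triangular
    · rintro _ ⟨y, ⟨hy, hyx, hne⟩, rfl⟩
      exact h.orthogonal y hy hyx hne
    · rintro _ ⟨y, ⟨hy, hyx, hne⟩, rfl⟩
      exact hq'.orthogonal y hy hyx hne
  rw [this]
  exact hq

end Symmetrization
end HeckmanOpdam
end

/-! ### The proposition -/

theorem mainTheorem3 {ι M N : Type*} [Fintype ι] [AddCommGroup M] [Module ℝ M]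
    [NormedAddCommGroup N] [NormedSpace ℝ N]
    (P : RootPairing ι ℝ M N) [P.IsRootSystem] [P.IsCrystallographic]
    (b : HeckmanOpdam.SimpleRoots P)
    (k : ι → ℝ) (k_nonneg : ∀ i, 0 ≤ k i) (k_inv : ∀ i j, k (P.reflectionPerm i j) = k j)
    (vol : MeasureTheory.Measure (HeckmanOpdam.Torus P)) [vol.IsAddHaarMeasure] :
    -- the polynomials `E(x, k)`, `P(x, k)` and `p_I(x, k)` are well defined
    (∀ x : HeckmanOpdam.weightLattice P,
      ∃! E : HeckmanOpdam.Laurent P, HeckmanOpdam.IsNonsymmetric b k vol x E) ∧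
    (∀ x ∈ b.dominant, ∃! p : HeckmanOpdam.Laurent P, HeckmanOpdam.IsSymmetric b k vol x p) ∧
    (∀ I ⊆ b.support, ∀ x ∈ b.relDominant I,
      ∃! p : HeckmanOpdam.Laurent P, HeckmanOpdam.IsJacobi b k vol I x p) ∧
    -- `p_I(x, k)` is the symmetrization of `E(x, k)`
    (∀ I ⊆ b.support, ∀ x ∈ b.relDominant I, ∀ p E : HeckmanOpdam.Laurent P,
      HeckmanOpdam.IsJacobi b k vol I x p → HeckmanOpdam.IsNonsymmetric b k vol x E →
        p = ∑ᶠ w ∈ b.minCosetReps I x, HeckmanOpdam.act w E) ∧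
    -- the extreme cases
    (∀ x : HeckmanOpdam.weightLattice P, x ∈ b.relDominant ∅ ∧
      ∀ p, HeckmanOpdam.IsJacobi b k vol ∅ x p ↔ HeckmanOpdam.IsNonsymmetric b k vol x p) ∧
    (b.relDominant b.support = b.dominant ∧ ∀ x ∈ b.dominant,
      ∀ p, HeckmanOpdam.IsJacobi b k vol b.support x p ↔ HeckmanOpdam.IsSymmetric b k vol x p) := by
  have key : ∀ x ∈ b.dominant, ∀ p, HeckmanOpdam.IsJacobi b k vol b.support x p ↔
      HeckmanOpdam.IsSymmetric b k vol x p := fun x hx p =>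
    HeckmanOpdam.isJacobi_support_iff k_nonneg hx
  refine ⟨fun x => HeckmanOpdam.existsUnique_isNonsymmetric b k_nonneg vol x, fun x hx => ?_,
    fun I _ x _ => HeckmanOpdam.existsUnique_isJacobi k_nonneg I x,
    fun I hI x hx p E hp hE => ?_,
    fun x => ⟨HeckmanOpdam.SimpleRoots.mem_relDominant_empty x,
      fun p => HeckmanOpdam.isJacobi_empty_iff⟩,
    b.relDominant_support, key⟩
  · simpa only [key x hx] using
      HeckmanOpdam.existsUnique_isJacobi (b := b) (vol := vol) k_nonneg b.support x
  · exact (HeckmanOpdam.existsUnique_isJacobi k_nonneg I x).unique hp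
      (hE.isJacobi_sum k_nonneg k_inv hI hx)
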